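/- Let $G$ be a finite connected 3-regular planar graph, and fix a planar straight-line drawing of $G$ (distinct vertices at distinct points, no vertex on an edge it is not an endpoint of, distinct edges meeting at most in a common endpoint). An arrangement $A_G$ is constructed from the drawing as follows. Guide disks. Let $\delta$ be the smallest distance in the drawing between a vertex and another vertex or a non-incident edge. For every edge $uv$ take two disks, centred at the points $2/5$ and $3/5$ of the way from $u$ to $v$; for every vertex $v$ take three disks, centred at distance $\delta/5$ from $v$ on the bisectors of the three wedges formed by the edges at $v$. All disks are closed and have the same radius $\rho>0$, such that: no two of the disks intersect; a disk on an edge meets no other edge and no vertex; a disk near a vertex meets no edge and no vertex; and for every edge $uv$ no line segment meets both disks on $uv$ and a disk in one of the four wedges bounded by $uv$. Segments. For every vertex $v$, every edge $va$ and each of the two wedges at $v$ bounded by $va$, there is a red segment with one endpoint in the disk of that wedge and the other in the disk on $va$ centred $3/5$ of the way from $v$ to $a$. For every guide disk there is a blue segment with both endpoints in that disk. The endpoints are chosen so that, for every guide disk, the two red segments with an endpoint in it are disjoint and its blue segment properly crosses both of them. $A_G$ is the family of all these red and blue segments. Then such choices of $\rho$ and of the endpoints exist for every planar straight-line drawing of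 $G$, and for all such choices the following holds. (a) $A_G$ is a red–blue arrangement: it is a finite family of (nondegenerate) red and blue segments in which every intersection point of two segments is a proper crossing point of exactly two segments; each blue segment is crossed by exactly two other segments, both red; each red segment is crossed by exactly three other segments, in the order blue–red–blue; and the union of the segments is connected. (b) There is a bijection between the independent sets of $G$ and the maximum-size non-crossing subsets of $A_G$ (the largest sets of segments no two of which cross), such that for every $k$ an independent set has size $k$ if and only if the corresponding non-crossing subset has exactly $6k$ red segments. -/

import Mathlib

namespace RedBlue

/-- The Euclidean plane. -/
abbrev Plane : Type := EuclideanSpace ℝ (Fin 2)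

/-! ### Coloured segments and red–blue arrangements -/

inductive Color : Type
  | red
  | blue
  deriving DecidableEq

/-- A family of coloured line segments in the plane, given by their endpoints. -/
structure ColoredSegments (ι : Type*) where
  fst : ι → Plane
  snd : ι → Plane
  color : ι → Color

namespace ColoredSegments

variable {ι : Type*} (A : ColoredSegments ι)

/-- The point set of the `i`-th segment. -/
def seg (i : ι) : Set Plane := segment ℝ (A.fst i) (A.snd i)

/-- Two nondegenerate segments cross (properly): they have exactly one common point, and it is
interior to both. -/
def Crosses (i j : ι) : Prop :=
  A.fst i ≠ A.snd i ∧ A.fst j ≠ A.snd j ∧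
    ∃ x, x ∈ openSegment ℝ (A.fst i) (A.snd i) ∧ x ∈ openSegment ℝ (A.fst j) (A.snd j) ∧
      A.seg i ∩ A.seg j = {x}

structure IsRedBlueArrangement : Prop where
  finite : Finite ι
  nondegenerate : ∀ i, A.fst i ≠ A.snd i
  /-- Each intersection point of two segments is a proper crossing point … -/
  proper : ∀ i j, i ≠ j → (A.seg i ∩ A.seg j).Nonempty → A.Crosses i j
  /-- … of exactly two segments. -/
  no_three : ∀ i j k, i ≠ j → j ≠ k → i ≠ k → A.seg i ∩ A.seg j ∩ A.seg k = ∅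
  /-- Each blue segment is crossed by exactly two other segments, both red. -/
  blue_crossings : ∀ i, A.color i = Color.blue →
    ∃ j k, j ≠ k ∧ A.color j = Color.red ∧ A.color k = Color.red ∧
      {m | m ≠ i ∧ A.Crosses i m} = {j, k}
  /-- Each red segment is crossed by exactly three other segments, in the order
  blue–red–blue. -/
  red_crossings : ∀ i, A.color i = Color.red →
    ∃ j k l, j ≠ l ∧ A.color j = Color.blue ∧ A.color k = Color.red ∧ A.color l = Color.blue ∧
      {m | m ≠ i ∧ A.Crosses i m} = {j, k, l} ∧
      ∃ x y z, x ∈ A.seg i ∩ A.seg j ∧ y ∈ A.seg i ∩ A.seg k ∧ z ∈ A.seg i ∩ A.seg l ∧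
        Sbtw ℝ x y z
  connected : IsConnected (⋃ i, A.seg i)

def NonCrossing (S : Finset ι) : Prop :=
  ∀ i ∈ S, ∀ j ∈ S, i ≠ j → ¬ A.Crosses i j

def IsMaxNonCrossing (S : Finset ι) : Prop :=
  A.NonCrossing S ∧ ∀ T : Finset ι, A.NonCrossing T → T.card ≤ S.card

/-- The number of red segments in a finite subset. -/
def redCount (S : Finset ι) : ℕ := (S.filter fun i => A.color i = Color.red).card

end ColoredSegments

/-! ### Straight-line drawings -/

/-- A planar straight-line drawing of `G`: distinct vertices at distinct points, no vertex on an
edge that it is not an endpoint of, and two distinct edges meet at most in a common endpoint. -/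
structure StraightLineDrawing {V : Type*} (G : SimpleGraph V) where
  pos : V → Plane
  injective : Function.Injective pos
  vertex_notMem : ∀ v a b, G.Adj a b → v ≠ a → v ≠ b → pos v ∉ segment ℝ (pos a) (pos b)
  edge_inter : ∀ a b c d, G.Adj a b → G.Adj c d → s(a, b) ≠ s(c, d) →
    segment ℝ (pos a) (pos b) ∩ segment ℝ (pos c) (pos d) ⊆
      {pos a, pos b} ∩ {pos c, pos d}

section Construction

variable {V : Type*} {G : SimpleGraph V}

/-- The smallest distance, in the drawing, between a vertex and another vertex or an edge that is
not incident to it. -/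
noncomputable def StraightLineDrawing.clearance (D : StraightLineDrawing G) : ℝ :=
  sInf ({t | ∃ v w, v ≠ w ∧ t = dist (D.pos v) (D.pos w)} ∪
    {t | ∃ v a b, G.Adj a b ∧ v ≠ a ∧ v ≠ b ∧
      t = Metric.infDist (D.pos v) (segment ℝ (D.pos a) (D.pos b))})

/-- Names of the guide disks of a cubic graph. For a dart `d` from `v` to `a`, `onEdge d` is the
disk on the edge `va` that belongs to `v`, and `inWedge d` is the disk at `v` in the wedge bounded
by the two edges at `v` other than `va`. So there are two disks on each edge and three at each
vertex. -/
inductive GuideDisk (G : SimpleGraph V) : Type _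
  | onEdge (d : G.Dart)
  | inWedge (d : G.Dart)

/-- Names of the red segments: one for each edge at a vertex `v` (the dart `edge`) and each of
the two wedges at `v` bounded by that edge (the wedge opposite to the dart `opp`). -/
structure RedLabel (G : SimpleGraph V) where
  edge : G.Dart
  opp : G.Dart
  same_vertex : opp.fst = edge.fst
  ne : opp ≠ edge

/-- Names of all segments: the red ones, and one blue segment for each guide disk. -/
inductive SegLabel (G : SimpleGraph V) : Type _
  | red (r : RedLabel G)
  | blue (q : GuideDisk G)

/-- A red segment has one endpoint in each of two guide disks: the one of its wedge and
the one of its vertex on its edge. -/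
def RedLabel.Touches (r : RedLabel G) (q : GuideDisk G) : Prop :=
  q = GuideDisk.inWedge r.opp ∨ q = GuideDisk.onEdge r.edge

/-- `x` is the centre of the guide disk in the wedge at `d.fst` opposite to the edge `d`: it is at
one fifth of the clearance from the vertex, it makes equal angles with the two edges
that bound the wedge, and the third edge makes a larger angle with it (which singles out, of the
two opposite directions bisecting the two edges, the one inside the wedge). -/
structure IsWedgeCenter (D : StraightLineDrawing G) (d : G.Dart) (x : Plane) : Prop where
  dist_eq : dist x (D.pos d.fst) = D.clearance / 5
  angle_eq : ∀ a b, G.Adj d.fst a → G.Adj d.fst b → a ≠ d.snd → b ≠ d.snd →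
    EuclideanGeometry.angle x (D.pos d.fst) (D.pos a) =
      EuclideanGeometry.angle x (D.pos d.fst) (D.pos b)
  angle_lt : ∀ a, G.Adj d.fst a → a ≠ d.snd →
    EuclideanGeometry.angle x (D.pos d.fst) (D.pos a) <
      EuclideanGeometry.angle x (D.pos d.fst) (D.pos d.snd)

/-- The choices made in the construction of an arrangement from the drawing `D`: the centres and
the common radius of the guide disks, and the endpoints of the red and blue segments in the
guide disks. -/
structure Choices (D : StraightLineDrawing G) where
  /-- centres of the disks near the vertices -/
  wedgeCenter : G.Dart → Plane
  /-- radius of all guide disks -/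
  rho : ℝ
  /-- endpoint of a red segment near its vertex -/
  redNear : RedLabel G → Plane
  /-- endpoint of a red segment on its edge -/
  redFar : RedLabel G → Plane
  blueFst : GuideDisk G → Plane
  blueSnd : GuideDisk G → Plane

namespace Choices

variable {D : StraightLineDrawing G} (C : Choices D)

/-- Centres of the guide disks. The red segments of a vertex `v` along an edge `va` end in the disk
centred at `3/5` of the way from `v` to `a`; for the reversed dart this gives the disk at `2/5`. -/
noncomputable def center : GuideDisk G → Plane
  | .onEdge d => AffineMap.lineMap (D.pos d.fst) (D.pos d.snd) (3 / 5 : ℝ)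
  | .inWedge d => C.wedgeCenter d

def disk (q : GuideDisk G) : Set Plane := Metric.closedBall (C.center q) C.rho

/-- The resulting family of coloured segments. -/
def arrangement : ColoredSegments (SegLabel G) where
  fst
    | .red r => C.redNear r
    | .blue q => C.blueFst q
  snd
    | .red r => C.redFar r
    | .blue q => C.blueSnd q
  color
    | .red _ => Color.red
    | .blue _ => Color.blue

/-- The rules of the construction. -/
structure Valid : Prop where
  wedgeCenter_spec : ∀ d : G.Dart, IsWedgeCenter D d (C.wedgeCenter d)
  rho_pos : 0 < C.rho
  /-- No two guide disks intersect each other. -/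
  disks_disjoint : ∀ q q' : GuideDisk G, q ≠ q' → Disjoint (C.disk q) (C.disk q')
  /-- A guide disk on an edge does not intersect any other edge … -/
  onEdge_edge : ∀ (d : G.Dart) (a b : V), G.Adj a b → s(a, b) ≠ d.edge →
    Disjoint (C.disk (.onEdge d)) (segment ℝ (D.pos a) (D.pos b))
  /-- … or vertex. -/
  onEdge_vertex : ∀ (d : G.Dart) (v : V), D.pos v ∉ C.disk (.onEdge d)
  /-- A guide disk near a vertex does not intersect any edge … -/
  inWedge_edge : ∀ (d : G.Dart) (a b : V), G.Adj a b →
    Disjoint (C.disk (.inWedge d)) (segment ℝ (D.pos a) (D.pos b))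
  /-- … or vertex. -/
  inWedge_vertex : ∀ (d : G.Dart) (v : V), D.pos v ∉ C.disk (.inWedge d)
  /-- No segment meets the two guide disks on an edge and a guide disk in one of the four wedges
  bounded by this edge (two at each end; both ends are covered since `d` may be reversed). -/
  no_transversal : ∀ d e : G.Dart, e.fst = d.fst → e ≠ d → ¬ ∃ x y : Plane,
    (segment ℝ x y ∩ C.disk (.onEdge d)).Nonempty ∧
    (segment ℝ x y ∩ C.disk (.onEdge d.symm)).Nonempty ∧
    (segment ℝ x y ∩ C.disk (.inWedge e)).Nonempty
  /-- The endpoints lie in the guide disks. -/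
  redNear_mem : ∀ r : RedLabel G, C.redNear r ∈ C.disk (.inWedge r.opp)
  redFar_mem : ∀ r : RedLabel G, C.redFar r ∈ C.disk (.onEdge r.edge)
  blueFst_mem : ∀ q, C.blueFst q ∈ C.disk q
  blueSnd_mem : ∀ q, C.blueSnd q ∈ C.disk q
  /-- Within each guide disk, the endpoints are placed so that the two red segments that end there
  are disjoint and the blue segment of the disk crosses both of them. -/
  red_disjoint : ∀ (q : GuideDisk G) (r r' : RedLabel G), r ≠ r' → r.Touches q → r'.Touches q →
    Disjoint (C.arrangement.seg (.red r)) (C.arrangement.seg (.red r'))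
  blue_crosses : ∀ (q : GuideDisk G) (r : RedLabel G), r.Touches q →
    C.arrangement.Crosses (.blue q) (.red r)

end Choices

end Construction

end RedBlue

/-! Combinatorics. At each vertex there are six guide disks and six red segments; each red segment
ends in two of the disks and each disk contains two red ends, so red and blue segments at the vertex
form a cycle of twelve successive crossings. A set `R` of red segments touches at least `|R|` disks
by double counting, and the blue segments of touched disks are excluded from a non-crossing set.
Hence a non-crossing set has at most as many elements as there are disks, and equality forces all
red or all blue at every vertex (`Choices.Valid.card_le`, `same_vertex_induction`). Red segments of
adjacent vertices cross somewhere (`Choices.Valid.exists_partner`), so the all-red vertices of a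
maximum set are independent. Conversely `selection Z` attains the bound for independent `Z`, and
every vertex of `Z` contributes six red segments.

Geometry. What remains is to find all intersections. Blue segments stay in disjoint disks, so the
question is which disks and which other red segments a red segment meets. The quantitative input on
the radius is the rule against transversals: it yields `20 * ρ < δ * |sin θ|`, where `θ` is the
angle between an edge and the bisector of an adjacent wedge (`Choices.Valid.rho_lt`). With this
margin linear functionals separate the objects. For two edges at a vertex, take the cross product
with the bisector of the wedge between them (`exists_corner_functional`). For red segments on
different sides of one edge, take the common internal tangent of the two disks on it
(`exists_tangent_functional`). Objects along disjoint edges are kept apart by the clearance, since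
the distance of two disjoint segments is attained at an endpoint. On one side of an edge, the two
red segments from its ends do cross, by the orientations of the endpoint triples
(`red_orientation`). The order blue–red–blue follows from convexity of the disks.

Existence. The red ends are offset by `ρ/2` from the disk centres, across the bisector or across the
edge, towards the side where the segment belongs. Two red segments sharing a disk are then separated
by a line, and everything else required holds for all sufficiently small `ρ`. -/

namespace RedBlue

/-! ### Coordinates in the plane -/

/-- The cross product `u ↦ x ↦ u × x`, linear in `x`. -/
noncomputable def cr (u : Plane) : Plane →ₗ[ℝ] ℝ where
  toFun x := u 0 * x 1 - u 1 * x 0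
  map_add' x y := by simp only [PiLp.add_apply]; ring
  map_smul' c x := by simp only [PiLp.smul_apply, smul_eq_mul, RingHom.id_apply]; ring

/-- The dot product as a linear map in the second variable. -/
noncomputable def dt (u : Plane) : Plane →ₗ[ℝ] ℝ where
  toFun x := u 0 * x 0 + u 1 * x 1
  map_add' x y := by simp only [PiLp.add_apply]; ring
  map_smul' c x := by simp only [PiLp.smul_apply, smul_eq_mul, RingHom.id_apply]; ring

/-- Rotation by a right angle. -/
noncomputable def rot (u : Plane) : Plane := !₂[-u 1, u 0]

lemma cr_apply (u x : Plane) : cr u x = u 0 * x 1 - u 1 * x 0 := rfl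
lemma dt_apply (u x : Plane) : dt u x = u 0 * x 0 + u 1 * x 1 := rfl
@[simp] lemma rot_zero (u : Plane) : rot u 0 = -u 1 := by simp [rot]
@[simp] lemma rot_one (u : Plane) : rot u 1 = u 0 := by simp [rot]

lemma plane_ext {x y : Plane} (h0 : x 0 = y 0) (h1 : x 1 = y 1) : x = y := by
  ext i; fin_cases i <;> assumption

lemma inner_eq_dt (x y : Plane) : inner ℝ x y = dt x y := by
  simp [PiLp.inner_apply, Fin.sum_univ_two, dt_apply, mul_comm]

lemma norm_sq_eq (x : Plane) : ‖x‖ ^ 2 = x 0 ^ 2 + x 1 ^ 2 := by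
  simp [EuclideanSpace.norm_sq_eq, Fin.sum_univ_two]

lemma dt_sq_add_cr_sq (x y : Plane) : dt x y ^ 2 + cr x y ^ 2 = ‖x‖ ^ 2 * ‖y‖ ^ 2 := by
  rw [norm_sq_eq, norm_sq_eq, dt_apply, cr_apply]; ring

lemma abs_cr_le (x y : Plane) : |cr x y| ≤ ‖x‖ * ‖y‖ := by
  apply abs_le_of_sq_le_sq _ (by positivity)
  have := dt_sq_add_cr_sq x y
  nlinarith [sq_nonneg (dt x y)]

lemma abs_dt_le (x y : Plane) : |dt x y| ≤ ‖x‖ * ‖y‖ := by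
  apply abs_le_of_sq_le_sq _ (by positivity)
  have := dt_sq_add_cr_sq x y
  nlinarith [sq_nonneg (cr x y)]

lemma cr_comm (x y : Plane) : cr x y = - cr y x := by simp only [cr_apply]; ring
lemma dt_comm (x y : Plane) : dt x y = dt y x := by simp only [dt_apply]; ring
lemma cr_self (x : Plane) : cr x x = 0 := by simp only [cr_apply]; ring
lemma dt_self (x : Plane) : dt x x = ‖x‖ ^ 2 := by rw [norm_sq_eq, dt_apply]; ring
lemma cr_smul_left (c : ℝ) (x y : Plane) : cr (c • x) y = c * cr x y := by
  simp only [cr_apply, PiLp.smul_apply, smul_eq_mul]; ring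
lemma dt_smul_left (c : ℝ) (x y : Plane) : dt (c • x) y = c * dt x y := by
  simp only [dt_apply, PiLp.smul_apply, smul_eq_mul]; ring
lemma cr_neg_left (x y : Plane) : cr (-x) y = - cr x y := by
  simp only [cr_apply, PiLp.neg_apply]; ring
lemma cr_rot_right (x y : Plane) : cr x (rot y) = dt x y := by
  simp only [cr_apply, dt_apply, rot_zero, rot_one]; ring
lemma dt_rot_right (x y : Plane) : dt x (rot y) = - cr x y := by
  simp only [cr_apply, dt_apply, rot_zero, rot_one]; ring
lemma norm_rot (x : Plane) : ‖rot x‖ = ‖x‖ := by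
  rw [← sq_eq_sq₀ (norm_nonneg _) (norm_nonneg _), norm_sq_eq, norm_sq_eq, rot_zero, rot_one]; ring

lemma eq_frame {u : Plane} (hu : ‖u‖ = 1) (x : Plane) : x = dt u x • u + cr u x • rot u := by
  have h := norm_sq_eq u
  rw [hu] at h
  apply plane_ext <;> simp only [dt_apply, cr_apply, PiLp.add_apply, PiLp.smul_apply, smul_eq_mul,
    rot_zero, rot_one]
  · linear_combination (x 0) * h
  · linear_combination (x 1) * h

/-! ### Unit vectors and bisectors -/

/-- A unit vector is determined by its component along `n` up to reflection in the axis `n`.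
Distinct vectors with the same component are therefore mirror images. -/
lemma cr_neg_of_dt_eq {n p q : Plane} (hn : ‖n‖ = 1) (hp : ‖p‖ = 1) (hq : ‖q‖ = 1) (hpq : p ≠ q)
    (h : dt n p = dt n q) : cr n q = - cr n p := by
  have h1 := dt_sq_add_cr_sq n p
  have h2 := dt_sq_add_cr_sq n q
  rw [hn, hp] at h1
  rw [hn, hq] at h2
  have h3 : (cr n q - cr n p) * (cr n q + cr n p) = 0 := by rw [h] at h1; linarith
  rcases mul_eq_zero.1 h3 with h4 | h4
  · exfalso; apply hpq
    rw [eq_frame hn p, eq_frame hn q, h, sub_eq_zero.1 h4]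
  · linarith

lemma cr_ne_zero_of_dt_eq {n p q : Plane} (hn : ‖n‖ = 1) (hp : ‖p‖ = 1) (hq : ‖q‖ = 1)
    (hpq : p ≠ q) (h : dt n p = dt n q) : cr n p ≠ 0 := by
  intro h0
  apply hpq
  rw [eq_frame hn p, eq_frame hn q, h, cr_neg_of_dt_eq hn hp hq hpq h, h0, neg_zero]

lemma norm_sub_of_dt_eq {n p q : Plane} (hn : ‖n‖ = 1) (hp : ‖p‖ = 1) (hq : ‖q‖ = 1)
    (hpq : p ≠ q) (h : dt n p = dt n q) : ‖p - q‖ = 2 * |cr n p| := by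
  rw [← sq_eq_sq₀ (norm_nonneg _) (by positivity), mul_pow, sq_abs]
  have h1 := dt_sq_add_cr_sq n (p - q)
  rw [map_sub, map_sub, cr_neg_of_dt_eq hn hp hq hpq h, h, hn] at h1
  linarith

lemma dt_sub_of_dt_eq {n p q : Plane} (hn : ‖n‖ = 1) (hp : ‖p‖ = 1) (hq : ‖q‖ = 1)
    (hpq : p ≠ q) (h : dt n p = dt n q) (m : Plane) :
    dt m (p - q) = 2 * cr n m * cr n p := by
  have h1 := cr_neg_of_dt_eq hn hp hq hpq h
  have h2 : p - q = (2 * cr n p) • rot n := by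
    rw [eq_frame hn (p - q), map_sub, map_sub, h1, h]
    simp only [sub_self, zero_smul, zero_add, sub_neg_eq_add, two_mul]
  rw [h2, map_smul, dt_rot_right, cr_comm m n, smul_eq_mul]; ring

/-- The angle between two bisectors sharing the side `p` is half the angle between the other
sides. -/
lemma cr_sq_bisectors {n m l p q r : Plane} (hn : ‖n‖ = 1) (hm : ‖m‖ = 1) (hl : ‖l‖ = 1)
    (hp : ‖p‖ = 1) (hq : ‖q‖ = 1) (hr : ‖r‖ = 1) (hpq : p ≠ q) (hpr : p ≠ r) (hqr : q ≠ r)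
    (h1 : dt n p = dt n q) (h2 : dt m p = dt m r) (h3 : dt l q = dt l r) :
    |cr n m| = |cr l q| := by
  rw [← sq_eq_sq_iff_abs_eq_abs]
  have e1 := norm_sub_of_dt_eq hl hq hr hqr h3
  have e2 : ‖q - r‖ ^ 2 = 4 * cr l q ^ 2 := by rw [e1, mul_pow, sq_abs]; ring
  have c1 := cr_neg_of_dt_eq hn hp hq hpq h1
  have c2 := cr_neg_of_dt_eq hm hp hr hpr h2
  -- Both `q` and `r` are reflections of `p`, in the axes `n` and `m`. Hence `r` is `q` rotated by
  -- twice the angle from `n` to `m`, and the double-angle formula gives `e4`.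
  have q1 : q = dt n p • n - cr n p • rot n := by
    rw [h1]; conv_lhs => rw [eq_frame hn q]
    rw [c1]; module
  have r1 : r = dt m p • m - cr m p • rot m := by
    rw [h2]; conv_lhs => rw [eq_frame hm r]
    rw [c2]; module
  have e3 : ‖q - r‖ ^ 2 = 2 - 2 * dt q r := by
    have a := norm_sq_eq q; have b := norm_sq_eq r
    rw [hq] at a; rw [hr] at b
    rw [norm_sq_eq, dt_apply]; simp only [PiLp.sub_apply]; linarith
  have e4 : dt q r = 1 - 2 * cr n m ^ 2 := by
    have a := norm_sq_eq n; have b := norm_sq_eq m; have c := norm_sq_eq p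
    rw [hn] at a; rw [hm] at b; rw [hp] at c
    have d := dt_sq_add_cr_sq n m
    rw [hn, hm] at d
    have : dt q r = (p 0 ^ 2 + p 1 ^ 2) * (dt n m ^ 2 - cr n m ^ 2) := by
      rw [q1, r1]
      simp only [dt_apply, cr_apply, PiLp.sub_apply, PiLp.smul_apply, smul_eq_mul, rot_zero,
        rot_one]
      ring
    rw [this, ← c]; linarith
  linarith

/-! ### Segments -/

lemma le_of_mem_segment {f : Plane →ₗ[ℝ] ℝ} {c : ℝ} {x y z : Plane} (hx : c ≤ f x) (hy : c ≤ f y)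
    (hz : z ∈ segment ℝ x y) : c ≤ f z := by
  obtain ⟨a, b, ha, hb, hab, rfl⟩ := hz
  simp only [map_add, map_smul, smul_eq_mul]
  obtain rfl : b = 1 - a := by linarith
  nlinarith [mul_le_mul_of_nonneg_left hx ha, mul_le_mul_of_nonneg_left hy hb]

lemma lt_of_mem_segment {f : Plane →ₗ[ℝ] ℝ} {c : ℝ} {x y z : Plane} (hx : c < f x) (hy : c < f y)
    (hz : z ∈ segment ℝ x y) : c < f z :=
  lt_of_lt_of_le (lt_min hx hy) (le_of_mem_segment (min_le_left _ _) (min_le_right _ _) hz)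

/-- Two segments meeting transversally at a common interior point have no other common point. -/
lemma segment_inter_eq {a b c d x : Plane} (hx : x ∈ segment ℝ a b) (hx' : x ∈ segment ℝ c d)
    (h : cr (b - a) (d - c) ≠ 0) : segment ℝ a b ∩ segment ℝ c d = {x} := by
  refine Set.eq_singleton_iff_unique_mem.2 ⟨⟨hx, hx'⟩, ?_⟩
  rintro y ⟨hy, hy'⟩
  rw [segment_eq_image'] at hx hx' hy hy'
  obtain ⟨s, -, rfl⟩ := hx
  obtain ⟨t, -, ht⟩ := hx'
  obtain ⟨s', -, rfl⟩ := hy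
  obtain ⟨t', -, ht'⟩ := hy'
  have e : (t' - t) • (d - c) = (s' - s) • (b - a) := by
    simp only at ht ht'
    rw [← sub_eq_zero] at ht ht' ⊢
    rw [← sub_zero (0 : Plane)]; nth_rw 1 [← ht']; rw [← ht]; module
  have e2 : (t' - t) * cr (b - a) (d - c) = 0 := by
    have := congrArg (cr (b - a)) e
    simpa only [map_smul, smul_eq_mul, cr_self, mul_zero] using this
  have e3 : (s' - s) * cr (b - a) (d - c) = 0 := by
    have := congrArg (cr (d - c)) e
    simp only [map_smul, smul_eq_mul, cr_self, mul_zero] at this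
    rw [cr_comm]; linarith
  rcases mul_eq_zero.1 e3 with h3 | h3
  · rw [sub_eq_zero.1 h3]
  · exact absurd h3 h

/-- Proper crossing from the orientations of the four endpoint triples. -/
lemma exists_crossing {a b c d : Plane}
    (h1 : cr (b - a) (c - a) * cr (b - a) (d - a) < 0)
    (h2 : cr (d - c) (a - c) * cr (d - c) (b - c) < 0) :
    ∃ x, x ∈ openSegment ℝ a b ∧ x ∈ openSegment ℝ c d ∧ segment ℝ a b ∩ segment ℝ c d = {x} := by
  set A := cr (b - a) (c - a) with hA
  set B := cr (b - a) (d - a) with hB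
  set A' := cr (d - c) (a - c) with hA'
  set B' := cr (d - c) (b - c) with hB'
  have k1 : cr (b - a) (d - c) = B - A := by
    rw [hA, hB, ← map_sub]; congr 1; abel
  have k2 : cr (b - a) (d - c) = A' - B' := by
    rw [hA', hB', ← map_sub, cr_comm, ← map_neg]; congr 1; abel
  have hne : B - A ≠ 0 := by intro h; rw [sub_eq_zero.1 h] at h1; nlinarith
  have hne' : A' - B' ≠ 0 := by rw [← k2, k1]; exact hne
  -- Cramer's rule for the intersection of the two lines. Opposite signs of `A`, `B` and of `A'`,
  -- `B'` put the parameters strictly between 0 and 1.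
  set s := A' / (A' - B') with hs
  set t := A / (A - B) with ht
  have hne2 : A - B ≠ 0 := by intro h; apply hne; linarith
  have hs01 : 0 < s ∧ 0 < 1 - s := by
    have e : 1 - s = -B' / (A' - B') := by rw [hs]; field_simp; ring
    rw [e]
    rcases lt_or_gt_of_ne (show A' ≠ 0 by intro h; rw [h] at h2; simp at h2) with h | h
    · have : 0 < B' := by nlinarith
      exact ⟨div_pos_of_neg_of_neg h (by linarith), div_pos_of_neg_of_neg (by linarith) (by linarith)⟩
    · have : B' < 0 := by nlinarith
      exact ⟨div_pos h (by linarith), div_pos (by linarith) (by linarith)⟩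
  have ht01 : 0 < t ∧ 0 < 1 - t := by
    have e : 1 - t = -B / (A - B) := by rw [ht]; field_simp; ring
    rw [e]
    rcases lt_or_gt_of_ne (show A ≠ 0 by intro h; rw [h] at h1; simp at h1) with h | h
    · have : 0 < B := by nlinarith
      exact ⟨div_pos_of_neg_of_neg h (by linarith), div_pos_of_neg_of_neg (by linarith) (by linarith)⟩
    · have : B < 0 := by nlinarith
      exact ⟨div_pos h (by linarith), div_pos (by linarith) (by linarith)⟩
  have key : (1 - s) • a + s • b = (1 - t) • c + t • d := by
    have es : s * (B - A) = A' := by rw [hs, ← k1, k2]; field_simp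
    have et : t * (B - A) = -A := by rw [ht]; field_simp; ring
    apply plane_ext <;> apply mul_left_cancel₀ hne <;>
    · simp only [PiLp.add_apply, PiLp.smul_apply, smul_eq_mul]
      rw [← sub_eq_zero]
      first
      | rw [show (B - A) * ((1 - s) * a 0 + s * b 0) - (B - A) * ((1 - t) * c 0 + t * d 0)
          = (B - A) * (a 0 - c 0) + (s * (B - A)) * (b 0 - a 0) - (t * (B - A)) * (d 0 - c 0) by ring]
      | rw [show (B - A) * ((1 - s) * a 1 + s * b 1) - (B - A) * ((1 - t) * c 1 + t * d 1)
          = (B - A) * (a 1 - c 1) + (s * (B - A)) * (b 1 - a 1) - (t * (B - A)) * (d 1 - c 1) by ring]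
      rw [es, et, hA, hB, hA']
      simp only [cr_apply, PiLp.sub_apply]
      ring
  refine ⟨(1 - s) • a + s • b, ⟨1 - s, s, hs01.2, hs01.1, by ring, rfl⟩,
    ⟨1 - t, t, ht01.2, ht01.1, by ring, key.symm⟩, ?_⟩
  refine segment_inter_eq ⟨1 - s, s, hs01.2.le, hs01.1.le, by ring, rfl⟩
    ⟨1 - t, t, ht01.2.le, ht01.1.le, by ring, key.symm⟩ (by rw [k1]; exact hne)

/-! ### Distances in a straight-line drawing -/

/-- Parallel segments: slide two points along the segments until one of them is an endpoint. -/
lemma le_dist_of_parallel {a b c d : Plane} {r κ s t : ℝ} (hκ : d - c = κ • (b - a))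
    (ha : ∀ y ∈ segment ℝ c d, r ≤ dist a y)
    (hc : ∀ x ∈ segment ℝ a b, r ≤ dist x c) (hd : ∀ x ∈ segment ℝ a b, r ≤ dist x d)
    (s0 : 0 < s) (s1 : s < 1) (t0 : 0 < t) (t1 : t < 1) :
    r ≤ dist (a + s • (b - a)) (c + t • (d - c)) := by
  have mX : ∀ s ∈ Set.Icc (0 : ℝ) 1, a + s • (b - a) ∈ segment ℝ a b := fun s hs => by
    rw [segment_eq_image']; exact ⟨s, hs, rfl⟩
  have mY : ∀ s ∈ Set.Icc (0 : ℝ) 1, c + s • (d - c) ∈ segment ℝ c d := fun s hs => by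
    rw [segment_eq_image']; exact ⟨s, hs, rfl⟩
  -- Moving both points by the same vector keeps their difference, and a step `τ` on the second
  -- segment equals a step `κ * τ` on the first.
  have endX : ∀ τ, t + τ ∈ Set.Icc (0 : ℝ) 1 → -s = κ * τ →
      r ≤ dist (a + s • (b - a)) (c + t • (d - c)) := by
    intro τ h1 h2
    convert ha _ (mY _ h1) using 1
    rw [dist_eq_norm, dist_eq_norm]
    congr 1
    rw [hκ, show s = - (κ * τ) by linarith]
    module
  have endY : ∀ σ, s + σ ∈ Set.Icc (0 : ℝ) 1 → σ = κ * (-t) →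
      r ≤ dist (a + s • (b - a)) (c + t • (d - c)) := by
    intro σ h1 h2
    convert hc _ (mX _ h1) using 1
    rw [dist_eq_norm, dist_eq_norm]
    congr 1
    rw [hκ, h2]
    module
  have endY' : ∀ σ, s + σ ∈ Set.Icc (0 : ℝ) 1 → σ = κ * (1 - t) →
      r ≤ dist (a + s • (b - a)) (c + t • (d - c)) := by
    intro σ h1 h2
    convert hd _ (mX _ h1) using 1
    rw [dist_eq_norm, dist_eq_norm]
    congr 1
    rw [show d = c + κ • (b - a) by rw [← hκ]; abel, h2]
    module
  -- The first point slides towards `a`. The sign of `κ` tells which end of `[c, d]` the second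
  -- point approaches, and the inner case split which of the two arrives first.
  rcases lt_trichotomy κ 0 with hk | hk | hk
  · by_cases h : s ≤ -κ * (1 - t)
    · have e : -s / κ = s / -κ := by rw [div_neg, neg_div]
      have h' : s / -κ ≤ 1 - t := by rw [div_le_iff₀ (by linarith)]; linarith
      have h'' : 0 < s / -κ := div_pos s0 (by linarith)
      refine endX (-s / κ) ⟨by rw [e]; linarith, by rw [e]; linarith⟩ (by have := hk.ne; field_simp)
    · refine endY' (κ * (1 - t)) ⟨by linarith, ?_⟩ rfl
      nlinarith
  · have hdc : d - c = 0 := by rw [hκ, hk, zero_smul]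
    have := hc _ (mX s ⟨s0.le, s1.le⟩)
    rwa [hdc, smul_zero, add_zero]
  · by_cases h : s ≤ κ * t
    · have h' : s / κ ≤ t := by rw [div_le_iff₀ hk]; linarith
      have h'' : 0 < s / κ := div_pos s0 hk
      refine endX (-s / κ) ⟨by rw [neg_div]; linarith, by rw [neg_div]; linarith⟩ (by field_simp)
    · refine endY (κ * (-t)) ⟨by linarith, ?_⟩ rfl
      nlinarith

/-- Linearly independent vectors span the plane. -/
lemma exists_coords {p q : Plane} (h : cr p q ≠ 0) (z : Plane) :
    ∃ α β : ℝ, z = α • p + β • q := by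
  refine ⟨-cr q z / cr p q, cr p z / cr p q, ?_⟩
  have : ∀ w w' : ℝ, cr p q * w = cr p q * w' → w = w' := fun w w' h' => mul_left_cancel₀ h h'
  apply plane_ext <;> apply this <;> simp only [PiLp.add_apply, PiLp.smul_apply, smul_eq_mul] <;>
    field_simp <;> simp only [cr_apply] <;> ring

lemma exists_smul_of_cr_eq_zero {p q : Plane} (hp : p ≠ 0) (h : cr p q = 0) :
    ∃ κ : ℝ, q = κ • p := by
  have hn : ‖p‖ ≠ 0 := norm_ne_zero_iff.2 hp
  have hu1 : ‖(‖p‖)⁻¹ • p‖ = 1 := by rw [norm_smul, norm_inv, norm_norm, inv_mul_cancel₀ hn]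
  refine ⟨dt ((‖p‖)⁻¹ • p) q * (‖p‖)⁻¹, ?_⟩
  conv_lhs => rw [eq_frame hu1 q]
  rw [show cr ((‖p‖)⁻¹ • p) q = 0 by rw [cr_smul_left, h, mul_zero], zero_smul, add_zero, mul_smul]

/-- Two points in the interiors of disjoint transversal segments can be moved closer. -/
lemma exists_closer_of_transversal {a b c d : Plane} {s t : ℝ} (h : cr (b - a) (d - c) ≠ 0)
    (s0 : 0 < s) (s1 : s < 1) (t0 : 0 < t) (t1 : t < 1)
    (hne : a + s • (b - a) ≠ c + t • (d - c)) :
    ∃ s' ∈ Set.Icc (0 : ℝ) 1, ∃ t' ∈ Set.Icc (0 : ℝ) 1,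
      dist (a + s' • (b - a)) (c + t' • (d - c)) < dist (a + s • (b - a)) (c + t • (d - c)) := by
  -- In the basis of the two directions, changing the parameters by `-l * α` and `l * β` multiplies
  -- the difference vector by `1 - l`.
  obtain ⟨α, β, hαβ⟩ := exists_coords h (a + s • (b - a) - (c + t • (d - c)))
  have ev : ∀ᶠ l in nhdsWithin (0 : ℝ) (Set.Ioi 0), s - l * α ∈ Set.Icc (0 : ℝ) 1 ∧
      t + l * β ∈ Set.Icc (0 : ℝ) 1 ∧ l < 1 ∧ 0 < l := by
    have c1 : Filter.Tendsto (fun l : ℝ => s - l * α) (nhdsWithin 0 (Set.Ioi 0)) (nhds s) := by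
      have : ContinuousAt (fun l : ℝ => s - l * α) 0 := by fun_prop
      simpa using this.tendsto.mono_left nhdsWithin_le_nhds
    have c2 : Filter.Tendsto (fun l : ℝ => t + l * β) (nhdsWithin 0 (Set.Ioi 0)) (nhds t) := by
      have : ContinuousAt (fun l : ℝ => t + l * β) 0 := by fun_prop
      simpa using this.tendsto.mono_left nhdsWithin_le_nhds
    filter_upwards [c1.eventually (Icc_mem_nhds s0 s1), c2.eventually (Icc_mem_nhds t0 t1),
      self_mem_nhdsWithin, nhdsWithin_le_nhds (Iio_mem_nhds (zero_lt_one' ℝ))] with l h1 h2 h3 h4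
    exact ⟨h1, h2, h4, h3⟩
  obtain ⟨l, h1, h2, h3, h4⟩ := ev.exists
  refine ⟨_, h1, _, h2, ?_⟩
  rw [dist_eq_norm, dist_eq_norm]
  have e : a + (s - l * α) • (b - a) - (c + (t + l * β) • (d - c))
      = (1 - l) • (a + s • (b - a) - (c + t • (d - c))) := by
    rw [sub_smul 1 l, one_smul]; nth_rw 2 [hαβ]; module
  rw [e, norm_smul, Real.norm_eq_abs, abs_of_pos (by linarith)]
  have := norm_pos_iff.2 (sub_ne_zero.2 hne)
  nlinarith

/-- The distance of two disjoint plane segments is attained at an endpoint of one of them. -/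
lemma le_dist_of_disjoint_segments {a b c d : Plane} {r : ℝ}
    (hdisj : Disjoint (segment ℝ a b) (segment ℝ c d))
    (ha : ∀ y ∈ segment ℝ c d, r ≤ dist a y) (hb : ∀ y ∈ segment ℝ c d, r ≤ dist b y)
    (hc : ∀ x ∈ segment ℝ a b, r ≤ dist x c) (hd : ∀ x ∈ segment ℝ a b, r ≤ dist x d)
    {x y : Plane} (hx : x ∈ segment ℝ a b) (hy : y ∈ segment ℝ c d) : r ≤ dist x y := by
  have hK : IsCompact (Set.Icc (0 : ℝ) 1 ×ˢ Set.Icc (0 : ℝ) 1) := isCompact_Icc.prod isCompact_Icc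
  have mX : ∀ s ∈ Set.Icc (0 : ℝ) 1, a + s • (b - a) ∈ segment ℝ a b := fun s hs => by
    rw [segment_eq_image']; exact ⟨s, hs, rfl⟩
  have mY : ∀ s ∈ Set.Icc (0 : ℝ) 1, c + s • (d - c) ∈ segment ℝ c d := fun s hs => by
    rw [segment_eq_image']; exact ⟨s, hs, rfl⟩
  have hcont : Continuous fun p : ℝ × ℝ => dist (a + p.1 • (b - a)) (c + p.2 • (d - c)) := by
    fun_prop
  -- Take a closest pair. If neither point is an endpoint, transversal segments contradict
  -- minimality and parallel ones allow sliding to an endpoint.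
  obtain ⟨p, hp, hpmin⟩ := hK.exists_isMinOn
    (Set.Nonempty.prod (Set.nonempty_Icc.2 zero_le_one) (Set.nonempty_Icc.2 zero_le_one))
    hcont.continuousOn
  obtain ⟨s, t⟩ := p
  have hs : s ∈ Set.Icc (0 : ℝ) 1 := hp.1
  have ht : t ∈ Set.Icc (0 : ℝ) 1 := hp.2
  have hmin : ∀ s' ∈ Set.Icc (0 : ℝ) 1, ∀ t' ∈ Set.Icc (0 : ℝ) 1,
      dist (a + s • (b - a)) (c + t • (d - c)) ≤ dist (a + s' • (b - a)) (c + t' • (d - c)) :=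
    fun s' hs' t' ht' => isMinOn_iff.1 hpmin (s', t') (Set.mk_mem_prod hs' ht')
  suffices h : r ≤ dist (a + s • (b - a)) (c + t • (d - c)) by
    rw [segment_eq_image'] at hx hy
    obtain ⟨s', hs', rfl⟩ := hx
    obtain ⟨t', ht', rfl⟩ := hy
    exact h.trans (hmin s' hs' t' ht')
  by_cases s0 : s = 0
  · have := ha _ (mY t ht); rwa [s0, zero_smul, add_zero]
  by_cases s1 : s = 1
  · have := hb _ (mY t ht); rwa [s1, one_smul, add_sub_cancel]
  by_cases t0 : t = 0
  · have := hc _ (mX s hs); rwa [t0, zero_smul, add_zero]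
  by_cases t1 : t = 1
  · have := hd _ (mX s hs); rwa [t1, one_smul, add_sub_cancel]
  have s0' : 0 < s := lt_of_le_of_ne hs.1 (Ne.symm s0)
  have s1' : s < 1 := lt_of_le_of_ne hs.2 s1
  have t0' : 0 < t := lt_of_le_of_ne ht.1 (Ne.symm t0)
  have t1' : t < 1 := lt_of_le_of_ne ht.2 t1
  by_cases hab : b - a = 0
  · have := ha _ (mY t ht); rwa [hab, smul_zero, add_zero]
  by_cases hpar : cr (b - a) (d - c) = 0
  · obtain ⟨κ, hκ⟩ := exists_smul_of_cr_eq_zero hab hpar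
    exact le_dist_of_parallel hκ ha hc hd s0' s1' t0' t1'
  · exfalso
    obtain ⟨s', hs', t', ht', hlt⟩ := exists_closer_of_transversal hpar s0' s1' t0' t1' (fun h =>
      Set.disjoint_left.1 hdisj (mX s hs) (by rw [h]; exact mY t ht))
    exact absurd (hmin s' hs' t' ht') (not_le.2 hlt)

section Drawing

variable {V : Type*} {G : SimpleGraph V} (D : StraightLineDrawing G)

lemma StraightLineDrawing.bddBelow_clearance :
    BddBelow ({t | ∃ v w, v ≠ w ∧ t = dist (D.pos v) (D.pos w)} ∪
    {t | ∃ v a b, G.Adj a b ∧ v ≠ a ∧ v ≠ b ∧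
      t = Metric.infDist (D.pos v) (segment ℝ (D.pos a) (D.pos b))}) := by
  refine ⟨0, ?_⟩
  rintro t (⟨v, w, -, rfl⟩ | ⟨v, a, b, -, -, -, rfl⟩)
  · exact dist_nonneg
  · exact Metric.infDist_nonneg

lemma StraightLineDrawing.clearance_le_dist {v w : V} (h : v ≠ w) :
    D.clearance ≤ dist (D.pos v) (D.pos w) :=
  csInf_le D.bddBelow_clearance (Or.inl ⟨v, w, h, rfl⟩)

lemma StraightLineDrawing.clearance_le_dist_edge {v a b : V} (hab : G.Adj a b) (ha : v ≠ a)
    (hb : v ≠ b) {y : Plane} (hy : y ∈ segment ℝ (D.pos a) (D.pos b)) :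
    D.clearance ≤ dist (D.pos v) y :=
  (csInf_le D.bddBelow_clearance (Or.inr ⟨v, a, b, hab, ha, hb, rfl⟩)).trans
    (Metric.infDist_le_dist_of_mem hy)

/-- With finitely many vertices the infimum is attained, and each distance is positive because edges
are closed. Two distinct vertices are required since `sInf ∅ = 0`. -/
lemma StraightLineDrawing.clearance_pos [Finite V] {a b : V} (hab : a ≠ b) : 0 < D.clearance := by
  have hne : ({t | ∃ v w, v ≠ w ∧ t = dist (D.pos v) (D.pos w)} ∪
    {t | ∃ v a b, G.Adj a b ∧ v ≠ a ∧ v ≠ b ∧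
      t = Metric.infDist (D.pos v) (segment ℝ (D.pos a) (D.pos b))}).Nonempty :=
    ⟨_, Or.inl ⟨a, b, hab, rfl⟩⟩
  have hfin : ({t | ∃ v w, v ≠ w ∧ t = dist (D.pos v) (D.pos w)} ∪
    {t | ∃ v a b, G.Adj a b ∧ v ≠ a ∧ v ≠ b ∧
      t = Metric.infDist (D.pos v) (segment ℝ (D.pos a) (D.pos b))}).Finite := by
    apply Set.Finite.union
    · refine (Set.finite_range fun p : V × V => dist (D.pos p.1) (D.pos p.2)).subset ?_
      rintro t ⟨v, w, -, rfl⟩; exact ⟨(v, w), rfl⟩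
    · refine (Set.finite_range fun p : V × V × V => Metric.infDist (D.pos p.1)
        (segment ℝ (D.pos p.2.1) (D.pos p.2.2))).subset ?_
      rintro t ⟨v, a, b, -, -, -, rfl⟩; exact ⟨(v, a, b), rfl⟩
  have hmem := hne.csInf_mem hfin
  have hpos : ∀ t ∈ ({t | ∃ v w, v ≠ w ∧ t = dist (D.pos v) (D.pos w)} ∪
    {t | ∃ v a b, G.Adj a b ∧ v ≠ a ∧ v ≠ b ∧
      t = Metric.infDist (D.pos v) (segment ℝ (D.pos a) (D.pos b))}), 0 < t := by
    rintro t (⟨v, w, h, rfl⟩ | ⟨v, a, b, h, ha, hb, rfl⟩)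
    · exact dist_pos.2 fun h' => h (D.injective h')
    · have hcl : IsClosed (segment ℝ (D.pos a) (D.pos b)) := by
        rw [segment_eq_image_lineMap]
        exact (isCompact_Icc.image (by fun_prop)).isClosed
      exact (hcl.notMem_iff_infDist_pos ⟨_, left_mem_segment ℝ _ _⟩).1 (D.vertex_notMem v a b h ha hb)
  exact hpos _ hmem

/-- The clearance speaks of vertices only, but the distance of disjoint edges is attained at an
endpoint, that is, at a vertex. -/
lemma StraightLineDrawing.clearance_le_dist_edges {a b c d : V} (hab : G.Adj a b) (hcd : G.Adj c d)
    (hac : a ≠ c) (had : a ≠ d) (hbc : b ≠ c) (hbd : b ≠ d) {x y : Plane}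
    (hx : x ∈ segment ℝ (D.pos a) (D.pos b)) (hy : y ∈ segment ℝ (D.pos c) (D.pos d)) :
    D.clearance ≤ dist x y := by
  refine le_dist_of_disjoint_segments ?_ (fun y hy => D.clearance_le_dist_edge hcd hac had hy)
    (fun y hy => D.clearance_le_dist_edge hcd hbc hbd hy)
    (fun x hx => by rw [dist_comm]; exact D.clearance_le_dist_edge hab hac.symm hbc.symm hx)
    (fun x hx => by rw [dist_comm]; exact D.clearance_le_dist_edge hab had.symm hbd.symm hx) hx hy
  rw [Set.disjoint_iff_inter_eq_empty, Set.eq_empty_iff_forall_notMem]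
  intro z hz
  have := D.edge_inter a b c d hab hcd (by
    intro h; rw [Sym2.eq_iff] at h; rcases h with ⟨h, -⟩ | ⟨h, -⟩ <;> contradiction) hz
  rcases this with ⟨h1 | h1, h2 | h2⟩ <;> rw [h1] at h2
  · exact hac (D.injective h2)
  · exact had (D.injective h2)
  · exact hbc (D.injective h2)
  · exact hbd (D.injective h2)

end Drawing

/-! ### Darts, their directions, and the wedge bisectors -/

section Frames

variable {V : Type*} {G : SimpleGraph V}

/-- In a cubic graph, two darts at a vertex determine the third one. -/
lemma exists_third_dart (hcub : ∀ v, (G.neighborSet v).ncard = 3) {e o : G.Dart}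
    (h : o.fst = e.fst) (hne : o ≠ e) :
    ∃ t : G.Dart, t.fst = e.fst ∧ t ≠ e ∧ t ≠ o ∧ ∀ d : G.Dart, d.fst = e.fst → d = e ∨ d = o ∨ d = t := by
  obtain ⟨a, b, c, hab, hac, hbc, hs⟩ := Set.ncard_eq_three.1 (hcub e.fst)
  have key : ∀ x, G.Adj e.fst x ↔ x = a ∨ x = b ∨ x = c := by
    intro x; rw [← G.mem_neighborSet, hs]; simp
  have ext : ∀ d d' : G.Dart, d.fst = e.fst → d'.fst = e.fst → d.snd = d'.snd → d = d' := by
    intro d d' h1 h2 h3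
    exact SimpleGraph.Dart.ext _ _ (Prod.ext (h1.trans h2.symm) h3)
  have he := (key e.snd).1 e.adj
  have ho := (key o.snd).1 (h ▸ o.adj)
  have hos : o.snd ≠ e.snd := fun h' => hne (ext _ _ h rfl h')
  have : ∃ x, G.Adj e.fst x ∧ x ≠ e.snd ∧ x ≠ o.snd ∧
      ∀ y, G.Adj e.fst y → y = e.snd ∨ y = o.snd ∨ y = x := by
    simp only [key]
    rcases he with he | he | he <;> rcases ho with ho | ho | ho <;>
      first
      | exact absurd (ho.trans he.symm) hos
      | exact ⟨a, by grind⟩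
      | exact ⟨b, by grind⟩
      | exact ⟨c, by grind⟩
  obtain ⟨x, hx, hxe, hxo, hall⟩ := this
  refine ⟨⟨(e.fst, x), hx⟩, rfl, ?_, ?_, ?_⟩
  · rintro h'; exact hxe (congrArg (fun d : G.Dart => d.snd) h')
  · rintro h'; exact hxo (congrArg (fun d : G.Dart => d.snd) h')
  · intro d hd
    rcases hall d.snd (hd ▸ d.adj) with h1 | h1 | h1
    · exact Or.inl (ext _ _ hd rfl h1)
    · exact Or.inr (Or.inl (ext _ _ hd h h1))
    · exact Or.inr (Or.inr (ext _ _ hd rfl h1))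

lemma dart_snd_ne {e o : G.Dart} (h : o.fst = e.fst) (hne : o ≠ e) : o.snd ≠ e.snd :=
  fun h' => hne (SimpleGraph.Dart.ext _ _ (Prod.ext h h'))

variable (D : StraightLineDrawing G)

/-- The length of the edge of a dart. -/
noncomputable def len (e : G.Dart) : ℝ := ‖D.pos e.snd - D.pos e.fst‖

/-- The unit vector in the direction of a dart. -/
noncomputable def dir (e : G.Dart) : Plane := (len D e)⁻¹ • (D.pos e.snd - D.pos e.fst)

lemma clearance_le_len (e : G.Dart) : D.clearance ≤ len D e := by
  rw [len, ← dist_eq_norm]; exact D.clearance_le_dist e.fst_ne_snd.symm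

lemma len_pos (e : G.Dart) : 0 < len D e := by
  rw [len, norm_pos_iff, sub_ne_zero]; exact fun h => e.fst_ne_snd (D.injective h).symm

lemma norm_dir (e : G.Dart) : ‖dir D e‖ = 1 := by
  rw [dir, norm_smul, norm_inv, Real.norm_of_nonneg (len_pos D e).le]
  exact inv_mul_cancel₀ (len_pos D e).ne'

lemma len_smul_dir (e : G.Dart) : len D e • dir D e = D.pos e.snd - D.pos e.fst := by
  rw [dir, smul_smul, mul_inv_cancel₀ (len_pos D e).ne', one_smul]

lemma pos_snd (e : G.Dart) : D.pos e.snd = D.pos e.fst + len D e • dir D e := by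
  rw [len_smul_dir]; abel

lemma len_symm (e : G.Dart) : len D e.symm = len D e := norm_sub_rev _ _

lemma dir_symm (e : G.Dart) : dir D e.symm = - dir D e := by
  rw [dir, dir, len_symm, ← smul_neg]; congr 1; exact (neg_sub _ _).symm

lemma add_smul_dir_mem (e : G.Dart) {c : ℝ} (h0 : 0 ≤ c) (h1 : c ≤ len D e) :
    D.pos e.fst + c • dir D e ∈ segment ℝ (D.pos e.fst) (D.pos e.snd) := by
  rw [segment_eq_image']
  refine ⟨c * (len D e)⁻¹, ⟨by have := len_pos D e; positivity, ?_⟩, ?_⟩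
  · rw [← div_eq_mul_inv, div_le_one (len_pos D e)]; exact h1
  · simp only [dir, mul_smul]

lemma clearance_pos' [Finite V] (e : G.Dart) : 0 < D.clearance := D.clearance_pos e.fst_ne_snd

/-- The angle between two edges at a vertex is large compared with the clearance. -/
lemma clearance_le_len_mul {e t : G.Dart} (h : t.fst = e.fst) (hne : t ≠ e) :
    D.clearance ≤ len D e * ‖dir D e - dir D t‖ := by
  have hs := dart_snd_ne h hne
  -- If `e` is the shorter edge, compare its far end with the point at the same distance on `t`:
  -- their distance is the chord `len D e * ‖dir D e - dir D t‖`.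
  have key : ∀ e t : G.Dart, t.fst = e.fst → t.snd ≠ e.snd → len D e ≤ len D t →
      D.clearance ≤ len D e * ‖dir D e - dir D t‖ := by
    intro e t h hs hl
    have := D.clearance_le_dist_edge t.adj (v := e.snd) (h ▸ e.fst_ne_snd.symm) hs.symm
      (add_smul_dir_mem D t (len_pos D e).le hl)
    rw [dist_eq_norm, pos_snd D e, h, add_sub_add_left_eq_sub, ← smul_sub, norm_smul,
      Real.norm_of_nonneg (len_pos D e).le] at this
    exact this
  rcases le_total (len D e) (len D t) with hl | hl
  · exact key e t h hs hl
  · refine (key t e h.symm hs.symm hl).trans ?_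
    rw [norm_sub_rev]; exact mul_le_mul_of_nonneg_right hl (norm_nonneg _)

lemma dir_ne [Finite V] {e t : G.Dart} (h : t.fst = e.fst) (hne : t ≠ e) : dir D e ≠ dir D t := by
  intro h'
  have := clearance_le_len_mul D h hne
  rw [h', sub_self, norm_zero, mul_zero] at this
  exact absurd (clearance_pos' D e) (not_lt.2 this)

variable {D}

/-- The unit vector from the vertex of `o` towards `x`, when `x` is at one fifth of the clearance. -/
noncomputable def unitTo (D : StraightLineDrawing G) (o : G.Dart) (x : Plane) : Plane :=
  (5 / D.clearance) • (x - D.pos o.fst)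

lemma IsWedgeCenter.norm_sub {o : G.Dart} {x : Plane} (hx : IsWedgeCenter D o x) :
    ‖x - D.pos o.fst‖ = D.clearance / 5 := by rw [← dist_eq_norm]; exact hx.dist_eq

/-- Turns the angle conditions on a wedge centre into conditions on dot products of unit vectors. -/
lemma IsWedgeCenter.dt_unitTo {o e : G.Dart} {x : Plane} (hx : IsWedgeCenter D o x)
    (h : e.fst = o.fst) : dt (unitTo D o x) (dir D e) =
      Real.cos (EuclideanGeometry.angle x (D.pos o.fst) (D.pos e.snd)) := by
  rw [EuclideanGeometry.angle, InnerProductGeometry.cos_angle, vsub_eq_sub, vsub_eq_sub,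
    inner_eq_dt, hx.norm_sub, unitTo, dir, dt_smul_left, map_smul, smul_eq_mul, len, h]
  ring

lemma IsWedgeCenter.dt_eq {o e t : G.Dart} {x : Plane} (hx : IsWedgeCenter D o x)
    (he : e.fst = o.fst) (ht : t.fst = o.fst) (heo : e ≠ o) (hto : t ≠ o) :
    dt (unitTo D o x) (dir D e) = dt (unitTo D o x) (dir D t) := by
  rw [hx.dt_unitTo he, hx.dt_unitTo ht, hx.angle_eq e.snd t.snd (he ▸ e.adj) (ht ▸ t.adj)
    (dart_snd_ne he heo) (dart_snd_ne ht hto)]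

lemma IsWedgeCenter.dt_lt {o e : G.Dart} {x : Plane} (hx : IsWedgeCenter D o x)
    (he : e.fst = o.fst) (heo : e ≠ o) :
    dt (unitTo D o x) (dir D o) < dt (unitTo D o x) (dir D e) := by
  rw [hx.dt_unitTo he, hx.dt_unitTo rfl]
  exact Real.cos_lt_cos_of_nonneg_of_le_pi (EuclideanGeometry.angle_nonneg _ _ _)
    (EuclideanGeometry.angle_le_pi _ _ _) (hx.angle_lt e.snd (he ▸ e.adj) (dart_snd_ne he heo))

variable [Finite V]

lemma IsWedgeCenter.norm_unitTo {o : G.Dart} {x : Plane} (hx : IsWedgeCenter D o x) :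
    ‖unitTo D o x‖ = 1 := by
  have := clearance_pos' D o
  rw [unitTo, norm_smul, hx.norm_sub, Real.norm_of_nonneg (by positivity)]; field_simp

lemma smul_unitTo (o : G.Dart) (x : Plane) :
    (D.clearance / 5) • unitTo D o x = x - D.pos o.fst := by
  have := clearance_pos' D o
  rw [unitTo, smul_smul, show D.clearance / 5 * (5 / D.clearance) = 1 by field_simp, one_smul]

section Three

variable {e o t : G.Dart} {x y z : Plane}

lemma IsWedgeCenter.cr_ne_zero (hx : IsWedgeCenter D o x) (he : e.fst = o.fst) (ht : t.fst = o.fst)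
    (heo : e ≠ o) (hto : t ≠ o) (het : e ≠ t) : cr (unitTo D o x) (dir D e) ≠ 0 :=
  cr_ne_zero_of_dt_eq hx.norm_unitTo (norm_dir D e) (norm_dir D t) (dir_ne D (ht.trans he.symm) het.symm)
    (hx.dt_eq he ht heo hto)

lemma IsWedgeCenter.cr_neg (hx : IsWedgeCenter D o x) (he : e.fst = o.fst) (ht : t.fst = o.fst)
    (heo : e ≠ o) (hto : t ≠ o) (het : e ≠ t) :
    cr (unitTo D o x) (dir D t) = - cr (unitTo D o x) (dir D e) :=
  cr_neg_of_dt_eq hx.norm_unitTo (norm_dir D e) (norm_dir D t) (dir_ne D (ht.trans he.symm) het.symm)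
    (hx.dt_eq he ht heo hto)

/-- The chord between the mirror images `dir D e` and `dir D t` is twice the distance of `dir D e`
from the axis. -/
lemma IsWedgeCenter.clearance_le (hx : IsWedgeCenter D o x) (he : e.fst = o.fst)
    (ht : t.fst = o.fst) (heo : e ≠ o) (hto : t ≠ o) (het : e ≠ t) :
    D.clearance ≤ 2 * (len D e * |cr (unitTo D o x) (dir D e)|) := by
  have := clearance_le_len_mul D (ht.trans he.symm) het.symm
  rw [norm_sub_of_dt_eq hx.norm_unitTo (norm_dir D e) (norm_dir D t)
    (dir_ne D (ht.trans he.symm) het.symm) (hx.dt_eq he ht heo hto)] at this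
  linarith

/-- The difference `dir D e - dir D t` is a multiple of the normal to the bisector at `o`, and the
bisector of the wedge opposite `t` is closer to `e` than to `t`. So that bisector lies on the side
of `e`. -/
lemma IsWedgeCenter.bisector_same_side (hx : IsWedgeCenter D o x) (hy : IsWedgeCenter D t y)
    (he : e.fst = o.fst) (ht : t.fst = o.fst) (heo : e ≠ o) (hto : t ≠ o) (het : e ≠ t) :
    0 < cr (unitTo D o x) (unitTo D t y) * cr (unitTo D o x) (dir D e) := by
  have h1 := dt_sub_of_dt_eq hx.norm_unitTo (norm_dir D e) (norm_dir D t)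
    (dir_ne D (ht.trans he.symm) het.symm) (hx.dt_eq he ht heo hto) (unitTo D t y)
  have h2 := hy.dt_lt (he.trans ht.symm) het
  rw [map_sub] at h1
  linarith

/-- The two wedges along an edge lie on different sides of it. -/
lemma IsWedgeCenter.opposite_sides (hx : IsWedgeCenter D o x) (hy : IsWedgeCenter D t y)
    (he : e.fst = o.fst) (ht : t.fst = o.fst) (heo : e ≠ o) (hto : t ≠ o) (het : e ≠ t) :
    cr (dir D e) (unitTo D o x) * cr (dir D e) (unitTo D t y) < 0 := by
  have h1 := hx.bisector_same_side hy he ht heo hto het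
  have h2 := hy.bisector_same_side hx (he.trans ht.symm) ht.symm het hto.symm heo
  rw [cr_comm (unitTo D t y) (unitTo D o x)] at h2
  rw [cr_comm (dir D e), cr_comm (dir D e)]
  set α := cr (unitTo D o x) (unitTo D t y)
  set p := cr (unitTo D o x) (dir D e)
  set q := cr (unitTo D t y) (dir D e)
  have h3 := mul_pos h1 h2
  have h4 : 0 < α ^ 2 * -(p * q) := by linarith
  have := pos_of_mul_pos_right h4 (sq_nonneg α)
  linarith

/-- The wedges opposite `o` and `t` share the side `e`, so their bisectors enclose half the angle
between `t` and `o`. The bisector of the third wedge makes that same half angle with `t`. Bounds on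
bisector–edge angles thereby become bounds on bisector–bisector angles. -/
lemma IsWedgeCenter.abs_cr_bisectors (hx : IsWedgeCenter D o x) (hy : IsWedgeCenter D t y)
    (hz : IsWedgeCenter D e z)
    (he : e.fst = o.fst) (ht : t.fst = o.fst) (heo : e ≠ o) (hto : t ≠ o) (het : e ≠ t) :
    |cr (unitTo D o x) (unitTo D t y)| = |cr (unitTo D e z) (dir D t)| :=
  cr_sq_bisectors hx.norm_unitTo hy.norm_unitTo hz.norm_unitTo (norm_dir D e) (norm_dir D t)
    (norm_dir D o) (dir_ne D (ht.trans he.symm) het.symm) (dir_ne D he.symm heo.symm)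
    (dir_ne D ht.symm hto.symm) (hx.dt_eq he ht heo hto) (hy.dt_eq (he.trans ht.symm) ht.symm het hto.symm)
    (hz.dt_eq (ht.trans he.symm) he.symm het.symm heo.symm)

end Three

end Frames

/-! ### Bounding the radius by means of the rule against transversals -/

section Radius

variable {V : Type*} {G : SimpleGraph V} {D : StraightLineDrawing G} (C : Choices D)

lemma center_onEdge (e : G.Dart) :
    C.center (.onEdge e) = D.pos e.fst + (3 / 5 * len D e) • dir D e := by
  rw [Choices.center, AffineMap.lineMap_apply_module', mul_smul, len_smul_dir, add_comm]

lemma center_onEdge_symm (e : G.Dart) :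
    C.center (.onEdge e.symm) = D.pos e.fst + (2 / 5 * len D e) • dir D e := by
  rw [center_onEdge, len_symm, dir_symm, show D.pos e.symm.fst = D.pos e.snd from rfl, pos_snd]
  module

/-- The bisector of the wedge opposite to a dart. -/
noncomputable def bis (o : G.Dart) : Plane := unitTo D o (C.wedgeCenter o)

variable {C}

/-- The separation estimates evaluate a functional of norm at most 1 at a disk centre and lose at
most `ρ` on the disk. -/
lemma abs_map_sub_center_le {f : Plane →ₗ[ℝ] ℝ} (hf : ∀ x, |f x| ≤ ‖x‖) {q : GuideDisk G}
    {x : Plane} (hx : x ∈ C.disk q) : |f x - f (C.center q)| ≤ C.rho := by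
  rw [← map_sub]
  refine (hf _).trans ?_
  rw [← dist_eq_norm]; exact hx

lemma mem_disk_of_norm {q : GuideDisk G} {x : Plane} (h : ‖x - C.center q‖ ≤ C.rho) :
    x ∈ C.disk q := by
  rw [Choices.disk, Metric.mem_closedBall, dist_eq_norm]; exact h

variable [Finite V]

variable (C) in
lemma center_inWedge (o : G.Dart) :
    C.center (.inWedge o) = D.pos o.fst + (D.clearance / 5) • bis C o := by
  rw [bis, smul_unitTo, Choices.center]; abel

lemma Choices.Valid.norm_bis (hC : C.Valid) (o : G.Dart) : ‖bis C o‖ = 1 :=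
  (hC.wedgeCenter_spec o).norm_unitTo

/-- The wedge disk stays clear of the common tangents of the two disks on the edge. -/
lemma Choices.Valid.rho_mul_lt (hC : C.Valid) {e o : G.Dart} (h : o.fst = e.fst) (hne : o ≠ e) :
    C.rho * (6 * len D e - 2 * (D.clearance * dt (dir D e) (bis C o))) <
      len D e * (D.clearance / 5 * |cr (dir D e) (bis C o)|) := by
  by_contra hcon
  push Not at hcon
  have hu := norm_dir D e
  have hL := len_pos D e
  have hδL := clearance_le_len D e
  have hδ := clearance_pos' D e
  have hρ := hC.rho_pos
  set u := dir D e with hu'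
  set L := len D e
  set δ := D.clearance
  set x0 := δ / 5 * dt u (bis C o) with hx0
  set y0 := δ / 5 * cr u (bis C o) with hy0
  have hx0L : x0 ≤ L / 5 := by
    have h1 := le_of_abs_le (abs_dt_le u (bis C o))
    rw [hu, hC.norm_bis, mul_one] at h1
    rw [hx0]; nlinarith
  have hy0ρ : L * |y0| ≤ C.rho * (6 * L - 10 * x0) := by
    rw [hy0, hx0, abs_mul, abs_of_pos (by positivity : 0 < δ / 5)]; linarith
  have hw : C.center (.inWedge o) = D.pos e.fst + x0 • u + y0 • rot u := by
    rw [center_inWedge, h]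
    conv_lhs => rw [eq_frame hu (bis C o)]
    rw [hx0, hy0]; module
  have hden : 0 < 6 * L - 10 * x0 := by linarith
  have hden' : 0 < 3 / 5 * L - x0 := by linarith
  -- In coordinates along and across the edge, the line at heights `k` and `-k` over the edge-disk
  -- centres `2/5 * L` and `3/5 * L` has height `y0 - k` over `x0` for exactly this `k`. If `|k| ≤
  -- ρ`, it is a forbidden transversal.
  obtain ⟨k, hk⟩ : ∃ k, k = y0 * L / (6 * L - 10 * x0) := ⟨_, rfl⟩
  have hkL : k * (6 * L - 10 * x0) = y0 * L := by rw [hk]; exact div_mul_cancel₀ _ hden.ne'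
  have hkρ : |k| ≤ C.rho := by
    rw [hk, abs_div, abs_mul, abs_of_pos hL, abs_of_pos hden, div_le_iff₀ hden]
    linarith
  have hrot : ‖rot u‖ = 1 := by rw [norm_rot, hu]
  refine hC.no_transversal e o h hne ⟨D.pos e.fst + x0 • u + (y0 - k) • rot u,
    D.pos e.fst + (3 / 5 * L) • u - k • rot u, ⟨_, right_mem_segment ℝ _ _, ?_⟩,
    ⟨D.pos e.fst + (2 / 5 * L) • u + k • rot u, ?_, ?_⟩, ⟨_, left_mem_segment ℝ _ _, ?_⟩⟩
  · apply mem_disk_of_norm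
    rw [center_onEdge, show D.pos e.fst + (3 / 5 * L) • u - k • rot u - (D.pos e.fst + (3 / 5 * L) • u)
      = (-k) • rot u by module, norm_smul, hrot, mul_one, norm_neg]
    exact hkρ
  · obtain ⟨a, ha⟩ : ∃ a, a = (1 / 5 * L) / (3 / 5 * L - x0) := ⟨_, rfl⟩
    obtain ⟨b, hb⟩ : ∃ b, b = (2 / 5 * L - x0) / (3 / 5 * L - x0) := ⟨_, rfl⟩
    have h2 : a * (3 / 5 * L - x0) = 1 / 5 * L := by rw [ha]; exact div_mul_cancel₀ _ hden'.ne'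
    have h3 : b * (3 / 5 * L - x0) = 2 / 5 * L - x0 := by
      rw [hb]; exact div_mul_cancel₀ _ hden'.ne'
    have e1 : a + b = 1 := mul_right_cancel₀ hden'.ne' (by linear_combination h2 + h3)
    have e2 : a * x0 + b * (3 / 5 * L) = 2 / 5 * L :=
      mul_right_cancel₀ hden'.ne' (by linear_combination x0 * h2 + (3 / 5 * L) * h3)
    have e3 : a * (y0 - k) - b * k = k :=
      mul_right_cancel₀ hden'.ne' (by linear_combination (y0 - k) * h2 - k * h3 - 1 / 5 * hkL)
    refine ⟨a, b, by rw [ha]; positivity, by rw [hb]; exact div_nonneg (by linarith) hden'.le, e1, ?_⟩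
    rw [show a • (D.pos e.fst + x0 • u + (y0 - k) • rot u) + b • (D.pos e.fst + (3 / 5 * L) • u
      - k • rot u) = (a + b) • D.pos e.fst + (a * x0 + b * (3 / 5 * L)) • u
        + (a * (y0 - k) - b * k) • rot u by module, e1, e2, e3, one_smul]
  · apply mem_disk_of_norm
    rw [center_onEdge_symm, add_sub_cancel_left, norm_smul, hrot, mul_one]
    exact hkρ
  · apply mem_disk_of_norm
    rw [hw, show D.pos e.fst + x0 • u + (y0 - k) • rot u - (D.pos e.fst + x0 • u + y0 • rot u)
      = (-k) • rot u by module, norm_smul, hrot, mul_one, norm_neg]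
    exact hkρ

/-- The radius is small compared with the distance of wedge disks from the bounding edges. -/
lemma Choices.Valid.rho_lt (hC : C.Valid) {e o : G.Dart} (h : o.fst = e.fst) (hne : o ≠ e) :
    20 * C.rho < D.clearance * |cr (dir D e) (bis C o)| := by
  have h1 := hC.rho_mul_lt h hne
  have h2 := le_of_abs_le (abs_dt_le (dir D e) (bis C o))
  rw [norm_dir, hC.norm_bis, mul_one] at h2
  have hL := len_pos D e
  have hδ := clearance_pos' D e
  -- Since `δ * cos ≤ δ ≤ L`, the factor of `ρ` in `rho_mul_lt` is at least `4 * L`. This gives `4 *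
  -- ρ < δ / 5 * |sin|`, hence the constant 20.
  have h3 : D.clearance * dt (dir D e) (bis C o) ≤ len D e :=
    (mul_le_of_le_one_right hδ.le h2).trans (clearance_le_len D e)
  have h4 : C.rho * (4 * len D e) ≤
      C.rho * (6 * len D e - 2 * (D.clearance * dt (dir D e) (bis C o))) :=
    mul_le_mul_of_nonneg_left (by linarith) hC.rho_pos.le
  have h5 : len D e * (4 * C.rho) < len D e * (D.clearance / 5 * |cr (dir D e) (bis C o)|) := by
    linarith
  linarith [lt_of_mul_lt_mul_left h5 hL.le]

lemma Choices.Valid.rho_lt_clearance (hC : C.Valid) {e o : G.Dart} (h : o.fst = e.fst)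
    (hne : o ≠ e) : 20 * C.rho < D.clearance := by
  refine (hC.rho_lt h hne).trans_le ?_
  have := abs_cr_le (dir D e) (bis C o)
  rw [norm_dir, hC.norm_bis] at this
  have := clearance_pos' D e
  nlinarith

end Radius

/-! ### Separating red segments and disks by linear functionals -/

section Separation

variable {V : Type*} {G : SimpleGraph V} {D : StraightLineDrawing G} {C : Choices D}

lemma Choices.Valid.lt_map_red (hC : C.Valid) {f : Plane →ₗ[ℝ] ℝ} {c : ℝ} {r : RedLabel G}
    (h1 : ∀ z ∈ C.disk (.inWedge r.opp), c < f z) (h2 : ∀ z ∈ C.disk (.onEdge r.edge), c < f z)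
    {z : Plane} (hz : z ∈ C.arrangement.seg (.red r)) : c < f z :=
  lt_of_mem_segment (h1 _ (hC.redNear_mem r)) (h2 _ (hC.redFar_mem r)) hz

lemma Choices.Valid.le_map_red (hC : C.Valid) {f : Plane →ₗ[ℝ] ℝ} {c : ℝ} {r : RedLabel G}
    (h1 : ∀ z ∈ C.disk (.inWedge r.opp), c ≤ f z) (h2 : ∀ z ∈ C.disk (.onEdge r.edge), c ≤ f z)
    {z : Plane} (hz : z ∈ C.arrangement.seg (.red r)) : c ≤ f z :=
  le_of_mem_segment (h1 _ (hC.redNear_mem r)) (h2 _ (hC.redFar_mem r)) hz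

lemma center_onEdge_mem (d : G.Dart) :
    C.center (.onEdge d) ∈ segment ℝ (D.pos d.fst) (D.pos d.snd) := by
  have := len_pos D d
  rw [center_onEdge]; exact add_smul_dir_mem D _ (by positivity) (by linarith)

/-- Two darts whose edges have no common vertex. -/
def Apart (d e : G.Dart) : Prop := d.fst ≠ e.fst ∧ d.fst ≠ e.snd ∧ d.snd ≠ e.fst ∧ d.snd ≠ e.snd

/-- Classifies two edges: disjoint, equal in one of the two orientations, or, after reversing darts,
different edges leaving a common vertex. -/
lemma corner_cases (d e : G.Dart) : Apart d e ∨ d = e ∨ d = e.symm ∨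
    ∃ d' e' : G.Dart, e'.fst = d'.fst ∧ e' ≠ d' ∧ (d = d' ∨ d = d'.symm) ∧ (e = e' ∨ e = e'.symm) := by
  by_cases h : Apart d e
  · exact Or.inl h
  right
  by_cases h1 : d = e
  · exact Or.inl h1
  by_cases h2 : d = e.symm
  · exact Or.inr (Or.inl h2)
  right; right
  have h3 : d.symm ≠ e := fun h => h2 (by rw [← h, SimpleGraph.Dart.symm_symm])
  have h4 : d.symm ≠ e.symm := fun h => h1 (SimpleGraph.Dart.symm_involutive.injective h)
  simp only [Apart, not_and_or, not_not] at h
  rcases h with h | h | h | h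
  · exact ⟨d, e, h.symm, Ne.symm h1, Or.inl rfl, Or.inl rfl⟩
  · exact ⟨d, e.symm, h.symm, Ne.symm h2, Or.inl rfl, Or.inr (by simp)⟩
  · exact ⟨d.symm, e, h.symm, Ne.symm h3, Or.inr (by simp), Or.inl rfl⟩
  · exact ⟨d.symm, e.symm, h.symm, Ne.symm h4, Or.inr (by simp), Or.inr (by simp)⟩

variable [Finite V]

/-- The functional is the cross product with the bisector of the wedge between `e` and `t`, up to
sign. Its zero line through the vertex has `e` and the wedge opposite `t` on one side, `t` and the
wedge opposite `e` on the other. The margins `20 * ρ` come from `rho_lt`, for the two bisectors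
after a passage through `abs_cr_bisectors`. -/
lemma Choices.Valid.exists_corner_functional (hC : C.Valid) {e o t : G.Dart} (he : e.fst = o.fst)
    (ht : t.fst = o.fst) (heo : e ≠ o) (hto : t ≠ o) (het : e ≠ t) :
    ∃ (f : Plane →ₗ[ℝ] ℝ) (s : ℝ), (∀ x, |f x| ≤ ‖x‖) ∧ 20 * C.rho < D.clearance * s ∧
      f (dir D e) = s ∧ f (dir D t) = -s ∧ f (bis C o) = 0 ∧
      20 * C.rho < D.clearance * f (bis C t) ∧ D.clearance * f (bis C e) < - (20 * C.rho) ∧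
      D.clearance ≤ 2 * (len D e * s) ∧ D.clearance ≤ 2 * (len D t * s) := by
  have hx := hC.wedgeCenter_spec
  -- The sign `ε` orients the functional so that it is positive on `e`.
  have key : ∀ ε : ℝ, |ε| = 1 → 0 < ε * cr (bis C o) (dir D e) →
    ∃ (f : Plane →ₗ[ℝ] ℝ) (s : ℝ), (∀ x, |f x| ≤ ‖x‖) ∧ 20 * C.rho < D.clearance * s ∧
      f (dir D e) = s ∧ f (dir D t) = -s ∧ f (bis C o) = 0 ∧
      20 * C.rho < D.clearance * f (bis C t) ∧ D.clearance * f (bis C e) < - (20 * C.rho) ∧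
      D.clearance ≤ 2 * (len D e * s) ∧ D.clearance ≤ 2 * (len D t * s) := by
    intro ε hε hpos
    have hs : |cr (bis C o) (dir D e)| = ε * cr (bis C o) (dir D e) := by
      rw [← abs_of_pos hpos, abs_mul, hε, one_mul]
    have hcr : cr (bis C o) (dir D t) = - cr (bis C o) (dir D e) :=
      (hx o).cr_neg he ht heo hto het
    have hδ := clearance_pos' D o
    have hεε : ε * ε = 1 := by rw [← abs_mul_abs_self, hε, one_mul]
    have bt : 0 < ε * cr (bis C o) (bis C t) := by
      have h := (hx o).bisector_same_side (hx t) he ht heo hto het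
      have h1 : 0 < (ε * cr (bis C o) (bis C t)) * (ε * cr (bis C o) (dir D e)) := by
        have : 0 < cr (bis C o) (bis C t) * cr (bis C o) (dir D e) := h
        nlinarith
      exact pos_of_mul_pos_left h1 hpos.le
    have be : ε * cr (bis C o) (bis C e) < 0 := by
      have h : 0 < cr (bis C o) (bis C e) * cr (bis C o) (dir D t) :=
        (hx o).bisector_same_side (hx e) ht he hto heo het.symm
      rw [hcr] at h
      have h1 : 0 < (-(ε * cr (bis C o) (bis C e))) * (ε * cr (bis C o) (dir D e)) := by
        nlinarith
      have := pos_of_mul_pos_left h1 hpos.le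
      linarith
    have abst : |cr (bis C o) (bis C t)| = ε * cr (bis C o) (bis C t) := by
      rw [← abs_of_pos bt, abs_mul, hε, one_mul]
    have abse : |cr (bis C o) (bis C e)| = - (ε * cr (bis C o) (bis C e)) := by
      rw [← abs_of_neg be, abs_mul, hε, one_mul]
    refine ⟨ε • cr (bis C o), ε * cr (bis C o) (dir D e), ?_, ?_, rfl, ?_, ?_, ?_, ?_, ?_, ?_⟩
    · intro x
      rw [LinearMap.smul_apply, smul_eq_mul, abs_mul, hε, one_mul]
      have := abs_cr_le (bis C o) x
      rwa [hC.norm_bis, one_mul] at this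
    · rw [← hs, cr_comm, abs_neg]; exact hC.rho_lt he.symm heo.symm
    · rw [LinearMap.smul_apply, smul_eq_mul, hcr]; ring
    · rw [LinearMap.smul_apply, cr_self, smul_zero]
    · rw [LinearMap.smul_apply, smul_eq_mul, ← abst,
        show |cr (bis C o) (bis C t)| = |cr (bis C e) (dir D t)| from
          (hx o).abs_cr_bisectors (hx t) (hx e) he ht heo hto het, cr_comm, abs_neg]
      exact hC.rho_lt (he.trans ht.symm) het
    · have : 20 * C.rho < D.clearance * |cr (bis C o) (bis C e)| := by
        rw [show |cr (bis C o) (bis C e)| = |cr (bis C t) (dir D e)| from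
          (hx o).abs_cr_bisectors (hx e) (hx t) ht he hto heo het.symm, cr_comm, abs_neg]
        exact hC.rho_lt (ht.trans he.symm) het.symm
      rw [abse] at this
      rw [LinearMap.smul_apply, smul_eq_mul]; linarith
    · rw [← hs]; exact (hx o).clearance_le he ht heo hto het
    · have h := (hx o).clearance_le ht he hto heo het.symm
      rw [show cr (unitTo D o (C.wedgeCenter o)) (dir D t) = _ from hcr, abs_neg, hs] at h
      exact h
  have hne : cr (bis C o) (dir D e) ≠ 0 := (hx o).cr_ne_zero he ht heo hto het
  rcases lt_or_gt_of_ne hne with h | h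
  · exact key (-1) (by norm_num) (by linarith)
  · exact key 1 (by norm_num) (by linarith)

section Side

variable {f : Plane →ₗ[ℝ] ℝ} {s : ℝ} {e : G.Dart}

lemma lt_map_of_mem_onEdge (hf : ∀ x, |f x| ≤ ‖x‖) (hs : 20 * C.rho < D.clearance * s)
    (hfe : f (dir D e) = s) (hρ : 0 < C.rho) {z : Plane} (hz : z ∈ C.disk (.onEdge e)) :
    f (D.pos e.fst) + C.rho < f z := by
  have h1 := abs_le.1 (abs_map_sub_center_le hf hz)
  rw [center_onEdge, map_add, map_smul, hfe, smul_eq_mul] at h1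
  have h2 : D.clearance * s ≤ len D e * s := by
    have := clearance_pos' D e
    exact mul_le_mul_of_nonneg_right (clearance_le_len D e) (by nlinarith)
  linarith

lemma lt_map_of_mem_onEdge_symm (hf : ∀ x, |f x| ≤ ‖x‖) (hs : 20 * C.rho < D.clearance * s)
    (hfe : f (dir D e) = s) (hρ : 0 < C.rho) {z : Plane} (hz : z ∈ C.disk (.onEdge e.symm)) :
    f (D.pos e.fst) + C.rho < f z := by
  have h1 := abs_le.1 (abs_map_sub_center_le hf hz)
  rw [center_onEdge_symm, map_add, map_smul, hfe, smul_eq_mul] at h1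
  have h2 : D.clearance * s ≤ len D e * s := by
    have := clearance_pos' D e
    exact mul_le_mul_of_nonneg_right (clearance_le_len D e) (by nlinarith)
  linarith

/-- The far vertex has height `len D e * s`. A wedge centre there deviates by at most `δ / 5`, which
by `hs'` is at most two fifths of this height. -/
lemma lt_map_of_mem_inWedge_snd (hC : C.Valid) (hf : ∀ x, |f x| ≤ ‖x‖)
    (hs : 20 * C.rho < D.clearance * s) (hfe : f (dir D e) = s)
    (hs' : D.clearance ≤ 2 * (len D e * s)) {d : G.Dart} (hd : d.fst = e.snd) {z : Plane}
    (hz : z ∈ C.disk (.inWedge d)) : f (D.pos e.fst) + C.rho < f z := by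
  have h1 := abs_le.1 (abs_map_sub_center_le hf hz)
  have hρ := hC.rho_pos
  have hδ := clearance_pos' D e
  rw [center_inWedge, hd, map_add, map_smul, smul_eq_mul, pos_snd, map_add, map_smul, smul_eq_mul,
    hfe] at h1
  have h2 : D.clearance * s ≤ len D e * s :=
    mul_le_mul_of_nonneg_right (clearance_le_len D e) (by nlinarith)
  have h3 := abs_le.1 (hf (bis C d))
  rw [hC.norm_bis] at h3
  nlinarith [h1.1, h3.1]

lemma abs_map_of_mem_inWedge (hf : ∀ x, |f x| ≤ ‖x‖) {d : G.Dart} {z : Plane}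
    (hz : z ∈ C.disk (.inWedge d)) :
    |f z - f (D.pos d.fst) - D.clearance / 5 * f (bis C d)| ≤ C.rho := by
  have h1 := abs_map_sub_center_le hf hz
  rwa [center_inWedge, map_add, map_smul, smul_eq_mul, ← sub_sub] at h1

end Side

/-- The red segments along the edge of `e`, seen from a functional of a wedge bounded by `e`. -/
lemma Choices.Valid.red_side (hC : C.Valid) {f : Plane →ₗ[ℝ] ℝ} {s : ℝ} {e o t : G.Dart}
    (he : e.fst = o.fst) (hall : ∀ d : G.Dart, d.fst = e.fst → d = e ∨ d = o ∨ d = t)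
    (hf : ∀ x, |f x| ≤ ‖x‖) (hs : 20 * C.rho < D.clearance * s) (hfe : f (dir D e) = s)
    (ho : f (bis C o) = 0) (ht : 20 * C.rho < D.clearance * f (bis C t))
    (hs' : D.clearance ≤ 2 * (len D e * s)) {r : RedLabel G}
    (hr : r.edge = e ∨ r.edge = e.symm) {z : Plane} (hz : z ∈ C.arrangement.seg (.red r)) :
    f (D.pos e.fst) + C.rho < f z ∨ (r.edge = e ∧ r.opp = o ∧ f (D.pos e.fst) - C.rho ≤ f z) := by
  have hρ := hC.rho_pos
  rcases hr with hr | hr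
  · have h1 : ∀ z ∈ C.disk (.onEdge r.edge), f (D.pos e.fst) + C.rho < f z := by
      rw [hr]; exact fun z hz => lt_map_of_mem_onEdge hf hs hfe hρ hz
    rcases hall r.opp (by rw [r.same_vertex, hr]) with h | h | h
    · exact absurd (h.trans hr.symm) r.ne
    · refine Or.inr ⟨hr, h, hC.le_map_red ?_ (fun z hz => by linarith [h1 z hz]) hz⟩
      intro z hz
      have := abs_le.1 (abs_map_of_mem_inWedge hf hz)
      rw [h, ho, ← he] at this
      linarith
    · refine Or.inl (hC.lt_map_red ?_ h1 hz)
      intro z hz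
      have := abs_le.1 (abs_map_of_mem_inWedge hf hz)
      rw [show r.opp.fst = e.fst by rw [r.same_vertex, hr], h] at this
      linarith
  · refine Or.inl (hC.lt_map_red ?_ ?_ hz)
    · intro z hz
      exact lt_map_of_mem_inWedge_snd hC hf hs hfe hs' (d := r.opp)
        (by rw [r.same_vertex, hr]; rfl) hz
    · intro z hz
      rw [hr] at hz
      exact lt_map_of_mem_onEdge_symm hf hs hfe hρ hz

/-- Apply `red_side` with `f` to `r` and with `-f` to `r'`. At least one of the two bounds has the
strict margin `ρ`, unless both segments end in the disk of the wedge between the edges, which `hw`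
excludes. -/
lemma Choices.Valid.disjoint_red_red_corner (hC : C.Valid)
    (hcub : ∀ v, (G.neighborSet v).ncard = 3) {e t : G.Dart} (h : t.fst = e.fst)
    (hne : t ≠ e) {r r' : RedLabel G} (hr : r.edge = e ∨ r.edge = e.symm)
    (hr' : r'.edge = t ∨ r'.edge = t.symm)
    (hw : ¬ (r.edge = e ∧ r'.edge = t ∧ r.opp = r'.opp)) :
    Disjoint (C.arrangement.seg (.red r)) (C.arrangement.seg (.red r')) := by
  obtain ⟨o, ho, hoe, hot, hall⟩ := exists_third_dart hcub h hne
  obtain ⟨f, s, hf, hs, fe, ft, fo, ft', fe', le, lt⟩ := hC.exists_corner_functional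
    ho.symm (h.trans ho.symm) hoe.symm hot.symm hne.symm
  rw [Set.disjoint_left]
  intro z hz hz'
  have h1 := hC.red_side (o := o) (t := t) ho.symm (fun d hd => by have := hall d hd; tauto)
    hf hs fe fo ft' le hr hz
  have h2 := hC.red_side (f := -f) (o := o) (t := e) (h.trans ho.symm)
    (fun d hd => by have := hall d (hd.trans h); tauto)
    (fun x => by rw [LinearMap.neg_apply, abs_neg]; exact hf x) hs
    (by rw [LinearMap.neg_apply, ft, neg_neg]) (by rw [LinearMap.neg_apply, fo, neg_zero])
    (by rw [LinearMap.neg_apply]; linarith) lt hr' hz'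
  have hρ := hC.rho_pos
  rw [LinearMap.neg_apply, LinearMap.neg_apply, h] at h2
  rcases h1 with h1 | ⟨a1, b1, h1⟩ <;> rcases h2 with h2 | ⟨a2, b2, h2⟩
  · linarith
  · linarith
  · linarith
  · exact hw ⟨a1, a2, b1.trans b2.symm⟩

lemma Choices.Valid.disjoint_red_onEdge_corner (hC : C.Valid)
    (hcub : ∀ v, (G.neighborSet v).ncard = 3) {e t : G.Dart} (h : t.fst = e.fst)
    (hne : t ≠ e) {r : RedLabel G} (hr : r.edge = e ∨ r.edge = e.symm) {d : G.Dart}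
    (hd : d = t ∨ d = t.symm) :
    Disjoint (C.arrangement.seg (.red r)) (C.disk (.onEdge d)) := by
  obtain ⟨o, ho, hoe, hot, hall⟩ := exists_third_dart hcub h hne
  obtain ⟨f, s, hf, hs, fe, ft, fo, ft', fe', le, lt⟩ := hC.exists_corner_functional
    ho.symm (h.trans ho.symm) hoe.symm hot.symm hne.symm
  rw [Set.disjoint_left]
  intro z hz hz'
  have h1 := hC.red_side (o := o) (t := t) ho.symm (fun d hd => by have := hall d hd; tauto)
    hf hs fe fo ft' le hr hz
  have hρ := hC.rho_pos
  have hf' : ∀ x, |(-f) x| ≤ ‖x‖ := fun x => by rw [LinearMap.neg_apply, abs_neg]; exact hf x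
  have ft2 : (-f) (dir D t) = s := by rw [LinearMap.neg_apply, ft, neg_neg]
  have h2 : (-f) (D.pos t.fst) + C.rho < (-f) z := by
    rcases hd with rfl | rfl
    · exact lt_map_of_mem_onEdge hf' hs ft2 hρ hz'
    · exact lt_map_of_mem_onEdge_symm hf' hs ft2 hρ hz'
  rw [LinearMap.neg_apply, LinearMap.neg_apply, h] at h2
  rcases h1 with h1 | ⟨a1, b1, h1⟩ <;> linarith

/-- A red segment misses the wedge disks at the far end of its edge. -/
lemma Choices.Valid.disjoint_red_inWedge_snd (hC : C.Valid) {r : RedLabel G} {d : G.Dart}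
    (hd : d.fst = r.edge.snd) :
    Disjoint (C.arrangement.seg (.red r)) (C.disk (.inWedge d)) := by
  have hρ := hC.rho_pos
  have hρδ := hC.rho_lt_clearance r.same_vertex r.ne
  have hδ := clearance_le_len D r.edge
  have hf : ∀ x, |(-dt (dir D r.edge)) x| ≤ ‖x‖ := fun x => by
    rw [LinearMap.neg_apply, abs_neg]
    have := abs_dt_le (dir D r.edge) x; rwa [norm_dir, one_mul] at this
  have hu : (-dt (dir D r.edge)) (dir D r.edge) = -1 := by
    rw [LinearMap.neg_apply, dt_self, norm_dir, one_pow]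
  -- The height `f` is measured backwards along the edge. From the far vertex the segment keeps a
  -- height above `3/10 * δ`, as `2/5 * δ - ρ` exceeds it, while the wedge disks there reach at most
  -- `δ / 5 + ρ < δ / 4`.
  set f := -dt (dir D r.edge)
  rw [Set.disjoint_left]
  intro z hz hz'
  have hb : ∀ d : G.Dart, |D.clearance / 5 * f (bis C d)| ≤ D.clearance / 5 := fun d => by
    have h := hf (bis C d)
    have := clearance_pos' D d
    rw [hC.norm_bis] at h
    rw [abs_mul, abs_of_pos (by positivity)]
    nlinarith
  have h1 : f (D.pos r.edge.snd) + 3 / 10 * D.clearance < f z := by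
    refine hC.lt_map_red ?_ ?_ hz
    · intro z hz
      have h := abs_le.1 (abs_map_of_mem_inWedge hf hz)
      have h' := abs_le.1 (hb r.opp)
      rw [r.same_vertex] at h
      rw [pos_snd, map_add, map_smul, hu, smul_eq_mul]
      linarith
    · intro z hz
      have h := abs_le.1 (abs_map_sub_center_le hf hz)
      rw [center_onEdge, map_add, map_smul, hu, smul_eq_mul] at h
      rw [pos_snd, map_add, map_smul, hu, smul_eq_mul]
      linarith
  have h2 := abs_le.1 (abs_map_of_mem_inWedge hf hz')
  have h' := abs_le.1 (hb d)
  rw [hd] at h2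
  linarith

/-- A red segment misses the other wedge disks of its vertex. -/
lemma Choices.Valid.disjoint_red_inWedge_fst (hC : C.Valid)
    (hcub : ∀ v, (G.neighborSet v).ncard = 3) {r : RedLabel G} {d : G.Dart}
    (hd : d.fst = r.edge.fst) (hne : d ≠ r.opp) :
    Disjoint (C.arrangement.seg (.red r)) (C.disk (.inWedge d)) := by
  have hρ := hC.rho_pos
  obtain ⟨t, ht, hte, hto, hall⟩ := exists_third_dart hcub r.same_vertex r.ne
  rcases hall d hd with h | h | rfl
  -- The wedge opposite the edge of `r`: it lies beyond the bisector of the wedge in which `r` ends.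
  · obtain ⟨f, s, hf, hs, fe, ft, fo, ft', fe', le, lt⟩ := hC.exists_corner_functional
      r.same_vertex.symm (ht.trans r.same_vertex.symm) r.ne.symm hto hte.symm
    rw [Set.disjoint_left]
    intro z hz hz'
    have h1 := hC.red_side (o := r.opp) (t := t) r.same_vertex.symm
      (fun d hd => by have := hall d hd; tauto) hf hs fe fo ft' le (Or.inl rfl) hz
    have h2 := abs_le.1 (abs_map_of_mem_inWedge hf hz')
    rw [h] at h2
    rcases h1 with h1 | ⟨a1, b1, h1⟩ <;> linarith
  · exact absurd h hne
  -- The other wedge bounded by the edge of `r`: it lies across the line of that edge.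
  · have hop : cr (dir D r.edge) (bis C r.opp) * cr (dir D r.edge) (bis C d) < 0 :=
      (hC.wedgeCenter_spec r.opp).opposite_sides (hC.wedgeCenter_spec d) r.same_vertex.symm
      (ht.trans r.same_vertex.symm) r.ne.symm hto hte.symm
    have k1 := hC.rho_lt r.same_vertex r.ne
    have k2 := hC.rho_lt ht hte
    have key : ∀ f : Plane →ₗ[ℝ] ℝ, (∀ x, |f x| ≤ ‖x‖) → f (dir D r.edge) = 0 →
        20 * C.rho < D.clearance * f (bis C r.opp) → D.clearance * f (bis C d) < -(20 * C.rho) →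
        Disjoint (C.arrangement.seg (.red r)) (C.disk (.inWedge d)) := by
      intro f hf hfe ho ht'
      rw [Set.disjoint_left]
      intro z hz hz'
      have h1 : f (D.pos r.edge.fst) - C.rho ≤ f z := by
        refine hC.le_map_red ?_ ?_ hz
        · intro z hz
          have h := abs_le.1 (abs_map_of_mem_inWedge hf hz)
          rw [r.same_vertex] at h
          linarith
        · intro z hz
          have h := abs_le.1 (abs_map_sub_center_le hf hz)
          rw [center_onEdge, map_add, map_smul, hfe, smul_zero] at h
          linarith
      have h2 := abs_le.1 (abs_map_of_mem_inWedge hf hz')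
      rw [hd] at h2
      linarith
    have hcr : ∀ x, |cr (dir D r.edge) x| ≤ ‖x‖ := fun x => by
      have := abs_cr_le (dir D r.edge) x; rwa [norm_dir, one_mul] at this
    rcases lt_or_ge 0 (cr (dir D r.edge) (bis C r.opp)) with h | h
    · have h' : cr (dir D r.edge) (bis C d) < 0 := by nlinarith
      rw [abs_of_pos h] at k1
      rw [abs_of_neg h'] at k2
      exact key (cr (dir D r.edge)) hcr (cr_self _) k1 (by linarith)
    · have h' : 0 < cr (dir D r.edge) (bis C d) := by nlinarith
      rw [abs_of_nonpos h] at k1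
      rw [abs_of_pos h'] at k2
      exact key (-cr (dir D r.edge)) (fun x => by rw [LinearMap.neg_apply, abs_neg]; exact hcr x)
        (by rw [LinearMap.neg_apply, cr_self, neg_zero]) (by rw [LinearMap.neg_apply]; linarith)
        (by rw [LinearMap.neg_apply]; linarith)

/-! ### Objects along edges without a common vertex -/

/-- Both endpoints are this close to points of the edge, and convex combinations stay so. The bound
is below `δ / 4`, so neighbourhoods of disjoint edges cannot meet. -/
lemma Choices.Valid.exists_near_edge (hC : C.Valid) (r : RedLabel G) {z : Plane}
    (hz : z ∈ C.arrangement.seg (.red r)) :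
    ∃ y ∈ segment ℝ (D.pos r.edge.fst) (D.pos r.edge.snd),
      dist z y ≤ D.clearance / 5 + C.rho := by
  obtain ⟨a, b, ha, hb, hab, rfl⟩ := hz
  have hδ := clearance_pos' D r.edge
  have hL := len_pos D r.edge
  have h1 : dist (C.redNear r) (D.pos r.edge.fst) ≤ D.clearance / 5 + C.rho := by
    refine (dist_triangle _ (C.center (.inWedge r.opp)) _).trans ?_
    have h1 : dist (C.redNear r) (C.center (.inWedge r.opp)) ≤ C.rho := hC.redNear_mem r
    have h2 := (hC.wedgeCenter_spec r.opp).dist_eq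
    rw [r.same_vertex] at h2
    have : dist (C.center (.inWedge r.opp)) (D.pos r.edge.fst) = D.clearance / 5 := h2
    linarith
  have h2 : dist (C.redFar r) (C.center (.onEdge r.edge)) ≤ D.clearance / 5 + C.rho := by
    have : dist (C.redFar r) (C.center (.onEdge r.edge)) ≤ C.rho := hC.redFar_mem r
    linarith
  refine ⟨a • D.pos r.edge.fst + b • C.center (.onEdge r.edge), ?_, ?_⟩
  · refine convex_segment _ _ (left_mem_segment ℝ _ _) ?_ ha hb hab
    rw [center_onEdge]
    exact add_smul_dir_mem D _ (by positivity) (by linarith)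
  · rw [dist_eq_norm] at *
    calc _ = ‖a • (C.redNear r - D.pos r.edge.fst) + b • (C.redFar r - C.center (.onEdge r.edge))‖ := by
          congr 1; change a • C.redNear r + b • C.redFar r - _ = _; module
      _ ≤ a * ‖C.redNear r - D.pos r.edge.fst‖ + b * ‖C.redFar r - C.center (.onEdge r.edge)‖ := by
          refine (norm_add_le _ _).trans_eq ?_
          rw [norm_smul, norm_smul, Real.norm_of_nonneg ha, Real.norm_of_nonneg hb]
      _ ≤ a * (D.clearance / 5 + C.rho) + b * (D.clearance / 5 + C.rho) := by gcongr
      _ = _ := by rw [← add_mul, hab, one_mul]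

lemma Choices.Valid.disjoint_red_red_apart (hC : C.Valid) {r r' : RedLabel G}
    (h : Apart r.edge r'.edge) :
    Disjoint (C.arrangement.seg (.red r)) (C.arrangement.seg (.red r')) := by
  rw [Set.disjoint_left]
  intro z hz hz'
  obtain ⟨y, hy, hd⟩ := hC.exists_near_edge r hz
  obtain ⟨y', hy', hd'⟩ := hC.exists_near_edge r' hz'
  have h1 := D.clearance_le_dist_edges r.edge.adj r'.edge.adj h.1 h.2.1 h.2.2.1 h.2.2.2 hy hy'
  have h2 := hC.rho_lt_clearance r.same_vertex r.ne
  have h3 := dist_triangle_left y y' z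
  have := hC.rho_pos
  linarith

lemma Choices.Valid.disjoint_red_onEdge_apart (hC : C.Valid) {r : RedLabel G} {d : G.Dart}
    (h : Apart r.edge d) : Disjoint (C.arrangement.seg (.red r)) (C.disk (.onEdge d)) := by
  rw [Set.disjoint_left]
  intro z hz hz'
  obtain ⟨y, hy, hd⟩ := hC.exists_near_edge r hz
  have h1 := D.clearance_le_dist_edges r.edge.adj d.adj h.1 h.2.1 h.2.2.1 h.2.2.2 hy
    (center_onEdge_mem (C := C) d)
  have h2 := hC.rho_lt_clearance r.same_vertex r.ne
  have h3 := dist_triangle_left y (C.center (.onEdge d)) z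
  have h4 : dist z (C.center (.onEdge d)) ≤ C.rho := hz'
  have := hC.rho_pos
  linarith

lemma Choices.Valid.disjoint_red_inWedge_apart (hC : C.Valid) {r : RedLabel G} {d : G.Dart}
    (h1 : d.fst ≠ r.edge.fst) (h2 : d.fst ≠ r.edge.snd) :
    Disjoint (C.arrangement.seg (.red r)) (C.disk (.inWedge d)) := by
  rw [Set.disjoint_left]
  intro z hz hz'
  obtain ⟨y, hy, hd⟩ := hC.exists_near_edge r hz
  have h3 := D.clearance_le_dist_edge r.edge.adj h1 h2 hy
  have h4 : dist (C.center (.inWedge d)) (D.pos d.fst) = D.clearance / 5 :=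
    (hC.wedgeCenter_spec d).dist_eq
  have h5 : dist z (C.center (.inWedge d)) ≤ C.rho := hz'
  have h6 := hC.rho_lt_clearance r.same_vertex r.ne
  have h7 := dist_triangle_left (D.pos d.fst) y z
  have h8 := dist_triangle z (C.center (.inWedge d)) (D.pos d.fst)
  have := hC.rho_pos
  linarith

/-- A red segment meets only the two guide disks that contain its endpoints. -/
lemma Choices.Valid.disjoint_red_disk (hC : C.Valid)
    (hcub : ∀ v, (G.neighborSet v).ncard = 3) {r : RedLabel G} {q : GuideDisk G}
    (h : ¬ r.Touches q) : Disjoint (C.arrangement.seg (.red r)) (C.disk q) := by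
  simp only [RedLabel.Touches, not_or] at h
  rcases q with d | d
  · rcases corner_cases r.edge d with ha | ha | ha | ⟨d', e', hf, hne, h1, h2⟩
    · exact hC.disjoint_red_onEdge_apart ha
    · exact absurd (by rw [ha]) h.2
    · rw [Set.disjoint_left]
      intro z hz hz'
      have ha' : d = r.edge.symm := by rw [ha, SimpleGraph.Dart.symm_symm]
      rw [ha'] at hz'
      -- If the red segment met the other disk on its own edge, it would itself be a forbidden
      -- transversal.
      exact hC.no_transversal r.edge r.opp r.same_vertex r.ne ⟨C.redNear r, C.redFar r,
        ⟨_, right_mem_segment ℝ _ _, hC.redFar_mem r⟩, ⟨z, hz, hz'⟩,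
        ⟨_, left_mem_segment ℝ _ _, hC.redNear_mem r⟩⟩
    · exact hC.disjoint_red_onEdge_corner hcub hf hne h1 h2
  · by_cases h1 : d.fst = r.edge.fst
    · exact hC.disjoint_red_inWedge_fst hcub h1 (fun h' => h.1 (by rw [h']))
    by_cases h2 : d.fst = r.edge.snd
    · exact hC.disjoint_red_inWedge_snd h2
    · exact hC.disjoint_red_inWedge_apart h1 h2

end Separation

/-! ### The internal tangent of the two disks on an edge -/

lemma norm_frame_eq_one {u : Plane} (hu : ‖u‖ = 1) {a b : ℝ} (h : a ^ 2 + b ^ 2 = 1) :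
    ‖a • u + b • rot u‖ = 1 := by
  rw [← sq_eq_sq₀ (norm_nonneg _) zero_le_one, norm_sq_eq]
  have h' := norm_sq_eq u
  rw [hu] at h'
  simp only [PiLp.add_apply, PiLp.smul_apply, smul_eq_mul, rot_zero, rot_one]
  linear_combination h - (a ^ 2 + b ^ 2) * h'

/-- Three collinear points, the middle one given by its parameter. -/
lemma mem_segment_of_params (m τ : Plane) {p b c : ℝ} (h1 : p < b) (h2 : b < c) :
    m + b • τ ∈ segment ℝ (m + p • τ) (m + c • τ) := by
  have hd : 0 < c - p := by linarith
  have ha : (c - b) / (c - p) * (c - p) = c - b := div_mul_cancel₀ _ hd.ne'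
  have hb : (b - p) / (c - p) * (c - p) = b - p := div_mul_cancel₀ _ hd.ne'
  have e1 : (c - b) / (c - p) + (b - p) / (c - p) = 1 :=
    mul_right_cancel₀ hd.ne' (by linear_combination ha + hb)
  have e2 : (c - b) / (c - p) * p + (b - p) / (c - p) * c = b :=
    mul_right_cancel₀ hd.ne' (by linear_combination p * ha + c * hb)
  refine ⟨(c - b) / (c - p), (b - p) / (c - p), div_nonneg (by linarith) hd.le,
    div_nonneg (by linarith) hd.le, e1, ?_⟩
  rw [show ∀ α β : ℝ, α • (m + p • τ) + β • (m + c • τ) = (α + β) • m + (α * p + β * c) • τ from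
    fun α β => by module, e1, e2, one_smul]

/-- If no segment meets the three disks, the third one is beyond the internal tangent of the first
two. -/
lemma tangent_side {u v : Plane} (hu : ‖u‖ = 1) {ε L ρ S K x y : ℝ} (hε : ε * ε = 1) (hρ : 0 < ρ)
    (hL : 0 < L) (hSL : S * L = 10 * ρ) (hS0 : 0 < S) (hKK : K ^ 2 = 1 - S ^ 2) (hK0 : 4 / 5 ≤ K)
    (hy0 : 0 < y) (hxL : x ≤ L / 5) (hxL' : -(L / 5) ≤ x) (hlt : ρ * (6 * L - 10 * x) < L * y)
    (hno : ¬ ∃ P Q : Plane,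
      (segment ℝ P Q ∩ Metric.closedBall (v + (3 / 5 * L) • u) ρ).Nonempty ∧
      (segment ℝ P Q ∩ Metric.closedBall (v + (2 / 5 * L) • u) ρ).Nonempty ∧
      (segment ℝ P Q ∩ Metric.closedBall (v + x • u + (ε * y) • rot u) ρ).Nonempty) :
    ρ < S * (x - L / 2) + K * y := by
  by_contra hcon
  push Not at hcon
  -- The vector `S • u + (K * ε) • rot u` is a unit normal of the internal tangent through the
  -- midpoint of the edge; `S * L = 10 * ρ` expresses tangency, the disk centres being `L / 10` from
  -- the midpoint. Here `g` is the signed distance of the third centre from the tangent and `p` the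
  -- position of its foot. If `|g| ≤ ρ`, the tangent from this foot to the farther contact point
  -- meets all three disks.
  obtain ⟨g, hg⟩ : ∃ g, g = S * (x - L / 2) + K * y := ⟨_, rfl⟩
  obtain ⟨p, hp⟩ : ∃ p, p = K * (x - L / 2) - S * y := ⟨_, rfl⟩
  have hg1 : -ρ < g := by
    have h1 : L * (-ρ) < L * g := by
      have : L * (4 / 5 * y) ≤ L * (K * y) := by gcongr
      have e1 : L * (S * (x - L / 2)) = 10 * ρ * (x - L / 2) := by rw [← hSL]; ring
      rw [hg, mul_add, e1]
      nlinarith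
    exact lt_of_mul_lt_mul_left h1 hL.le
  rw [← hg] at hcon
  have hp1 : p < -(L / 10 * K) := by
    rw [hp]; nlinarith [mul_pos hS0 hy0, mul_le_mul_of_nonneg_left hxL (by linarith : (0 : ℝ) ≤ K),
      mul_pos hL (by linarith : (0 : ℝ) < K)]
  have hLK : 0 < L / 10 * K := by positivity
  have hball : ∀ (c : ℝ) (q : Plane), |c| ≤ ρ →
      q + c • (S • u + (K * ε) • rot u) ∈ Metric.closedBall q ρ := by
    intro c q hc
    rw [Metric.mem_closedBall, dist_eq_norm, add_sub_cancel_left, norm_smul,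
      norm_frame_eq_one hu (by linear_combination hKK + K ^ 2 * hε), mul_one]
    exact hc
  refine hno ⟨v + x • u + (ε * y) • rot u + (-g) • (S • u + (K * ε) • rot u),
    v + (3 / 5 * L) • u + (-ρ) • (S • u + (K * ε) • rot u),
    ⟨_, right_mem_segment ℝ _ _, hball _ _ (by rw [abs_neg, abs_of_pos hρ])⟩,
    ⟨v + (2 / 5 * L) • u + ρ • (S • u + (K * ε) • rot u), ?_, hball _ _ (by rw [abs_of_pos hρ])⟩,
    ⟨_, left_mem_segment ℝ _ _, hball _ _ (by rw [abs_neg, abs_le]; exact ⟨hg1.le, hcon⟩)⟩⟩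
  have e1 : v + x • u + (ε * y) • rot u + (-g) • (S • u + (K * ε) • rot u) =
      v + (L / 2) • u + p • (K • u - (S * ε) • rot u) := by
    have a1 : x - g * S = L / 2 + p * K := by
      rw [hg, hp]; linear_combination -(x - L / 2) * hKK
    have a2 : ε * y - g * (K * ε) = - (p * (S * ε)) := by
      rw [hg, hp]; linear_combination -(ε * y) * hKK
    rw [show v + x • u + (ε * y) • rot u + (-g) • (S • u + (K * ε) • rot u)
      = v + (x - g * S) • u + (ε * y - g * (K * ε)) • rot u by module, a1, a2]
    module
  have e2 : v + (3 / 5 * L) • u + (-ρ) • (S • u + (K * ε) • rot u) =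
      v + (L / 2) • u + (L / 10 * K) • (K • u - (S * ε) • rot u) := by
    have a1 : 3 / 5 * L - ρ * S = L / 2 + L / 10 * K * K := by
      linear_combination -(L / 10) * hKK + S / 10 * hSL
    have a2 : - (ρ * (K * ε)) = - (L / 10 * K * (S * ε)) := by
      linear_combination K * ε / 10 * hSL
    rw [show v + (3 / 5 * L) • u + (-ρ) • (S • u + (K * ε) • rot u)
      = v + (3 / 5 * L - ρ * S) • u + (- (ρ * (K * ε))) • rot u by module, a1, a2]
    module
  have e3 : v + (2 / 5 * L) • u + ρ • (S • u + (K * ε) • rot u) =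
      v + (L / 2) • u + (-(L / 10 * K)) • (K • u - (S * ε) • rot u) := by
    have a1 : 2 / 5 * L + ρ * S = L / 2 - L / 10 * K * K := by
      linear_combination (L / 10) * hKK - S / 10 * hSL
    have a2 : (ρ * (K * ε)) = (L / 10 * K * (S * ε)) := by
      linear_combination - K * ε / 10 * hSL
    rw [show v + (2 / 5 * L) • u + ρ • (S • u + (K * ε) • rot u)
      = v + (2 / 5 * L + ρ * S) • u + (ρ * (K * ε)) • rot u by module, a1, a2]
    module
  rw [e1, e2, e3]
  exact mem_segment_of_params _ _ hp1 (by linarith)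

lemma abs_frame_functional_le {u : Plane} (hu : ‖u‖ = 1) {a b : ℝ} (h : a ^ 2 + b ^ 2 = 1)
    (z : Plane) : |(a • dt u + b • cr u) z| ≤ ‖z‖ := by
  apply abs_le_of_sq_le_sq _ (norm_nonneg _)
  have h' := dt_sq_add_cr_sq u z
  rw [hu, one_pow, one_mul] at h'
  simp only [LinearMap.add_apply, LinearMap.smul_apply, smul_eq_mul]
  have h2 : (b * dt u z - a * cr u z) ^ 2 + (a * dt u z + b * cr u z) ^ 2
      = (a ^ 2 + b ^ 2) * (dt u z ^ 2 + cr u z ^ 2) := by ring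
  rw [h, one_mul, h'] at h2
  linarith [sq_nonneg (b * dt u z - a * cr u z)]

section SameEdge

variable {V : Type*} [Finite V] {G : SimpleGraph V} {D : StraightLineDrawing G} {C : Choices D}

/-- The internal tangent line of the two disks on an edge has the wedge disk on one side. -/
lemma Choices.Valid.exists_tangent_functional (hC : C.Valid) (e : G.Dart) {ε : ℝ} (hε : ε * ε = 1)
    (hρ : 2 * (10 * C.rho) ≤ len D e) :
    ∃ K : ℝ, ∀ o : G.Dart, ∀ e' : G.Dart, (e' = e ∨ e' = e.symm) → o.fst = e'.fst → o ≠ e' →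
      0 < ε * cr (dir D e') (bis C o) →
      ∀ f : Plane →ₗ[ℝ] ℝ,
        f = (10 * C.rho / len D e) • dt (dir D e') + (K * ε) • cr (dir D e') →
        (∀ z ∈ C.disk (.inWedge o), f (D.pos e'.fst + (len D e / 2) • dir D e') < f z) ∧
        (∀ z ∈ C.disk (.onEdge e'), f (D.pos e'.fst + (len D e / 2) • dir D e') ≤ f z) := by
  have hρ0 := hC.rho_pos
  obtain ⟨S, hS⟩ : ∃ S, S = 10 * C.rho / len D e := ⟨_, rfl⟩
  have hSL : S * len D e = 10 * C.rho := by rw [hS]; exact div_mul_cancel₀ _ (len_pos D e).ne'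
  have hS0 : 0 < S := by rw [hS]; have := len_pos D e; positivity
  have hS2 : S ≤ 1 / 2 := by rw [hS, div_le_iff₀ (len_pos D e)]; linarith
  -- The cosine of the angle whose sine is `S`. It depends only on `ρ` and the length, so one
  -- tangent line serves both orientations of the edge.
  refine ⟨Real.sqrt (1 - S ^ 2), ?_⟩
  have hKK : Real.sqrt (1 - S ^ 2) ^ 2 = 1 - S ^ 2 := Real.sq_sqrt (by nlinarith)
  have hK0 : 4 / 5 ≤ Real.sqrt (1 - S ^ 2) := Real.le_sqrt_of_sq_le (by nlinarith)
  generalize Real.sqrt (1 - S ^ 2) = K at hKK hK0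
  intro o e' hee' ho hne hpos f hf
  have hlen : len D e = len D e' := by
    rcases hee' with rfl | rfl
    · rfl
    · rw [len_symm]
  rw [← hS] at hf
  rw [hlen] at hSL ⊢
  clear hS hρ hlen hee'
  have hu := norm_dir D e'
  have hL := len_pos D e'
  have hδL := clearance_le_len D e'
  have hδ := clearance_pos' D e'
  have hlt := hC.rho_mul_lt ho hne
  have hb := hC.norm_bis o
  have hcen := center_onEdge C e'
  have hcen' := center_onEdge_symm C e'
  have hw := center_inWedge C o
  have hx1 := abs_le.1 (abs_dt_le (dir D e') (bis C o))
  rw [hu, hb, mul_one] at hx1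
  have hε1 : |ε| = 1 := by
    have h := abs_mul_abs_self ε
    rw [hε] at h
    nlinarith [abs_nonneg ε]
  have habs : |cr (dir D e') (bis C o)| = ε * cr (dir D e') (bis C o) := by
    rw [← abs_of_pos hpos, abs_mul, hε1, one_mul]
  rw [habs] at hlt
  have hframe := eq_frame hu (bis C o)
  set u := dir D e'
  set L := len D e'
  obtain ⟨x, hx⟩ : ∃ x, x = D.clearance / 5 * dt u (bis C o) := ⟨_, rfl⟩
  obtain ⟨y, hy⟩ : ∃ y, y = D.clearance / 5 * (ε * cr u (bis C o)) := ⟨_, rfl⟩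
  have hy0 : 0 < y := by rw [hy]; positivity
  have hxL : x ≤ L / 5 := by rw [hx]; nlinarith [hx1.2]
  have hxL' : -(L / 5) ≤ x := by rw [hx]; nlinarith [hx1.1]
  have hlt' : C.rho * (6 * L - 10 * x) < L * y := by rw [hx, hy]; linarith
  have hw' : C.center (.inWedge o) = D.pos e'.fst + x • u + (ε * y) • rot u := by
    rw [hw, ho, hframe, hx, hy, show ε * (D.clearance / 5 * (ε * cr u (bis C o)))
      = (ε * ε) * (D.clearance / 5 * cr u (bis C o)) by ring, hε]; module
  have hdu : dt u u = 1 := by rw [dt_self, hu, one_pow]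
  have hdr : dt u (rot u) = 0 := by rw [dt_rot_right, cr_self, neg_zero]
  have hcr : cr u (rot u) = 1 := by rw [cr_rot_right, hdu]
  have fu : f u = S := by
    rw [hf]; simp only [LinearMap.add_apply, LinearMap.smul_apply, smul_eq_mul, hdu, cr_self]; ring
  have fr : f (rot u) = K * ε := by
    rw [hf]; simp only [LinearMap.add_apply, LinearMap.smul_apply, smul_eq_mul, hdr, hcr]; ring
  have hfb : ∀ z, |f z| ≤ ‖z‖ := by
    rw [hf]; exact abs_frame_functional_le hu (by linear_combination hKK + K ^ 2 * hε)
  have fc : f (C.center (.onEdge e')) = f (D.pos e'.fst + (L / 2) • u) + C.rho := by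
    rw [hcen, map_add, map_add, map_smul, map_smul, fu, smul_eq_mul, smul_eq_mul]
    linarith
  have fw : f (C.center (.inWedge o)) - f (D.pos e'.fst + (L / 2) • u) = S * (x - L / 2) + K * y := by
    rw [hw']; simp only [map_add, map_smul, smul_eq_mul, fu, fr]
    linear_combination (y * K) * hε
  have fw2 := tangent_side (v := D.pos e'.fst) hu hε hρ0 hL hSL hS0 hKK hK0 hy0 hxL hxL' hlt' (by
    rw [← hcen, ← hcen', ← hw']; exact hC.no_transversal e' o ho hne)
  rw [← fw] at fw2
  constructor
  · intro z hz
    have := abs_le.1 (abs_map_sub_center_le hfb hz)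
    linarith
  · intro z hz
    have := abs_le.1 (abs_map_sub_center_le hfb hz)
    linarith

lemma Choices.Valid.len_bound (hC : C.Valid) (r : RedLabel G) :
    2 * (10 * C.rho) ≤ len D r.edge := by
  have := hC.rho_lt_clearance r.same_vertex r.ne
  have := clearance_le_len D r.edge
  linarith

/-- Red segments from the two ends of an edge on different sides of it are disjoint. -/
lemma Choices.Valid.disjoint_red_red_opposite (hC : C.Valid) {r r' : RedLabel G}
    (hr : r'.edge = r.edge.symm) {ε : ℝ} (hε : ε * ε = 1)
    (h1 : 0 < ε * cr (dir D r.edge) (bis C r.opp)) (h2 : ε * cr (dir D r.edge) (bis C r'.opp) < 0) :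
    Disjoint (C.arrangement.seg (.red r)) (C.arrangement.seg (.red r')) := by
  obtain ⟨K, hK⟩ := hC.exists_tangent_functional r.edge hε (hC.len_bound r)
  obtain ⟨a1, a2⟩ := hK r.opp r.edge (Or.inl rfl) r.same_vertex r.ne h1 _ rfl
  obtain ⟨b1, b2⟩ := hK r'.opp r'.edge (Or.inr hr) r'.same_vertex r'.ne
    (by rw [hr, dir_symm, cr_neg_left]; linarith) _ rfl
  set f := (10 * C.rho / len D r.edge) • dt (dir D r.edge) + (K * ε) • cr (dir D r.edge) with hf
  -- Seen from the other end, the tangent functional changes sign and the midpoint is the same. Thus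
  -- the two red segments lie on opposite closed sides of one line.
  have hf' : (10 * C.rho / len D r.edge) • dt (dir D r'.edge) + (K * ε) • cr (dir D r'.edge) = -f := by
    ext x
    rw [hf, hr, dir_symm]
    simp only [LinearMap.add_apply, LinearMap.smul_apply, LinearMap.neg_apply, cr_neg_left,
      smul_eq_mul]
    rw [show dt (-dir D r.edge) x = - dt (dir D r.edge) x by
      simp only [dt_apply, PiLp.neg_apply]; ring]
    ring
  have hm : D.pos r'.edge.fst + (len D r.edge / 2) • dir D r'.edge =
      D.pos r.edge.fst + (len D r.edge / 2) • dir D r.edge := by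
    rw [hr, dir_symm, show D.pos r.edge.symm.fst = D.pos r.edge.snd from rfl, pos_snd]; module
  rw [hf', hm] at b1 b2
  simp only [LinearMap.neg_apply] at b1 b2
  set m := f (D.pos r.edge.fst + (len D r.edge / 2) • dir D r.edge)
  rw [Set.disjoint_left]
  rintro z ⟨a, b, ha, hb, hab, rfl⟩ ⟨a', b', ha', hb', hab', he⟩
  have n1 := a1 _ (hC.redNear_mem r)
  have n2 := a2 _ (hC.redFar_mem r)
  have n1' := b1 _ (hC.redNear_mem r')
  have n2' := b2 _ (hC.redFar_mem r')
  have hev := congrArg f he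
  change f (a' • C.redNear r' + b' • C.redFar r') = f (a • C.redNear r + b • C.redFar r) at hev
  simp only [map_add, map_smul, smul_eq_mul] at hev
  have hb1 : b = 1 - a := by linarith
  have hb1' : b' = 1 - a' := by linarith
  -- The near endpoints are strictly off the line, so a common point must be the far endpoint of
  -- both segments. These endpoints lie in disjoint disks.
  have ha0 : a = 0 := by
    by_contra h
    have : 0 < a := lt_of_le_of_ne ha (Ne.symm h)
    subst hb1 hb1'
    nlinarith [mul_pos this (sub_pos.2 n1), mul_nonneg hb (sub_nonneg.2 n2),
      mul_nonneg ha' (sub_nonneg.2 n1'.le), mul_nonneg hb' (sub_nonneg.2 n2')]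
  have ha0' : a' = 0 := by
    by_contra h
    have : 0 < a' := lt_of_le_of_ne ha' (Ne.symm h)
    subst hb1 hb1'
    nlinarith [mul_pos this (sub_pos.2 n1'), mul_nonneg hb (sub_nonneg.2 n2),
      mul_nonneg ha (sub_nonneg.2 n1.le), mul_nonneg hb' (sub_nonneg.2 n2')]
  rw [hb1, hb1', ha0, ha0'] at he
  simp only [zero_smul, zero_add, sub_zero, one_smul] at he
  have he' : C.redFar r' = C.redFar r := he
  refine Set.disjoint_left.1 (hC.disks_disjoint (.onEdge r.edge) (.onEdge r'.edge) ?_)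
    (hC.redFar_mem r) (by rw [← he']; exact hC.redFar_mem r')
  intro h
  injection h with h
  rw [hr] at h
  exact r.edge.symm_ne h.symm

end SameEdge

/-! ### Red segments from the two ends of an edge on the same side -/

lemma cr_eq_frame {u : Plane} (hu : ‖u‖ = 1) (x y : Plane) :
    cr x y = dt u x * cr u y - cr u x * dt u y := by
  have h := norm_sq_eq u
  rw [hu] at h
  simp only [cr_apply, dt_apply]
  linear_combination (x 0 * y 1 - x 1 * y 0) * h

/-- A segment that stays in the strip over `[N, F]` and misses `[N, F]` stays on one side. -/
lemma side_of_disjoint_segment {f : Plane →ₗ[ℝ] ℝ} {ε : ℝ} {N F z₀ z₁ : Plane}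
    (hN : ∀ z ∈ segment ℝ z₀ z₁, f N < f z) (hF : ∀ z ∈ segment ℝ z₀ z₁, f z < f F)
    (hdisj : Disjoint (segment ℝ N F) (segment ℝ z₀ z₁))
    (h0 : ε * cr (F - N) (z₀ - N) < 0) : ε * cr (F - N) (z₁ - N) < 0 := by
  by_contra hcon
  push Not at hcon
  obtain ⟨p, hp⟩ : ∃ p, p = ε * cr (F - N) (z₀ - N) := ⟨_, rfl⟩
  obtain ⟨q, hq⟩ : ∃ q, q = ε * cr (F - N) (z₁ - N) := ⟨_, rfl⟩
  rw [← hp] at h0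
  rw [← hq] at hcon
  have hε : ε ≠ 0 := by rintro rfl; simp at hp; linarith
  have hd : 0 < q - p := by linarith
  have e1 : q / (q - p) + -p / (q - p) = 1 := by field_simp; ring
  -- These weights give the point of `[z₀, z₁]` on the line through `N` and `F`. The strip condition
  -- then puts it on the segment `[N, F]`.
  have hz : (q / (q - p)) • z₀ + (-p / (q - p)) • z₁ ∈ segment ℝ z₀ z₁ :=
    ⟨_, _, div_nonneg hcon hd.le, div_nonneg (by linarith) hd.le, e1, rfl⟩
  obtain ⟨z, hzdef⟩ : ∃ z, z = (q / (q - p)) • z₀ + (-p / (q - p)) • z₁ := ⟨_, rfl⟩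
  rw [← hzdef] at hz
  have hzN : z - N = (q / (q - p)) • (z₀ - N) + (-p / (q - p)) • (z₁ - N) := by
    rw [hzdef, smul_sub, smul_sub]
    nth_rw 1 [← one_smul ℝ N]; rw [← e1]; module
  have hg : cr (F - N) (z - N) = 0 := by
    apply mul_left_cancel₀ hε
    rw [mul_zero, hzN, map_add, map_smul, map_smul, smul_eq_mul, smul_eq_mul, mul_add,
      mul_left_comm, ← hp, mul_left_comm, ← hq]
    ring
  have hNF : F - N ≠ 0 := by
    rw [sub_ne_zero]; rintro rfl
    exact absurd (hN z hz) (not_lt.2 (hF z hz).le)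
  obtain ⟨κ, hκ⟩ := exists_smul_of_cr_eq_zero hNF hg
  have hf := congrArg f hκ
  rw [map_sub, map_smul, map_sub, smul_eq_mul] at hf
  have h1 := hN z hz
  have h2 := hF z hz
  have hκ0 : 0 ≤ κ := by
    by_contra h; push Not at h; nlinarith
  have hκ1 : κ ≤ 1 := by
    by_contra h; push Not at h; nlinarith
  refine Set.disjoint_left.1 hdisj ?_ hz
  rw [segment_eq_image']
  exact ⟨κ, ⟨hκ0, hκ1⟩, by simp only; rw [← hκ]; abel⟩

section SameSide

variable {V : Type*} {G : SimpleGraph V} {D : StraightLineDrawing G} {C : Choices D}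

/-- Two red labels at the two ends of an edge, on the same side of it. -/
def Partner (C : Choices D) (r r' : RedLabel G) : Prop :=
  r'.edge = r.edge.symm ∧
    0 < cr (dir D r.edge) (bis C r.opp) * cr (dir D r.edge) (bis C r'.opp)

lemma RedLabel.ext' {r r' : RedLabel G} (h1 : r.edge = r'.edge) (h2 : r.opp = r'.opp) : r = r' := by
  cases r; cases r'; cases h1; cases h2; rfl

lemma exists_other_dart (hcub : ∀ v, (G.neighborSet v).ncard = 3) (e : G.Dart) :
    ∃ o : G.Dart, o.fst = e.fst ∧ o ≠ e := by
  obtain ⟨a, b, c, hab, hac, hbc, hs⟩ := Set.ncard_eq_three.1 (hcub e.fst)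
  have key : ∀ x ∈ ({a, b, c} : Set V), G.Adj e.fst x := by rw [← hs]; exact fun x hx => hx
  by_cases h : a = e.snd
  · exact ⟨⟨(e.fst, b), key b (by simp)⟩, rfl, fun h' =>
      hab (h.trans (congrArg (fun d : G.Dart => d.snd) h').symm)⟩
  · exact ⟨⟨(e.fst, a), key a (by simp)⟩, rfl, fun h' =>
      h (congrArg (fun d : G.Dart => d.snd) h')⟩

variable [Finite V]

-- Let `X` be the coordinate along the edge and `Y` the one across it, towards the common side of
-- the wedges. Along `r` from near to far end, `X` grows and `Y` falls; the near end of `r'` is both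
-- further along and higher than the far end of `r`, hence above its line. The disk of the far end
-- of `r'` lies in the strip over `r` and misses `r`. Its lowest point is below the line of `r`, so
-- the far end of `r'` is below as well.
set_option maxHeartbeats 600000 in
lemma Choices.Valid.red_orientation (hC : C.Valid) (hcub : ∀ v, (G.neighborSet v).ncard = 3)
    {r r' : RedLabel G} (hr : r'.edge = r.edge.symm) {ε : ℝ} (hε : ε * ε = 1)
    (h1 : 0 < ε * cr (dir D r.edge) (bis C r.opp))
    (h2 : 0 < ε * cr (dir D r.edge) (bis C r'.opp)) :
    0 < ε * cr (C.redFar r - C.redNear r) (C.redNear r' - C.redNear r) ∧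
      ε * cr (C.redFar r - C.redNear r) (C.redFar r' - C.redNear r) < 0 := by
  have hu := norm_dir D r.edge
  have hL := clearance_le_len D r.edge
  have hδ := clearance_pos' D r.edge
  have hρ := hC.rho_pos
  have hρδ := hC.rho_lt_clearance r.same_vertex r.ne
  have k1 := hC.rho_lt r.same_vertex r.ne
  have k2 := hC.rho_lt r'.same_vertex r'.ne
  rw [hr, dir_symm, cr_neg_left, abs_neg] at k2
  have hε1 : |ε| = 1 := by
    have h := abs_mul_abs_self ε
    rw [hε] at h
    nlinarith [abs_nonneg ε]
  have habs : ∀ c : ℝ, 0 < ε * c → |c| = ε * c := fun c hc => by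
    rw [← abs_of_pos hc, abs_mul, hε1, one_mul]
  rw [habs _ h1] at k1
  rw [habs _ h2] at k2
  have hX : ∀ x, |dt (dir D r.edge) x| ≤ ‖x‖ := fun x => by
    have := abs_dt_le (dir D r.edge) x; rwa [hu, one_mul] at this
  have hY : ∀ x, |(ε • cr (dir D r.edge)) x| ≤ ‖x‖ := fun x => by
    rw [LinearMap.smul_apply, smul_eq_mul, abs_mul, hε1, one_mul]
    have := abs_cr_le (dir D r.edge) x; rwa [hu, one_mul] at this
  have hdisj := hC.disjoint_red_disk hcub (r := r) (q := .onEdge r'.edge) (by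
    rintro (h | h)
    · cases h
    · injection h with h; rw [hr] at h; exact r.edge.symm_ne h)
  have hXu : dt (dir D r.edge) (dir D r.edge) = 1 := by rw [dt_self, hu, one_pow]
  have hYu : (ε • cr (dir D r.edge)) (dir D r.edge) = 0 := by
    rw [LinearMap.smul_apply, cr_self, smul_zero]
  have hYr : (ε • cr (dir D r.edge)) (rot (dir D r.edge)) = ε := by
    rw [LinearMap.smul_apply, cr_rot_right, hXu, smul_eq_mul, mul_one]
  have hXr : dt (dir D r.edge) (rot (dir D r.edge)) = 0 := by
    rw [dt_rot_right, cr_self, neg_zero]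
  have hcrXY : ∀ a b, ε * cr a b = dt (dir D r.edge) a * (ε • cr (dir D r.edge)) b
      - (ε • cr (dir D r.edge)) a * dt (dir D r.edge) b := by
    intro a b
    rw [cr_eq_frame hu a b, LinearMap.smul_apply, LinearMap.smul_apply, smul_eq_mul, smul_eq_mul]
    ring
  have hYb : (ε • cr (dir D r.edge)) (bis C r.opp) = ε * cr (dir D r.edge) (bis C r.opp) := rfl
  have hYb' : (ε • cr (dir D r.edge)) (bis C r'.opp) = ε * cr (dir D r.edge) (bis C r'.opp) := rfl
  have ho' : D.pos r'.opp.fst = D.pos r.edge.snd := by rw [r'.same_vertex, hr]; rfl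
  -- coordinates of the four endpoints
  have nX := abs_le.1 (abs_map_of_mem_inWedge hX (hC.redNear_mem r))
  have nY := abs_le.1 (abs_map_of_mem_inWedge hY (hC.redNear_mem r))
  have n'X := abs_le.1 (abs_map_of_mem_inWedge hX (hC.redNear_mem r'))
  have n'Y := abs_le.1 (abs_map_of_mem_inWedge hY (hC.redNear_mem r'))
  have fX := abs_le.1 (abs_map_sub_center_le hX (hC.redFar_mem r))
  have fY := abs_le.1 (abs_map_sub_center_le hY (hC.redFar_mem r))
  have f'X : ∀ z ∈ C.disk (.onEdge r'.edge), |_| ≤ _ := fun z hz => abs_map_sub_center_le hX hz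
  have bX := abs_le.1 (hX (bis C r.opp))
  have b'X := abs_le.1 (hX (bis C r'.opp))
  rw [hC.norm_bis] at bX b'X
  have hcen' := center_onEdge_symm C r.edge
  rw [← hr] at hcen'
  rw [r.same_vertex] at nX nY
  rw [hYb] at nY
  rw [hYb', ho', pos_snd, map_add, map_smul, hYu, smul_zero, add_zero] at n'Y
  rw [ho', pos_snd, map_add, map_smul, hXu, smul_eq_mul, mul_one] at n'X
  rw [center_onEdge, map_add, map_smul, hXu, smul_eq_mul, mul_one] at fX
  rw [center_onEdge, map_add, map_smul, hYu, smul_zero, add_zero] at fY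
  simp only [hcen', map_add, map_smul, hXu, smul_eq_mul, mul_one] at f'X
  -- The lowest point of the edge disk of `r'`, at height `-ρ`, which the far end of `r` does not
  -- undercut.
  have hz0 : C.center (.onEdge r'.edge) + (-(ε * C.rho)) • rot (dir D r.edge) ∈
      C.disk (.onEdge r'.edge) := by
    apply mem_disk_of_norm
    rw [add_sub_cancel_left, norm_smul, norm_rot, hu, mul_one, norm_neg, norm_mul,
      Real.norm_eq_abs, hε1, one_mul, Real.norm_of_nonneg hρ.le]
  have z0X : dt (dir D r.edge) (C.center (.onEdge r'.edge) + (-(ε * C.rho)) • rot (dir D r.edge)) =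
      dt (dir D r.edge) (D.pos r.edge.fst) + 2 / 5 * len D r.edge := by
    rw [hcen']; simp only [map_add, map_smul, hXu, hXr, smul_eq_mul]; ring
  have z0Y : (ε • cr (dir D r.edge))
      (C.center (.onEdge r'.edge) + (-(ε * C.rho)) • rot (dir D r.edge)) =
      (ε • cr (dir D r.edge)) (D.pos r.edge.fst) - C.rho := by
    rw [hcen', map_add, map_add, map_smul, map_smul, hYu, hYr, smul_eq_mul, smul_eq_mul]
    linear_combination - C.rho * hε
  have bXδ : D.clearance / 5 * dt (dir D r.edge) (bis C r.opp) ≤ D.clearance / 5 := by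
    nlinarith [bX.2]
  have b'Xδ : -(D.clearance / 5) ≤ D.clearance / 5 * dt (dir D r.edge) (bis C r'.opp) := by
    nlinarith [b'X.1]
  set X := dt (dir D r.edge)
  set Y := ε • cr (dir D r.edge)
  constructor
  · rw [hcrXY]
    simp only [map_sub]
    have p1 : 0 < X (C.redFar r) - X (C.redNear r) := by linarith [fX.1, nX.2]
    have p2 : 0 < Y (C.redNear r') - Y (C.redFar r) := by linarith [fY.2, n'Y.1]
    have p3 : 0 < Y (C.redNear r) - Y (C.redFar r) := by linarith [fY.2, nY.1]
    have p4 : 0 < X (C.redNear r') - X (C.redFar r) := by linarith [fX.2, n'X.1]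
    linarith [mul_pos p1 p2, mul_pos p3 p4]
  · have hconv : segment ℝ (C.center (.onEdge r'.edge) + (-(ε * C.rho)) • rot (dir D r.edge))
        (C.redFar r') ⊆ C.disk (.onEdge r'.edge) :=
      (convex_closedBall _ _).segment_subset hz0 (hC.redFar_mem r')
    refine side_of_disjoint_segment (f := X) (fun z hz => ?_) (fun z hz => ?_)
      (hdisj.mono_right hconv) ?_
    · have := abs_le.1 (f'X z (hconv hz)); linarith [nX.2]
    · have := abs_le.1 (f'X z (hconv hz)); linarith [fX.1]
    · rw [hcrXY]
      simp only [map_sub]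
      rw [z0X, z0Y]
      have p1 : 0 < X (C.redFar r) - X (C.redNear r) := by linarith [fX.1, nX.2]
      have p3 : 0 < Y (C.redNear r) - Y (C.redFar r) := by linarith [fY.2, nY.1]
      have p4 : 0 ≤ Y (C.redFar r) - (Y (D.pos r.edge.fst) - C.rho) := by linarith [fY.1]
      have p5 : 0 < X (C.redFar r) - (X (D.pos r.edge.fst) + 2 / 5 * len D r.edge) := by
        linarith [fX.1]
      linarith [mul_nonneg p1.le p4, mul_pos p3 p5]

/-- Red segments from the two ends of an edge on the same side of it cross. -/
lemma Choices.Valid.crosses_red_red (hC : C.Valid) (hcub : ∀ v, (G.neighborSet v).ncard = 3)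
    {r r' : RedLabel G} (hr : r'.edge = r.edge.symm) {ε : ℝ} (hε : ε * ε = 1)
    (h1 : 0 < ε * cr (dir D r.edge) (bis C r.opp))
    (h2 : 0 < ε * cr (dir D r.edge) (bis C r'.opp)) :
    C.arrangement.Crosses (.red r) (.red r') := by
  obtain ⟨a1, a2⟩ := hC.red_orientation hcub hr hε h1 h2
  have hr' : r.edge = r'.edge.symm := by rw [hr, SimpleGraph.Dart.symm_symm]
  have hd : dir D r'.edge = - dir D r.edge := by rw [hr, dir_symm]
  -- Reversing the edge negates its direction, so the same side is described by the opposite sign.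
  obtain ⟨b1, b2⟩ := hC.red_orientation hcub hr' (ε := -ε) (by linarith)
    (by rw [hd, cr_neg_left]; linarith) (by rw [hd, cr_neg_left]; linarith)
  obtain ⟨x, hx, hx', hxx⟩ := exists_crossing (a := C.redNear r) (b := C.redFar r)
    (c := C.redNear r') (d := C.redFar r')
    (by have := mul_neg_of_pos_of_neg a1 a2
        calc _ = (ε * ε) * _ := by rw [hε, one_mul]
          _ < 0 := by linarith)
    (by have := mul_neg_of_pos_of_neg b1 b2
        calc _ = (ε * ε) * _ := by rw [hε, one_mul]
          _ < 0 := by linarith)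
  refine ⟨?_, ?_, x, hx, hx', hxx⟩
  · change C.redNear r ≠ C.redFar r
    intro h; rw [h, sub_self] at a1; simp [cr_apply] at a1
  · change C.redNear r' ≠ C.redFar r'
    intro h; rw [h, sub_self] at b1; simp [cr_apply] at b1

lemma exists_sign {c : ℝ} (h : c ≠ 0) : ∃ ε : ℝ, ε * ε = 1 ∧ 0 < ε * c := by
  rcases lt_or_gt_of_ne h with h | h
  · exact ⟨-1, by norm_num, by linarith⟩
  · exact ⟨1, by norm_num, by linarith⟩

lemma Choices.Valid.cr_dir_bis_ne_zero (hC : C.Valid) {e o : G.Dart} (h : o.fst = e.fst)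
    (hne : o ≠ e) : cr (dir D e) (bis C o) ≠ 0 := by
  intro h0
  have := hC.rho_lt h hne
  rw [h0, abs_zero, mul_zero] at this
  linarith [hC.rho_pos]

lemma Choices.Valid.cr_dir_bis_ne_zero' (hC : C.Valid) {r r' : RedLabel G}
    (hr : r'.edge = r.edge.symm) : cr (dir D r.edge) (bis C r'.opp) ≠ 0 := by
  have := hC.cr_dir_bis_ne_zero r'.same_vertex r'.ne
  rwa [hr, dir_symm, cr_neg_left, neg_ne_zero] at this

lemma Choices.Valid.crosses_of_partner (hC : C.Valid) (hcub : ∀ v, (G.neighborSet v).ncard = 3)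
    {r r' : RedLabel G} (h : Partner C r r') : C.arrangement.Crosses (.red r) (.red r') := by
  obtain ⟨ε, hε, h1⟩ := exists_sign (hC.cr_dir_bis_ne_zero r.same_vertex r.ne)
  refine hC.crosses_red_red hcub h.1 hε h1 ?_
  have : 0 < (ε * cr (dir D r.edge) (bis C r.opp)) * (ε * cr (dir D r.edge) (bis C r'.opp)) := by
    calc 0 < (ε * ε) * (cr (dir D r.edge) (bis C r.opp) * cr (dir D r.edge) (bis C r'.opp)) := by
            rw [hε, one_mul]; exact h.2
      _ = _ := by ring
  exact pos_of_mul_pos_right this h1.le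

/-- By the position of the two edges: disjoint edges are handled by the clearance, equal darts and
common wedges by the rule for a shared disk, opposite darts by the tangent functional (non-partners
lie on different sides), and corners by the corner functional. -/
lemma Choices.Valid.disjoint_red_red (hC : C.Valid) (hcub : ∀ v, (G.neighborSet v).ncard = 3)
    {r r' : RedLabel G} (hne : r ≠ r') (h : ¬ Partner C r r') :
    Disjoint (C.arrangement.seg (.red r)) (C.arrangement.seg (.red r')) := by
  rcases corner_cases r.edge r'.edge with ha | ha | ha | ⟨d', e', hf, hne', h1, h2⟩
  · exact hC.disjoint_red_red_apart ha
  · exact hC.red_disjoint (.onEdge r.edge) r r' hne (Or.inr rfl) (Or.inr (by rw [ha]))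
  · have hr : r'.edge = r.edge.symm := by rw [ha, SimpleGraph.Dart.symm_symm]
    obtain ⟨ε, hε, h1⟩ := exists_sign (hC.cr_dir_bis_ne_zero r.same_vertex r.ne)
    refine hC.disjoint_red_red_opposite hr hε h1 ?_
    by_contra hcon
    push Not at hcon
    have h0 := hC.cr_dir_bis_ne_zero' hr
    apply h
    refine ⟨hr, lt_of_le_of_ne ?_ (Ne.symm (mul_ne_zero
      (hC.cr_dir_bis_ne_zero r.same_vertex r.ne) h0))⟩
    calc 0 ≤ (ε * cr (dir D r.edge) (bis C r.opp)) * (ε * cr (dir D r.edge) (bis C r'.opp)) :=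
          mul_nonneg h1.le hcon
      _ = (ε * ε) * (cr (dir D r.edge) (bis C r.opp) * cr (dir D r.edge) (bis C r'.opp)) := by ring
      _ = _ := by rw [hε, one_mul]
  · by_cases hw : r.edge = d' ∧ r'.edge = e' ∧ r.opp = r'.opp
    · exact hC.red_disjoint (.inWedge r.opp) r r' hne (Or.inl rfl) (Or.inl (by rw [hw.2.2]))
    · exact hC.disjoint_red_red_corner hcub hf hne' h1 h2 hw

/-- The two wedges along the edge at its far end lie on opposite sides of it, so exactly one is on
the side of `r`. -/
lemma Choices.Valid.exists_partner (hC : C.Valid) (hcub : ∀ v, (G.neighborSet v).ncard = 3)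
    (r : RedLabel G) : ∃ r', ∀ r'', Partner C r r'' ↔ r'' = r' := by
  obtain ⟨o, ho, hoe⟩ := exists_other_dart hcub r.edge.symm
  obtain ⟨t, ht, hte, hto, hall⟩ := exists_third_dart hcub ho hoe
  have hop : cr (dir D r.edge.symm) (bis C o) * cr (dir D r.edge.symm) (bis C t) < 0 :=
    (hC.wedgeCenter_spec o).opposite_sides (hC.wedgeCenter_spec t) ho.symm (ht.trans ho.symm)
      hoe.symm hto hte.symm
  rw [dir_symm, cr_neg_left, cr_neg_left, neg_mul_neg] at hop
  have h0 := hC.cr_dir_bis_ne_zero r.same_vertex r.ne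
  have key : ∀ o t : G.Dart, ∀ ho : o.fst = r.edge.symm.fst, ∀ hoe : o ≠ r.edge.symm,
      (∀ d : G.Dart, d.fst = r.edge.symm.fst → d = r.edge.symm ∨ d = o ∨ d = t) →
      0 < cr (dir D r.edge) (bis C r.opp) * cr (dir D r.edge) (bis C o) →
      cr (dir D r.edge) (bis C r.opp) * cr (dir D r.edge) (bis C t) < 0 →
      ∃ r', ∀ r'', Partner C r r'' ↔ r'' = r' := by
    intro o t ho hoe hall hpos hneg
    refine ⟨⟨r.edge.symm, o, ho, hoe⟩, fun r'' => ⟨fun h => ?_, ?_⟩⟩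
    · rcases hall r''.opp (by rw [r''.same_vertex, h.1]) with h1 | h1 | h1
      · exact absurd (h1.trans h.1.symm) r''.ne
      · exact RedLabel.ext' h.1 h1
      · have := h.2; rw [h1] at this; linarith
    · rintro rfl; exact ⟨rfl, hpos⟩
  set p := cr (dir D r.edge) (bis C r.opp)
  set a := cr (dir D r.edge) (bis C o)
  set b := cr (dir D r.edge) (bis C t)
  have hp2 : 0 < p * p := mul_self_pos.2 h0
  have hprod : (p * a) * (p * b) < 0 := by nlinarith
  rcases lt_trichotomy (p * a) 0 with h | h | h
  · exact key t o ht hte (fun d hd => by have := hall d hd; tauto) (by nlinarith) h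
  · rw [h, zero_mul] at hprod; exact absurd hprod (lt_irrefl 0)
  · exact key o t ho hoe hall h (by nlinarith)

end SameSide

/-! ### Symmetry of crossing, and incidences of red labels with guide disks -/

namespace ColoredSegments

variable {ι : Type*} {A : ColoredSegments ι} {i j : ι}

lemma Crosses.symm (h : A.Crosses i j) : A.Crosses j i := by
  obtain ⟨h1, h2, x, h3, h4, h5⟩ := h
  exact ⟨h2, h1, x, h4, h3, by rw [Set.inter_comm]; exact h5⟩

lemma Crosses.nonempty (h : A.Crosses i j) : (A.seg i ∩ A.seg j).Nonempty := by
  obtain ⟨h1, h2, x, h3, h4, h5⟩ := h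
  rw [h5]; exact Set.singleton_nonempty x

lemma not_crosses_of_disjoint (h : Disjoint (A.seg i) (A.seg j)) : ¬ A.Crosses i j :=
  fun h' => Set.not_disjoint_iff_nonempty_inter.2 h'.nonempty h

end ColoredSegments

section Labels

variable {V : Type*} {G : SimpleGraph V}

lemma finite_segLabel [Finite V] : Finite (SegLabel G) := by
  have hd : Finite G.Dart := Finite.of_injective (fun d : G.Dart => d.toProd)
    fun d d' h => SimpleGraph.Dart.ext _ _ h
  have hr : Finite (RedLabel G) := Finite.of_injective (fun r : RedLabel G => (r.edge, r.opp))
    fun r r' h => RedLabel.ext' (congrArg Prod.fst h) (congrArg Prod.snd h)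
  have hq : Finite (GuideDisk G) := Finite.of_surjective
    (Sum.elim GuideDisk.onEdge GuideDisk.inWedge : G.Dart ⊕ G.Dart → GuideDisk G) (by
      rintro (d | d)
      · exact ⟨Sum.inl d, rfl⟩
      · exact ⟨Sum.inr d, rfl⟩)
  exact Finite.of_surjective (Sum.elim SegLabel.red SegLabel.blue : _ → SegLabel G) (by
      rintro (d | d)
      · exact ⟨Sum.inl d, rfl⟩
      · exact ⟨Sum.inr d, rfl⟩)

/-- Exactly two red segments end in each guide disk. -/
lemma exists_touching_pair (hcub : ∀ v, (G.neighborSet v).ncard = 3) (q : GuideDisk G) :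
    ∃ r r' : RedLabel G, r ≠ r' ∧ ∀ x : RedLabel G, x.Touches q ↔ x = r ∨ x = r' := by
  rcases q with d | d
  · obtain ⟨o, ho, hod⟩ := exists_other_dart hcub d
    obtain ⟨t, ht, htd, hto, hall⟩ := exists_third_dart hcub ho hod
    refine ⟨⟨d, o, ho, hod⟩, ⟨d, t, ht, htd⟩, fun h => hto (congrArg RedLabel.opp h).symm,
      fun x => ⟨?_, ?_⟩⟩
    · rintro (h | h)
      · cases h
      · injection h with h
        rcases hall x.opp (by rw [x.same_vertex, h]) with h1 | h1 | h1
        · exact absurd (h1.trans h) x.ne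
        · exact Or.inl (RedLabel.ext' h.symm h1)
        · exact Or.inr (RedLabel.ext' h.symm h1)
    · rintro (rfl | rfl) <;> exact Or.inr rfl
  · obtain ⟨o, ho, hod⟩ := exists_other_dart hcub d
    obtain ⟨t, ht, htd, hto, hall⟩ := exists_third_dart hcub ho hod
    refine ⟨⟨o, d, ho.symm, hod.symm⟩, ⟨t, d, ht.symm, htd.symm⟩,
      fun h => hto (congrArg RedLabel.edge h).symm, fun x => ⟨?_, ?_⟩⟩
    · rintro (h | h)
      · injection h with h
        rcases hall x.edge (by rw [← x.same_vertex, h]) with h1 | h1 | h1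
        · exact absurd (h.symm.trans h1.symm) x.ne
        · exact Or.inl (RedLabel.ext' h1 h.symm)
        · exact Or.inr (RedLabel.ext' h1 h.symm)
      · cases h
    · rintro (rfl | rfl) <;> exact Or.inl rfl

end Labels

/-- A point of a segment outside two convex sets around the two ends lies between the points of
these sets. -/
lemma sbtw_of_convex {N F x y z : Plane} {S T : Set Plane} (hS : Convex ℝ S) (hT : Convex ℝ T)
    (hN : N ∈ S) (hF : F ∈ T) (hxS : x ∈ S) (hzT : z ∈ T) (hyS : y ∉ S) (hyT : y ∉ T)
    (hx : x ∈ segment ℝ N F) (hy : y ∈ segment ℝ N F) (hz : z ∈ segment ℝ N F) : Sbtw ℝ x y z := by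
  refine ⟨?_, fun h => hyS (by rw [h]; exact hxS), fun h => hyT (by rw [h]; exact hzT)⟩
  rw [segment_eq_image'] at hx hy hz
  obtain ⟨a, ha, rfl⟩ := hx
  obtain ⟨b, hb, rfl⟩ := hy
  obtain ⟨c, hc, rfl⟩ := hz
  rw [← mem_segment_iff_wbtw]
  simp only at *
  -- With parameters `a`, `b`, `c` of `x`, `y`, `z`: if `b ≤ a`, then `y` lies between `N` and `x`,
  -- hence in `S`; if `c ≤ b`, it lies between `z` and `F`, hence in `T`.
  refine mem_segment_of_params N (F - N) ?_ ?_
  · by_contra h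
    push Not at h
    rcases eq_or_lt_of_le h with h | h
    · exact hyS (by rw [h]; exact hxS)
    rcases eq_or_lt_of_le hb.1 with h' | h'
    · exact hyS (by rw [← h', zero_smul, add_zero]; exact hN)
    · have := mem_segment_of_params N (F - N) h' h
      rw [zero_smul, add_zero] at this
      exact hyS (hS.segment_subset hN hxS this)
  · by_contra h
    push Not at h
    rcases eq_or_lt_of_le h with h | h
    · exact hyT (by rw [← h]; exact hzT)
    rcases eq_or_lt_of_le hb.2 with h' | h'
    · exact hyT (by rw [h', one_smul, add_sub_cancel]; exact hF)
    · have := mem_segment_of_params N (F - N) h h'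
      rw [one_smul, add_sub_cancel] at this
      exact hyT (hT.segment_subset hzT hF this)

/-! ### Proof that the family is a red–blue arrangement -/

section Crossings

variable {V : Type*} {G : SimpleGraph V} {D : StraightLineDrawing G} {C : Choices D}

lemma Choices.Valid.blue_subset (hC : C.Valid) (q : GuideDisk G) :
    C.arrangement.seg (.blue q) ⊆ C.disk q :=
  (convex_closedBall _ _).segment_subset (hC.blueFst_mem q) (hC.blueSnd_mem q)

lemma Choices.Valid.disjoint_blue_blue (hC : C.Valid) {q q' : GuideDisk G} (h : q ≠ q') :
    Disjoint (C.arrangement.seg (.blue q)) (C.arrangement.seg (.blue q')) :=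
  (hC.disks_disjoint q q' h).mono (hC.blue_subset q) (hC.blue_subset q')

/-- Being joined by a chain of pairwise intersecting segments. -/
def Linked (C : Choices D) : SegLabel G → SegLabel G → Prop :=
  Relation.ReflTransGen fun i j => (C.arrangement.seg i ∩ C.arrangement.seg j).Nonempty

lemma Linked.of_crosses {i j : SegLabel G} (h : C.arrangement.Crosses i j) : Linked C i j :=
  Relation.ReflTransGen.single h.nonempty

lemma Linked.symm {i j : SegLabel G} (h : Linked C i j) : Linked C j i := by
  induction h with
  | refl => exact Relation.ReflTransGen.refl
  | tail _ h ih => exact Relation.ReflTransGen.head (by rwa [Set.inter_comm]) ih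

lemma Linked.trans {i j k : SegLabel G} (h : Linked C i j) (h' : Linked C j k) : Linked C i k :=
  Relation.ReflTransGen.trans h h'

lemma Choices.Valid.linked_same_disk (hC : C.Valid) {q : GuideDisk G} {r r' : RedLabel G}
    (h : r.Touches q) (h' : r'.Touches q) : Linked C (.red r) (.red r') :=
  (Linked.of_crosses (hC.blue_crosses q r h)).symm.trans (Linked.of_crosses (hC.blue_crosses q r' h'))

/-- A property of red labels that is inherited through guide disks holds for all labels of a
vertex. -/
lemma same_vertex_induction (hcub : ∀ v, (G.neighborSet v).ncard = 3) {P : RedLabel G → Prop}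
    (hP : ∀ (q : GuideDisk G) (r r' : RedLabel G), r.Touches q → r'.Touches q → P r → P r')
    {r r' : RedLabel G} (h : r.edge.fst = r'.edge.fst) (hr : P r) : P r' := by
  -- Stay in the wedge of `r` and change to the edge `e`, then use the disk on `e` to change wedge.
  -- This requires that `e` bounds the wedge of `r`.
  have key : ∀ (r : RedLabel G) (e : G.Dart) (he : r.opp.fst = e.fst) (hne : r.opp ≠ e)
      (r' : RedLabel G), r'.edge = e → P r → P r' := by
    intro r e he hne r' hr' h
    have h1 : P ⟨e, r.opp, he, hne⟩ := hP (.inWedge r.opp) r _ (Or.inl rfl) (Or.inl rfl) h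
    exact hP (.onEdge e) _ r' (Or.inr rfl) (Or.inr (by rw [hr'])) h1
  have ho : r.opp.fst = r'.edge.fst := by rw [r.same_vertex, h]
  by_cases hne : r.opp = r'.edge
  -- The wedge of `r` is opposite the target edge, so first move to the other wedge along the edge
  -- of `r`.
  · obtain ⟨t, ht, hte, hto, -⟩ := exists_third_dart hcub r.same_vertex r.ne
    have h1 : P ⟨r.edge, t, ht, hte⟩ := hP (.onEdge r.edge) r _ (Or.inr rfl) (Or.inr rfl) hr
    exact key ⟨r.edge, t, ht, hte⟩ r'.edge (ht.trans h) (by rw [← hne]; exact hto) r' rfl h1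
  · exact key r r'.edge ho hne r' rfl hr

lemma Choices.Valid.linked_same_vertex (hC : C.Valid) (hcub : ∀ v, (G.neighborSet v).ncard = 3)
    {r r' : RedLabel G} (h : r.edge.fst = r'.edge.fst) : Linked C (.red r) (.red r') :=
  same_vertex_induction hcub (P := fun x => Linked C (.red r) (.red x))
    (fun _ _ _ h h' h'' => h''.trans (hC.linked_same_disk h h')) h Relation.ReflTransGen.refl

variable [Finite V]

lemma Choices.Valid.touches_of_mem (hC : C.Valid) (hcub : ∀ v, (G.neighborSet v).ncard = 3)
    {q : GuideDisk G} {r : RedLabel G} {z : Plane}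
    (h1 : z ∈ C.arrangement.seg (.blue q)) (h2 : z ∈ C.arrangement.seg (.red r)) : r.Touches q := by
  by_contra h
  exact Set.disjoint_left.1 (hC.disjoint_red_disk hcub h) h2 (hC.blue_subset q h1)

lemma Choices.Valid.partner_of_mem (hC : C.Valid) (hcub : ∀ v, (G.neighborSet v).ncard = 3)
    {r r' : RedLabel G} {z : Plane} (hne : r ≠ r')
    (h1 : z ∈ C.arrangement.seg (.red r)) (h2 : z ∈ C.arrangement.seg (.red r')) :
    Partner C r r' := by
  by_contra h
  exact Set.disjoint_left.1 (hC.disjoint_red_red hcub hne h) h1 h2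

lemma Choices.Valid.crosses_blue_red_iff (hC : C.Valid)
    (hcub : ∀ v, (G.neighborSet v).ncard = 3) {q : GuideDisk G} {r : RedLabel G} :
    C.arrangement.Crosses (.blue q) (.red r) ↔ r.Touches q :=
  ⟨fun h => by obtain ⟨z, h1, h2⟩ := h.nonempty; exact hC.touches_of_mem hcub h1 h2,
    hC.blue_crosses q r⟩

lemma Choices.Valid.crosses_red_red_iff (hC : C.Valid)
    (hcub : ∀ v, (G.neighborSet v).ncard = 3) {r r' : RedLabel G} (hne : r ≠ r') :
    C.arrangement.Crosses (.red r) (.red r') ↔ Partner C r r' :=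
  ⟨fun h => by obtain ⟨z, h1, h2⟩ := h.nonempty; exact hC.partner_of_mem hcub hne h1 h2,
    hC.crosses_of_partner hcub⟩

/-- Two blue segments never meet, two red segments meeting one blue share its disk and are disjoint,
and a red segment meets only one other red. -/
lemma Choices.Valid.no_three (hC : C.Valid) (hcub : ∀ v, (G.neighborSet v).ncard = 3)
    {i j k : SegLabel G} (hij : i ≠ j) (hjk : j ≠ k) (hik : i ≠ k) :
    C.arrangement.seg i ∩ C.arrangement.seg j ∩ C.arrangement.seg k = ∅ := by
  rw [Set.eq_empty_iff_forall_notMem]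
  rintro z ⟨⟨hi, hj⟩, hk⟩
  have bb : ∀ q q', SegLabel.blue q ≠ SegLabel.blue q' → z ∈ C.arrangement.seg (.blue q) →
      z ∈ C.arrangement.seg (.blue q') → False := fun q q' h h1 h2 =>
    Set.disjoint_left.1 (hC.disjoint_blue_blue (fun h' => h (by rw [h']))) h1 h2
  have brr : ∀ q r r', SegLabel.red r ≠ SegLabel.red r' → z ∈ C.arrangement.seg (.blue q) →
      z ∈ C.arrangement.seg (.red r) → z ∈ C.arrangement.seg (.red r') → False :=
    fun q r r' h h0 h1 h2 => Set.disjoint_left.1 (hC.red_disjoint q r r' (fun h' => h (by rw [h']))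
      (hC.touches_of_mem hcub h0 h1) (hC.touches_of_mem hcub h0 h2)) h1 h2
  rcases i with r₁ | q₁ <;> rcases j with r₂ | q₂ <;> rcases k with r₃ | q₃
  · obtain ⟨r', h'⟩ := hC.exists_partner hcub r₁
    have h1 := (h' _).1 (hC.partner_of_mem hcub (fun h => hij (by rw [h])) hi hj)
    have h2 := (h' _).1 (hC.partner_of_mem hcub (fun h => hik (by rw [h])) hi hk)
    exact hjk (by rw [h1, h2])
  · exact brr q₃ r₁ r₂ hij hk hi hj
  · exact brr q₂ r₁ r₃ hik hj hi hk
  · exact bb _ _ hjk hj hk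
  · exact brr q₁ r₂ r₃ hjk hi hj hk
  · exact bb _ _ hik hi hk
  · exact bb _ _ hij hi hj
  · exact bb _ _ hij hi hj

lemma Choices.Valid.proper (hC : C.Valid) (hcub : ∀ v, (G.neighborSet v).ncard = 3)
    {i j : SegLabel G} (hij : i ≠ j)
    (h : (C.arrangement.seg i ∩ C.arrangement.seg j).Nonempty) : C.arrangement.Crosses i j := by
  obtain ⟨z, hi, hj⟩ := h
  rcases i with r₁ | q₁ <;> rcases j with r₂ | q₂
  · exact hC.crosses_of_partner hcub (hC.partner_of_mem hcub (fun h => hij (by rw [h])) hi hj)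
  · exact (hC.blue_crosses _ _ (hC.touches_of_mem hcub hj hi)).symm
  · exact hC.blue_crosses _ _ (hC.touches_of_mem hcub hi hj)
  · exact absurd hj (Set.disjoint_left.1 (hC.disjoint_blue_blue (fun h => hij (by rw [h]))) hi)

lemma Choices.Valid.blue_crossings (hC : C.Valid) (hcub : ∀ v, (G.neighborSet v).ncard = 3)
    (q : GuideDisk G) : ∃ j k, j ≠ k ∧ C.arrangement.color j = Color.red ∧
      C.arrangement.color k = Color.red ∧
      {m | m ≠ .blue q ∧ C.arrangement.Crosses (.blue q) m} = {j, k} := by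
  obtain ⟨r, r', hne, hr⟩ := exists_touching_pair hcub q
  refine ⟨.red r, .red r', fun h => hne (by injection h), rfl, rfl, ?_⟩
  ext m
  simp only [Set.mem_ofPred_eq, Set.mem_insert_iff, Set.mem_singleton_iff]
  rcases m with x | q'
  · rw [hC.crosses_blue_red_iff hcub, hr]; simp
  · constructor
    · rintro ⟨h1, h2⟩
      exact absurd h2 (ColoredSegments.not_crosses_of_disjoint
        (hC.disjoint_blue_blue (fun h => h1 (by rw [h]))))
    · rintro (h | h) <;> cases h

/-- The partner avoids both end disks of `r`, while each blue crossing lies inside one of them.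
Convexity of the disks then gives the order along `r`. -/
lemma Choices.Valid.red_crossings (hC : C.Valid) (hcub : ∀ v, (G.neighborSet v).ncard = 3)
    (r : RedLabel G) : ∃ j k l, j ≠ l ∧ C.arrangement.color j = Color.blue ∧
      C.arrangement.color k = Color.red ∧ C.arrangement.color l = Color.blue ∧
      {m | m ≠ .red r ∧ C.arrangement.Crosses (.red r) m} = {j, k, l} ∧
      ∃ x y z, x ∈ C.arrangement.seg (.red r) ∩ C.arrangement.seg j ∧
        y ∈ C.arrangement.seg (.red r) ∩ C.arrangement.seg k ∧
        z ∈ C.arrangement.seg (.red r) ∩ C.arrangement.seg l ∧ Sbtw ℝ x y z := by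
  obtain ⟨r', hr'⟩ := hC.exists_partner hcub r
  have hp := (hr' r').2 rfl
  have hpe : r.edge ≠ r'.edge := by rw [hp.1]; exact r.edge.symm_ne.symm
  have hpr : r ≠ r' := fun h => hpe (by rw [h])
  have hpo : r.opp ≠ r'.opp := by
    intro h
    have h1 := r'.same_vertex
    rw [← h, r.same_vertex, hp.1] at h1
    exact r.edge.fst_ne_snd h1
  refine ⟨.blue (.inWedge r.opp), .red r', .blue (.onEdge r.edge), by simp, rfl, rfl, rfl, ?_, ?_⟩
  · ext m
    simp only [Set.mem_ofPred_eq, Set.mem_insert_iff, Set.mem_singleton_iff]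
    rcases m with x | q
    · by_cases hx : r = x
      · subst hx; simp [hpr]
      · rw [hC.crosses_red_red_iff hcub hx, hr']
        simp [Ne.symm hx]
    · have : C.arrangement.Crosses (.red r) (.blue q) ↔ r.Touches q :=
        ⟨fun h => (hC.crosses_blue_red_iff hcub).1 h.symm,
          fun h => ((hC.crosses_blue_red_iff hcub).2 h).symm⟩
      rw [this]; simp [RedLabel.Touches]
  · obtain ⟨x, hx, hx'⟩ := (hC.blue_crosses (.inWedge r.opp) r (Or.inl rfl)).nonempty
    obtain ⟨y, hy, hy'⟩ := (hC.crosses_of_partner hcub hp).nonempty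
    obtain ⟨z, hz, hz'⟩ := (hC.blue_crosses (.onEdge r.edge) r (Or.inr rfl)).nonempty
    refine ⟨x, y, z, ⟨hx', hx⟩, ⟨hy, hy'⟩, ⟨hz', hz⟩, ?_⟩
    refine sbtw_of_convex (convex_closedBall _ _) (convex_closedBall _ _) (hC.redNear_mem r)
      (hC.redFar_mem r) (hC.blue_subset _ hx) (hC.blue_subset _ hz)
      (Set.disjoint_left.1 (hC.disjoint_red_disk hcub ?_) hy')
      (Set.disjoint_left.1 (hC.disjoint_red_disk hcub ?_) hy') hx' hy hz'
    · rintro (h | h)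
      · injection h with h; exact hpo h
      · cases h
    · rintro (h | h)
      · cases h
      · injection h with h; exact hpe h

/-- Red segments of one vertex are linked through its disks, and a red segment along an edge crosses
its partner at the other end. -/
lemma Choices.Valid.linked_red_red (hC : C.Valid) (hcub : ∀ v, (G.neighborSet v).ncard = 3)
    {u v : V} (p : G.Walk u v) :
    ∀ r r' : RedLabel G, r.edge.fst = u → r'.edge.fst = v → Linked C (.red r) (.red r') := by
  induction p with
  | nil => exact fun r r' h h' => hC.linked_same_vertex hcub (h.trans h'.symm)
  | @cons u w v hadj p ih =>
    intro r r' h h'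
    obtain ⟨o, ho, hoe⟩ := exists_other_dart hcub ⟨(u, w), hadj⟩
    obtain ⟨s, hs⟩ := hC.exists_partner hcub ⟨⟨(u, w), hadj⟩, o, ho, hoe⟩
    have hp := (hs s).2 rfl
    refine (hC.linked_same_vertex hcub (r' := ⟨⟨(u, w), hadj⟩, o, ho, hoe⟩) h).trans
      ((Linked.of_crosses (hC.crosses_of_partner hcub hp)).trans (ih s r' ?_ h'))
    rw [hp.1]; rfl

lemma Choices.Valid.isRedBlueArrangement (hC : C.Valid)
    (hcub : ∀ v, (G.neighborSet v).ncard = 3) (hconn : G.Connected) :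
    C.arrangement.IsRedBlueArrangement where
  finite := finite_segLabel
  nondegenerate := by
    rintro (r | q)
    · exact (hC.blue_crosses _ r (Or.inl rfl)).2.1
    · obtain ⟨r, r', -, hr⟩ := exists_touching_pair hcub q
      exact (hC.blue_crosses _ r ((hr r).2 (Or.inl rfl))).1
  proper := fun i j => hC.proper hcub
  no_three := fun i j k => hC.no_three hcub
  blue_crossings := by
    rintro (r | q) h
    · cases h
    · exact hC.blue_crossings hcub q
  red_crossings := by
    rintro (r | q) h
    · exact hC.red_crossings hcub r
    · cases h
  connected := by
    have hred : ∀ i : SegLabel G, ∃ r, Linked C i (.red r) := by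
      rintro (r | q)
      · exact ⟨r, Relation.ReflTransGen.refl⟩
      · obtain ⟨r, r', -, hr⟩ := exists_touching_pair hcub q
        exact ⟨r, Linked.of_crosses (hC.blue_crosses _ r ((hr r).2 (Or.inl rfl)))⟩
    have hne : Nonempty (SegLabel G) := by
      obtain ⟨v⟩ := hconn.nonempty
      obtain ⟨a, b, c, -, -, -, hs⟩ := Set.ncard_eq_three.1 (hcub v)
      have : a ∈ G.neighborSet v := by rw [hs]; simp
      exact ⟨.blue (.onEdge ⟨(v, a), this⟩)⟩
    refine IsConnected.iUnion_of_reflTransGen (fun i => ?_) fun i j => ?_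
    · exact ⟨⟨_, left_mem_segment ℝ _ _⟩, (convex_segment _ _).isPreconnected⟩
    · obtain ⟨r, hr⟩ := hred i
      obtain ⟨r', hr'⟩ := hred j
      obtain ⟨p⟩ := hconn.preconnected r.edge.fst r'.edge.fst
      exact hr.trans ((hC.linked_red_red hcub p r r' rfl rfl).trans hr'.symm)

end Crossings

/-! ### Counting red labels and guide disks -/

section Counting

variable {V : Type*} {G : SimpleGraph V}

/-- The vertex to which a guide disk belongs. -/
def GuideDisk.vertex : GuideDisk G → V
  | .onEdge d => d.fst
  | .inWedge d => d.fst

lemma RedLabel.Touches.vertex_eq {r : RedLabel G} {q : GuideDisk G} (h : r.Touches q) :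
    q.vertex = r.edge.fst := by
  rcases h with rfl | rfl
  · exact r.same_vertex
  · rfl

/-- The labels chosen by a set of vertices: red at its vertices, blue elsewhere. -/
def Chosen (Z : Set V) : SegLabel G → Prop
  | .red r => r.edge.fst ∈ Z
  | .blue q => q.vertex ∉ Z

open Classical in
/-- The selection of segments determined by a set of vertices. -/
noncomputable def selection [Fintype (SegLabel G)] (Z : Set V) : Finset (SegLabel G) :=
  Finset.univ.filter (Chosen Z)

lemma mem_selection [Fintype (SegLabel G)] {Z : Set V} {i : SegLabel G} :
    i ∈ selection Z ↔ Chosen Z i := by simp [selection]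

open Classical in
lemma card_segLabel_filter [Fintype (RedLabel G)] [Fintype (GuideDisk G)]
    (S : Finset (SegLabel G)) :
    S.card = (Finset.univ.filter fun r => SegLabel.red r ∈ S).card +
      (Finset.univ.filter fun q => SegLabel.blue q ∈ S).card := by
  have hr : Function.Injective (SegLabel.red : RedLabel G → SegLabel G) := fun a b h => by
    injection h
  have hb : Function.Injective (SegLabel.blue : GuideDisk G → SegLabel G) := fun a b h => by
    injection h
  rw [← Finset.card_image_of_injective _ hr, ← Finset.card_image_of_injective _ hb,
    ← Finset.card_union_of_disjoint]
  · congr 1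
    ext i
    rcases i with r | q <;> simp
  · rw [Finset.disjoint_left]
    intro i hi hi'
    simp only [Finset.mem_image, Finset.mem_filter] at hi hi'
    obtain ⟨a, -, rfl⟩ := hi
    obtain ⟨b, -, h⟩ := hi'
    cases h

open Classical in
lemma card_touched (r : RedLabel G) {T : Finset (GuideDisk G)} (hT : ∀ q, r.Touches q → q ∈ T) :
    (T.bipartiteAbove RedLabel.Touches r).card = 2 := by
  have : T.bipartiteAbove RedLabel.Touches r = {.inWedge r.opp, .onEdge r.edge} := by
    ext q
    simp only [Finset.mem_bipartiteAbove, Finset.mem_insert, Finset.mem_singleton]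
    exact ⟨fun h => h.2, fun h => ⟨hT q h, h⟩⟩
  rw [this, Finset.card_pair]
  simp

open Classical in
lemma card_touching_le (hcub : ∀ v, (G.neighborSet v).ncard = 3) (q : GuideDisk G)
    (R : Finset (RedLabel G)) : (R.bipartiteBelow RedLabel.Touches q).card ≤ 2 := by
  obtain ⟨r, r', -, h⟩ := exists_touching_pair hcub q
  refine (Finset.card_le_card (t := {r, r'}) ?_).trans Finset.card_le_two
  intro x hx
  rw [Finset.mem_bipartiteBelow, h] at hx
  simpa using hx.2

open Classical in
lemma card_touching_eq (hcub : ∀ v, (G.neighborSet v).ncard = 3) (q : GuideDisk G)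
    {R : Finset (RedLabel G)} :
    (R.bipartiteBelow RedLabel.Touches q).card = 2 ↔ ∀ r, r.Touches q → r ∈ R := by
  obtain ⟨r, r', hne, h⟩ := exists_touching_pair hcub q
  have hsub : R.bipartiteBelow RedLabel.Touches q ⊆ {r, r'} := by
    intro x hx
    rw [Finset.mem_bipartiteBelow, h] at hx
    simpa using hx.2
  constructor
  · intro hc x hx
    have := Finset.eq_of_subset_of_card_le hsub (by rw [Finset.card_pair hne, hc])
    have hx' : x ∈ R.bipartiteBelow RedLabel.Touches q := by
      rw [this]; simpa using (h x).1 hx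
    exact (Finset.mem_bipartiteBelow _).1 hx' |>.1
  · intro hall
    rw [Finset.Subset.antisymm hsub, Finset.card_pair hne]
    intro x hx
    have hx' := (h x).2 (by simpa using hx)
    exact (Finset.mem_bipartiteBelow _).2 ⟨hall x hx', hx'⟩

-- Touching is two-to-two between the red labels and the disks of the vertices in `Z`. Exchanging
-- blue for red at whole vertices therefore keeps the size.
open Classical in
lemma card_red_eq_card_disks [Fintype (RedLabel G)] [Fintype (GuideDisk G)]
    (hcub : ∀ v, (G.neighborSet v).ncard = 3) (Z : Set V) :
    (Finset.univ.filter fun r : RedLabel G => r.edge.fst ∈ Z).card =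
      (Finset.univ.filter fun q : GuideDisk G => q.vertex ∈ Z).card := by
  have := Finset.card_mul_eq_card_mul RedLabel.Touches (m := 2) (n := 2)
    (s := Finset.univ.filter fun r : RedLabel G => r.edge.fst ∈ Z)
    (t := Finset.univ.filter fun q : GuideDisk G => q.vertex ∈ Z)
    (fun r hr => card_touched r fun q hq => by
      simp only [Finset.mem_filter, Finset.mem_univ, true_and] at hr ⊢
      rw [hq.vertex_eq]; exact hr)
    (fun q hq => (card_touching_eq hcub q).2 fun r hr => by
      simp only [Finset.mem_filter, Finset.mem_univ, true_and] at hq ⊢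
      rw [← hr.vertex_eq]; exact hq)
  omega

lemma exists_dart (hcub : ∀ v, (G.neighborSet v).ncard = 3) (v : V) : ∃ d : G.Dart, d.fst = v := by
  obtain ⟨a, b, c, -, -, -, hs⟩ := Set.ncard_eq_three.1 (hcub v)
  have : a ∈ G.neighborSet v := by rw [hs]; simp
  exact ⟨⟨(v, a), this⟩, rfl⟩

open Classical in
lemma card_disks_at [Fintype (GuideDisk G)] (hcub : ∀ v, (G.neighborSet v).ncard = 3) (v : V) :
    (Finset.univ.filter fun q : GuideDisk G => q.vertex = v).card = 6 := by
  obtain ⟨e, rfl⟩ := exists_dart hcub v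
  obtain ⟨o, ho, hoe⟩ := exists_other_dart hcub e
  obtain ⟨t, ht, hte, hto, hall⟩ := exists_third_dart hcub ho hoe
  have : (Finset.univ.filter fun q : GuideDisk G => q.vertex = e.fst) =
      {.onEdge e, .onEdge o, .onEdge t, .inWedge e, .inWedge o, .inWedge t} := by
    ext q
    simp only [Finset.mem_filter, Finset.mem_univ, true_and, Finset.mem_insert,
      Finset.mem_singleton]
    constructor
    · intro hq
      rcases q with d | d
      · rcases hall d hq with rfl | rfl | rfl <;> simp
      · rcases hall d hq with rfl | rfl | rfl <;> simp
    · rintro (rfl | rfl | rfl | rfl | rfl | rfl) <;> first | rfl | exact ho | exact ht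
  rw [this]
  simp [Finset.card_insert_of_notMem, hoe.symm, hte.symm, hto.symm]

open Classical in
lemma card_disks_of [Fintype (GuideDisk G)] (hcub : ∀ v, (G.neighborSet v).ncard = 3)
    (Z : Finset V) : (Finset.univ.filter fun q : GuideDisk G => q.vertex ∈ Z).card = 6 * Z.card := by
  rw [Finset.card_eq_sum_card_fiberwise (f := GuideDisk.vertex) (t := Z) (by
    intro q hq; simpa using hq)]
  rw [Finset.sum_const_nat (m := 6), mul_comm]
  intro v hv
  rw [← card_disks_at hcub v, Finset.filter_filter]
  congr 1
  ext q
  simp only [Finset.mem_filter, Finset.mem_univ, true_and]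
  exact ⟨fun h => h.2, fun h => ⟨by rw [h]; exact hv, h⟩⟩

end Counting

/-! ### Maximum non-crossing sets and independent sets -/

section MaxNonCrossing

variable {V : Type*} {G : SimpleGraph V} {D : StraightLineDrawing G} {C : Choices D}

open Classical in
/-- A set of segments no red of which crosses a blue has at most as many elements as there are
guide disks; equality forces the red part to be closed under sharing a disk. -/
lemma Choices.Valid.card_le [Fintype (RedLabel G)] [Fintype (GuideDisk G)] (hC : C.Valid)
    (hcub : ∀ v, (G.neighborSet v).ncard = 3) {S : Finset (SegLabel G)}
    (hS : C.arrangement.NonCrossing S) :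
    S.card ≤ Fintype.card (GuideDisk G) ∧ (Fintype.card (GuideDisk G) ≤ S.card →
      (∀ (q : GuideDisk G) (r r' : RedLabel G), r.Touches q → r'.Touches q →
        SegLabel.red r ∈ S → SegLabel.red r' ∈ S) ∧
      ∀ q : GuideDisk G, SegLabel.blue q ∈ S ↔ ∀ r : RedLabel G, r.Touches q → SegLabel.red r ∉ S) := by
  set R := Finset.univ.filter fun r : RedLabel G => SegLabel.red r ∈ S with hR
  set B := Finset.univ.filter fun q : GuideDisk G => SegLabel.blue q ∈ S with hB
  -- The touched disks. Counting incidences gives `2 * |R| ≤ 2 * |T|`, and the blue part avoids `T`.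
  set T := Finset.univ.filter fun q : GuideDisk G => ∃ r : RedLabel G, r.Touches q ∧
    SegLabel.red r ∈ S with hT
  have hcard : S.card = R.card + B.card := card_segLabel_filter S
  have hsum := Finset.sum_card_bipartiteAbove_eq_sum_card_bipartiteBelow RedLabel.Touches
    (s := R) (t := T)
  have hleft : ∑ r ∈ R, (T.bipartiteAbove RedLabel.Touches r).card = R.card * 2 :=
    Finset.sum_const_nat fun r hr => card_touched r fun q hq => by
      simp only [hR, hT, Finset.mem_filter, Finset.mem_univ, true_and] at hr ⊢
      exact ⟨r, hq, hr⟩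
  have hle : ∀ q ∈ T, (R.bipartiteBelow RedLabel.Touches q).card ≤ 2 :=
    fun q _ => card_touching_le hcub q R
  have hright : ∑ q ∈ T, (R.bipartiteBelow RedLabel.Touches q).card ≤ T.card * 2 := by
    have := Finset.sum_le_card_nsmul T _ 2 hle
    rwa [smul_eq_mul] at this
  have hBT : B ⊆ Tᶜ := by
    intro q hq
    simp only [hB, hT, Finset.mem_filter, Finset.mem_univ, true_and, Finset.mem_compl, not_exists,
      not_and] at hq ⊢
    intro r hr hrS
    exact hS _ hq _ hrS (by simp) (hC.blue_crosses q r hr)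
  have hB' := Finset.card_le_card hBT
  have hTc : Tᶜ.card + T.card = Fintype.card (GuideDisk G) := by
    rw [add_comm]; exact Finset.card_add_card_compl T
  refine ⟨by omega, fun hge => ?_⟩
  -- In the extremal case both inequalities are sharp: every untouched disk contributes its blue
  -- segment, and every touched disk has both of its red segments in `S`.
  have hBeq : B = Tᶜ := Finset.eq_of_subset_of_card_le hBT (by omega)
  have hall : ∀ q ∈ T, (R.bipartiteBelow RedLabel.Touches q).card = 2 := by
    have h1 : ∑ q ∈ T, (R.bipartiteBelow RedLabel.Touches q).card = ∑ q ∈ T, 2 := by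
      rw [Finset.sum_const, smul_eq_mul]; omega
    exact (Finset.sum_eq_sum_iff_of_le hle).1 h1
  constructor
  · intro q r r' hr hr' hrS
    have hq : q ∈ T := by
      simp only [hT, Finset.mem_filter, Finset.mem_univ, true_and]; exact ⟨r, hr, hrS⟩
    have := (card_touching_eq hcub q).1 (hall q hq) r' hr'
    simpa [hR] using this
  · intro q
    have : q ∈ B ↔ q ∈ Tᶜ := by rw [hBeq]
    simpa [hB, hT] using this

open Classical in
lemma card_selection [Fintype (SegLabel G)] [Fintype (RedLabel G)] [Fintype (GuideDisk G)]
    (hcub : ∀ v, (G.neighborSet v).ncard = 3) (Z : Set V) :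
    (selection Z : Finset (SegLabel G)).card = Fintype.card (GuideDisk G) := by
  rw [card_segLabel_filter]
  simp only [mem_selection, Chosen]
  rw [card_red_eq_card_disks hcub Z, Finset.card_filter_add_card_filter_not]
  rfl

open Classical in
lemma redCount_selection [Fintype (SegLabel G)] [Fintype (RedLabel G)] [Fintype (GuideDisk G)]
    (hcub : ∀ v, (G.neighborSet v).ncard = 3) (Z : Finset V) :
    C.arrangement.redCount (selection (Z : Set V)) = 6 * Z.card := by
  rw [← card_disks_of hcub Z]
  have h := card_red_eq_card_disks hcub (Z : Set V)
  simp only [Finset.mem_coe] at h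
  rw [← h, ColoredSegments.redCount]
  have hr : Function.Injective (SegLabel.red : RedLabel G → SegLabel G) := fun a b h => by
    injection h
  rw [← Finset.card_image_of_injective _ hr]
  congr 1
  ext i
  rw [Finset.mem_filter, mem_selection, Finset.mem_image]
  rcases i with r | q
  · simp only [Chosen, Finset.mem_coe, Finset.mem_filter, Finset.mem_univ, true_and,
      SegLabel.red.injEq, exists_eq_right]
    exact ⟨fun h => h.1, fun h => ⟨h, rfl⟩⟩
  · refine ⟨fun h => ?_, ?_⟩
    · cases h.2
    · rintro ⟨r, -, h⟩; cases h

lemma exists_red_at (hcub : ∀ v, (G.neighborSet v).ncard = 3) (v : V) :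
    ∃ r : RedLabel G, r.edge.fst = v := by
  obtain ⟨e, he⟩ := exists_dart hcub v
  obtain ⟨o, ho, hoe⟩ := exists_other_dart hcub e
  exact ⟨⟨e, o, ho, hoe⟩, he⟩

variable [Finite V]

lemma Choices.Valid.nonCrossing_selection [Fintype (SegLabel G)] (hC : C.Valid)
    (hcub : ∀ v, (G.neighborSet v).ncard = 3) {Z : Set V} (hZ : G.IsIndepSet Z) :
    C.arrangement.NonCrossing (selection Z) := by
  have br : ∀ q r, Chosen Z (.blue q) → Chosen Z (.red r) →
      ¬ C.arrangement.Crosses (.blue q) (.red r) := by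
    intro q r hq hr h
    have := ((hC.crosses_blue_red_iff hcub).1 h).vertex_eq
    exact hq (by rw [this]; exact hr)
  intro i hi j hj hij hc
  rw [mem_selection] at hi hj
  rcases i with r | q <;> rcases j with r' | q'
  · have hp := (hC.crosses_red_red_iff hcub (fun h => hij (by rw [h]))).1 hc
    have h2 : r.edge.snd ∈ Z := by
      have : r'.edge.fst ∈ Z := hj
      rw [hp.1] at this; exact this
    exact hZ hi h2 r.edge.fst_ne_snd r.edge.adj
  · exact br q' r hj hi hc.symm
  · exact br q r' hi hj hc
  · exact ColoredSegments.not_crosses_of_disjoint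
      (hC.disjoint_blue_blue (fun h => hij (by rw [h]))) hc

/-- The bijection is `Z ↦ selection Z`. A red label at each vertex makes it injective; surjectivity
is the equality case of `card_le`. -/
theorem Choices.Valid.exists_equiv (hC : C.Valid) (hcub : ∀ v, (G.neighborSet v).ncard = 3) :
    ∃ f : {Z : Finset V // G.IsIndepSet (Z : Set V)} ≃
        {S : Finset (SegLabel G) // C.arrangement.IsMaxNonCrossing S},
      ∀ (Z : {Z : Finset V // G.IsIndepSet (Z : Set V)}) (k : ℕ),
        Z.1.card = k ↔ C.arrangement.redCount (f Z).1 = 6 * k := by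
  classical
  have : Fintype V := Fintype.ofFinite V
  have : Finite (SegLabel G) := finite_segLabel
  have : Fintype (SegLabel G) := Fintype.ofFinite _
  have : Fintype (RedLabel G) := Fintype.ofInjective (SegLabel.red : RedLabel G → SegLabel G)
    fun a b h => by injection h
  have : Fintype (GuideDisk G) := Fintype.ofInjective (SegLabel.blue : GuideDisk G → SegLabel G)
    fun a b h => by injection h
  have hmax : ∀ Z : Finset V, G.IsIndepSet (Z : Set V) →
      C.arrangement.IsMaxNonCrossing (selection (Z : Set V)) := fun Z hZ =>
    ⟨hC.nonCrossing_selection hcub hZ, fun T hT => by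
      rw [card_selection hcub]; exact (hC.card_le hcub hT).1⟩
  let f : {Z : Finset V // G.IsIndepSet (Z : Set V)} →
      {S : Finset (SegLabel G) // C.arrangement.IsMaxNonCrossing S} :=
    fun Z => ⟨selection (Z.1 : Set V), hmax Z.1 Z.2⟩
  have hinj : Function.Injective f := by
    rintro ⟨Z, hZ⟩ ⟨Z', hZ'⟩ h
    have h' : (selection (Z : Set V) : Finset (SegLabel G)) = selection (Z' : Set V) :=
      congrArg Subtype.val h
    apply Subtype.ext
    ext v
    obtain ⟨r, rfl⟩ := exists_red_at hcub v
    have := Finset.ext_iff.1 h' (.red r)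
    simpa [mem_selection, Chosen] using this
  have hsurj : Function.Surjective f := by
    rintro ⟨S, hS⟩
    have hcard : Fintype.card (GuideDisk G) ≤ S.card := by
      -- Compare with the set of all blue segments, the selection of the empty set.
      rw [← card_selection hcub (∅ : Set V)]
      exact hS.2 _ (hC.nonCrossing_selection hcub (by simp [SimpleGraph.IsIndepSet]))
    obtain ⟨hclosed, hblue⟩ := (hC.card_le hcub hS.1).2 hcard
    have hall : ∀ r r' : RedLabel G, r.edge.fst = r'.edge.fst → SegLabel.red r ∈ S →
        SegLabel.red r' ∈ S := fun r r' h => same_vertex_induction hcub hclosed h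
    set Z : Finset V := Finset.univ.filter fun v => ∃ r : RedLabel G, r.edge.fst = v ∧
      SegLabel.red r ∈ S with hZ
    have memZ : ∀ r : RedLabel G, r.edge.fst ∈ Z ↔ SegLabel.red r ∈ S := by
      intro r
      simp only [hZ, Finset.mem_filter, Finset.mem_univ, true_and]
      exact ⟨fun ⟨r', h, h'⟩ => hall r' r h h', fun h => ⟨r, rfl, h⟩⟩
    -- An edge inside `Z` would put a red label along it and its partner, which cross, both into
    -- `S`.
    have hind : G.IsIndepSet (Z : Set V) := by
      intro u hu v hv _ hadj
      obtain ⟨o, ho, hoe⟩ := exists_other_dart hcub ⟨(u, v), hadj⟩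
      obtain ⟨r', hr'⟩ := hC.exists_partner hcub ⟨⟨(u, v), hadj⟩, o, ho, hoe⟩
      have hp := (hr' r').2 rfl
      have h1 := (memZ ⟨⟨(u, v), hadj⟩, o, ho, hoe⟩).1 hu
      have h2 := (memZ r').1 (by rw [hp.1]; exact hv)
      have hc := hC.crosses_of_partner hcub hp
      refine hS.1 _ h1 _ h2 (fun h => ?_) hc
      injection h with h
      have h3 := hp.1
      rw [← h] at h3
      exact SimpleGraph.Dart.symm_ne _ h3.symm
    refine ⟨⟨Z, hind⟩, Subtype.ext ?_⟩
    change selection (Z : Set V) = S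
    ext i
    rw [mem_selection]
    rcases i with r | q
    · exact memZ r
    · rw [hblue]
      constructor
      · intro hq r hr hrS
        apply hq
        rw [hr.vertex_eq]
        exact (memZ r).2 hrS
      · intro h hq
        obtain ⟨r, r', -, hr⟩ := exists_touching_pair hcub q
        have ht := (hr r).2 (Or.inl rfl)
        refine h r ht ((memZ r).1 ?_)
        rw [← ht.vertex_eq]; exact hq
  refine ⟨Equiv.ofBijective f ⟨hinj, hsurj⟩, fun Z k => ?_⟩
  have : C.arrangement.redCount (Equiv.ofBijective f ⟨hinj, hsurj⟩ Z).1 = 6 * Z.1.card :=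
    redCount_selection hcub Z.1
  rw [this]
  omega

end MaxNonCrossing

/-! ### Existence of valid choices: bisectors, small radii, blue segments -/

section Existence

open Filter Topology

variable {V : Type*} {G : SimpleGraph V} {D : StraightLineDrawing G}

/-! ### Bisectors of wedges -/

lemma angle_eq_arccos {δ : ℝ} (hδ : 0 < δ) {n : Plane} (hn : ‖n‖ = 1) (e : G.Dart) :
    EuclideanGeometry.angle (D.pos e.fst + (δ / 5) • n) (D.pos e.fst) (D.pos e.snd) =
      Real.arccos (dt n (dir D e)) := by
  rw [EuclideanGeometry.angle, vsub_eq_sub, vsub_eq_sub, add_sub_cancel_left, ← len_smul_dir,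
    InnerProductGeometry.angle_smul_left_of_pos _ _ (by positivity),
    InnerProductGeometry.angle_smul_right_of_pos _ _ (len_pos D e), InnerProductGeometry.angle,
    hn, norm_dir, inner_eq_dt]
  norm_num

lemma abs_dt_le_one {p q : Plane} (hp : ‖p‖ = 1) (hq : ‖q‖ = 1) : |dt p q| ≤ 1 := by
  have := abs_dt_le p q; rwa [hp, hq, mul_one] at this

/-- Vectors normal to `p - q` make equal angles with the unit vectors `p` and `q`, and one of the
two unit normals favours them over `r`. A tie would make `r` the mirror image of `p`, which is `q`.
-/
lemma exists_bisector {p q r : Plane} (hp : ‖p‖ = 1) (hq : ‖q‖ = 1) (hr : ‖r‖ = 1) (hpq : p ≠ q)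
    (hpr : p ≠ r) (hqr : q ≠ r) : ∃ n : Plane, ‖n‖ = 1 ∧ dt n p = dt n q ∧ dt n r < dt n p := by
  have hm : ‖rot (p - q)‖ ≠ 0 := by rw [norm_rot]; exact norm_ne_zero_iff.2 (sub_ne_zero.2 hpq)
  set n := (‖rot (p - q)‖)⁻¹ • rot (p - q) with hn
  have hn1 : ‖n‖ = 1 := by rw [hn, norm_smul, norm_inv, norm_norm, inv_mul_cancel₀ hm]
  have h1 : dt n p = dt n q := by
    rw [← sub_eq_zero, ← map_sub, hn, dt_smul_left, dt_comm, dt_rot_right, cr_self]; ring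
  have h2 : dt n r ≠ dt n p := by
    intro h
    have a := cr_neg_of_dt_eq hn1 hp hq hpq h1
    have b := cr_neg_of_dt_eq hn1 hp hr hpr h.symm
    apply hqr
    rw [eq_frame hn1 q, eq_frame hn1 r, a, b, ← h1, h]
  rcases lt_or_gt_of_ne h2 with h | h
  · exact ⟨n, hn1, h1, h⟩
  · refine ⟨-n, by rw [norm_neg, hn1], ?_, ?_⟩ <;> rw [dt_comm (-n), dt_comm (-n), map_neg, map_neg,
      dt_comm _ n, dt_comm _ n]
    · rw [h1]
    · linarith

lemma exists_isWedgeCenter [Finite V] (hcub : ∀ v, (G.neighborSet v).ncard = 3) (d : G.Dart) :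
    ∃ x, IsWedgeCenter D d x := by
  obtain ⟨o, ho, hod⟩ := exists_other_dart hcub d
  obtain ⟨t, ht, htd, hto, hall⟩ := exists_third_dart hcub ho hod
  obtain ⟨n, hn, h1, h2⟩ := exists_bisector (norm_dir D o) (norm_dir D t) (norm_dir D d)
    (dir_ne D (ht.trans ho.symm) hto) (dir_ne D ho.symm hod.symm) (dir_ne D ht.symm htd.symm)
  have hδ := clearance_pos' D d
  have key : ∀ a, G.Adj d.fst a → a ≠ d.snd →
      EuclideanGeometry.angle (D.pos d.fst + (D.clearance / 5) • n) (D.pos d.fst) (D.pos a) =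
        Real.arccos (dt n (dir D o)) := by
    intro a ha hne
    have h := angle_eq_arccos (D := D) hδ hn ⟨(d.fst, a), ha⟩
    rcases hall ⟨(d.fst, a), ha⟩ rfl with h' | h' | h'
    · exact absurd (congrArg (fun x : G.Dart => x.snd) h') hne
    · rw [h'] at h; rw [← h, ho, show o.snd = a from
        (congrArg (fun x : G.Dart => x.snd) h').symm]
    · rw [h', ← h1] at h; rw [← h, ht, show t.snd = a from
        (congrArg (fun x : G.Dart => x.snd) h').symm]
  refine ⟨D.pos d.fst + (D.clearance / 5) • n, ?_, ?_, ?_⟩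
  · rw [dist_eq_norm, add_sub_cancel_left, norm_smul, hn, mul_one, Real.norm_of_nonneg (by positivity)]
  · intro a b ha hb ha' hb'
    rw [key a ha ha', key b hb hb']
  · intro a ha ha'
    rw [key a ha ha', angle_eq_arccos hδ hn]
    exact Real.arccos_lt_arccos (abs_le.1 (abs_dt_le_one hn (norm_dir D d))).1 h2
      (abs_le.1 (abs_dt_le_one hn (norm_dir D o))).2

/-! ### Small radii -/

lemma eventually_lt_of_pos {c : ℝ} (hc : 0 < c) : ∀ᶠ ρ in 𝓝[>] (0 : ℝ), ρ < c :=
  nhdsWithin_le_nhds (Iio_mem_nhds hc)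

lemma eventually_disjoint_closedBall {c : Plane} {K : Set Plane} (hK : IsClosed K) (hc : c ∉ K) :
    ∀ᶠ ρ in 𝓝[>] (0 : ℝ), Disjoint (Metric.closedBall c ρ) K := by
  obtain ⟨ε, hε, h⟩ := Metric.nhds_basis_closedBall.mem_iff.1 (hK.isOpen_compl.mem_nhds hc)
  filter_upwards [eventually_lt_of_pos hε] with ρ hρ
  exact (Set.disjoint_compl_left_iff_subset.2
    ((Metric.closedBall_subset_closedBall hρ.le).trans (by simpa using h))).symm.mono_right
      (by simp)

lemma eventually_disjoint_closedBalls {c c' : Plane} (h : c ≠ c') :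
    ∀ᶠ ρ in 𝓝[>] (0 : ℝ), Disjoint (Metric.closedBall c ρ) (Metric.closedBall c' ρ) := by
  filter_upwards [eventually_lt_of_pos (half_pos (dist_pos.2 h))] with ρ hρ
  exact Metric.closedBall_disjoint_closedBall (by linarith)

lemma cr_eq_zero_of_mem_segment {x y a b c : Plane} (ha : a ∈ segment ℝ x y)
    (hb : b ∈ segment ℝ x y) (hc : c ∈ segment ℝ x y) : cr (b - a) (c - a) = 0 := by
  rw [segment_eq_image'] at ha hb hc
  obtain ⟨s, -, rfl⟩ := ha
  obtain ⟨t, -, rfl⟩ := hb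
  obtain ⟨r, -, rfl⟩ := hc
  simp only [cr_apply, PiLp.sub_apply, PiLp.add_apply, PiLp.smul_apply, smul_eq_mul]
  ring

/-- Non-collinearity is an open condition on triples of points. -/
lemma eventually_no_transversal {a b c : Plane} (h : cr (b - a) (c - a) ≠ 0) :
    ∀ᶠ ρ in 𝓝[>] (0 : ℝ), ¬ ∃ x y : Plane, (segment ℝ x y ∩ Metric.closedBall a ρ).Nonempty ∧
      (segment ℝ x y ∩ Metric.closedBall b ρ).Nonempty ∧
      (segment ℝ x y ∩ Metric.closedBall c ρ).Nonempty := by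
  have hcont : Continuous fun p : Plane × Plane × Plane => cr (p.2.1 - p.1) (p.2.2 - p.1) := by
    simp only [cr_apply, PiLp.sub_apply]
    fun_prop
  have hev : ∀ᶠ p in 𝓝 (a, b, c), cr (p.2.1 - p.1) (p.2.2 - p.1) ≠ 0 :=
    hcont.continuousAt.eventually_ne h
  obtain ⟨ε, hε, hball⟩ := Metric.eventually_nhds_iff.1 hev
  filter_upwards [eventually_lt_of_pos hε] with ρ hρ
  rintro ⟨x, y, ⟨a', ha, ha'⟩, ⟨b', hb, hb'⟩, ⟨c', hc, hc'⟩⟩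
  refine hball (y := (a', b', c')) ?_ (cr_eq_zero_of_mem_segment ha hb hc)
  rw [Metric.mem_closedBall] at ha' hb' hc'
  simp only [Prod.dist_eq, max_lt_iff]
  exact ⟨by linarith, by linarith, by linarith⟩

/-- For quantities whose value at `ρ = 0` may vanish: a nonzero slope still keeps them nonzero for
small positive `ρ`. -/
lemma eventually_affine_ne {α β : ℝ} (hβ : β ≠ 0) : ∀ᶠ ρ in 𝓝[>] (0 : ℝ), α + ρ * β ≠ 0 := by
  by_cases hα : α = 0
  · filter_upwards [self_mem_nhdsWithin] with ρ hρ
    rw [hα, zero_add]; exact mul_ne_zero (ne_of_gt hρ) hβ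
  · have : ContinuousAt (fun ρ : ℝ => α + ρ * β) 0 := by fun_prop
    exact nhdsWithin_le_nhds (this.eventually_ne (by simpa using hα))

/-! ### Blue segments -/

/-- Two segments starting in a disk can be crossed near their starting points by a segment in the
disk. -/
lemma exists_blue {c P₁ Q₁ P₂ Q₂ : Plane} {ρ : ℝ} (h1 : P₁ ∈ Metric.ball c ρ)
    (h2 : P₂ ∈ Metric.ball c ρ) (hc1 : cr (P₁ - P₂) (Q₁ - P₁) ≠ 0)
    (hc2 : cr (P₁ - P₂) (Q₂ - P₂) ≠ 0) :
    ∃ B B' : Plane, B ∈ Metric.closedBall c ρ ∧ B' ∈ Metric.closedBall c ρ ∧ B ≠ B' ∧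
      (∃ x, x ∈ openSegment ℝ B B' ∧ x ∈ openSegment ℝ P₁ Q₁ ∧
        segment ℝ B B' ∩ segment ℝ P₁ Q₁ = {x}) ∧
      (∃ x, x ∈ openSegment ℝ B B' ∧ x ∈ openSegment ℝ P₂ Q₂ ∧
        segment ℝ B B' ∩ segment ℝ P₂ Q₂ = {x}) := by
  -- Advance by a small `t` along both segments and let the blue segment pass through the two points
  -- reached, overshooting each by `t` times their difference. For small `t` its ends stay in the
  -- open ball, and transversality persists.
  set A₁ : ℝ → Plane := fun t => P₁ + t • (Q₁ - P₁) with hA₁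
  set A₂ : ℝ → Plane := fun t => P₂ + t • (Q₂ - P₂) with hA₂
  have cA₁ : Continuous A₁ := by fun_prop
  have cA₂ : Continuous A₂ := by fun_prop
  have z1 : A₁ 0 = P₁ := by simp [hA₁]
  have z2 : A₂ 0 = P₂ := by simp [hA₂]
  have ev1 : ∀ᶠ t in 𝓝[>] (0 : ℝ), A₁ t + t • (A₁ t - A₂ t) ∈ Metric.ball c ρ := by
    have : Continuous fun t : ℝ => A₁ t + t • (A₁ t - A₂ t) := by fun_prop
    exact nhdsWithin_le_nhds (this.continuousAt.eventually_mem
      (Metric.isOpen_ball.mem_nhds (by simpa [z1] using h1)))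
  have ev2 : ∀ᶠ t in 𝓝[>] (0 : ℝ), A₂ t + t • (A₂ t - A₁ t) ∈ Metric.ball c ρ := by
    have : Continuous fun t : ℝ => A₂ t + t • (A₂ t - A₁ t) := by fun_prop
    exact nhdsWithin_le_nhds (this.continuousAt.eventually_mem
      (Metric.isOpen_ball.mem_nhds (by simpa [z2] using h2)))
  have evc : ∀ w : Plane, cr (P₁ - P₂) w ≠ 0 → ∀ᶠ t in 𝓝[>] (0 : ℝ), cr (A₁ t - A₂ t) w ≠ 0 := by
    intro w hw
    have : Continuous fun t : ℝ => cr (A₁ t - A₂ t) w := by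
      simp only [cr_apply, PiLp.sub_apply]; fun_prop
    exact nhdsWithin_le_nhds (this.continuousAt.eventually_ne (by simpa [z1, z2] using hw))
  obtain ⟨t, b1, b2, n1, n2, t1, t0⟩ := (ev1.and (ev2.and ((evc _ hc1).and ((evc _ hc2).and
    ((eventually_lt_of_pos one_pos).and self_mem_nhdsWithin))))).exists
  have t0' : 0 < t := t0
  have hne : (1 + 2 * t) ≠ 0 := by positivity
  set X := A₁ t
  set Y := A₂ t
  have hBB : Y + t • (Y - X) - (X + t • (X - Y)) = (-(1 + 2 * t)) • (X - Y) := by module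
  have w1 : (1 + t) / (1 + 2 * t) + t / (1 + 2 * t) = 1 := by field_simp; ring
  have mX : X ∈ openSegment ℝ (X + t • (X - Y)) (Y + t • (Y - X)) := by
    refine ⟨(1 + t) / (1 + 2 * t), t / (1 + 2 * t), by positivity, by positivity, w1, ?_⟩
    have e : (1 + t) / (1 + 2 * t) * t - t / (1 + 2 * t) * (1 + t) = 0 := by field_simp; ring
    calc _ = ((1 + t) / (1 + 2 * t) + t / (1 + 2 * t)) • X
        + ((1 + t) / (1 + 2 * t) * t - t / (1 + 2 * t) * (1 + t)) • (X - Y) := by module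
      _ = X := by rw [w1, e, one_smul, zero_smul, add_zero]
  have mY : Y ∈ openSegment ℝ (X + t • (X - Y)) (Y + t • (Y - X)) := by
    refine ⟨t / (1 + 2 * t), (1 + t) / (1 + 2 * t), by positivity, by positivity,
      by rw [add_comm]; exact w1, ?_⟩
    have e : (1 + t) / (1 + 2 * t) * t - t / (1 + 2 * t) * (1 + t) = 0 := by field_simp; ring
    calc _ = ((1 + t) / (1 + 2 * t) + t / (1 + 2 * t)) • Y
        - ((1 + t) / (1 + 2 * t) * t - t / (1 + 2 * t) * (1 + t)) • (X - Y) := by module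
      _ = Y := by rw [w1, e, one_smul, zero_smul, sub_zero]
  have oX : X ∈ openSegment ℝ P₁ Q₁ := by
    rw [openSegment_eq_image']; exact ⟨t, ⟨t0, t1⟩, rfl⟩
  have oY : Y ∈ openSegment ℝ P₂ Q₂ := by
    rw [openSegment_eq_image']; exact ⟨t, ⟨t0, t1⟩, rfl⟩
  refine ⟨X + t • (X - Y), Y + t • (Y - X), Metric.ball_subset_closedBall b1,
    Metric.ball_subset_closedBall b2, ?_, ⟨X, mX, oX, ?_⟩, ⟨Y, mY, oY, ?_⟩⟩
  · intro h
    rw [h, sub_self] at hBB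
    have h0 : X - Y = 0 := by
      rcases smul_eq_zero.1 hBB.symm with h' | h'
      · exact absurd (neg_eq_zero.1 h') hne
      · exact h'
    rw [h0] at n1
    simp [cr_apply] at n1
  · refine segment_inter_eq (openSegment_subset_segment _ _ _ mX)
      (openSegment_subset_segment _ _ _ oX) ?_
    rw [hBB, cr_smul_left]; exact mul_ne_zero (neg_ne_zero.2 hne) n1
  · refine segment_inter_eq (openSegment_subset_segment _ _ _ mY)
      (openSegment_subset_segment _ _ _ oY) ?_
    rw [hBB, cr_smul_left]; exact mul_ne_zero (neg_ne_zero.2 hne) n2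

end Existence

/-! ### Choosing the endpoints and assembling a valid choice -/

section Construct

open Filter Topology

variable {V : Type*} {G : SimpleGraph V} {D : StraightLineDrawing G}

/-- Centres of the guide disks, given those near the vertices. -/
noncomputable def diskCenter (D : StraightLineDrawing G) (w : G.Dart → Plane) : GuideDisk G → Plane
  | .onEdge d => D.pos d.fst + (3 / 5 * len D d) • dir D d
  | .inWedge d => w d

lemma diskCenter_onEdge_mem (w : G.Dart → Plane) (d : G.Dart) :
    diskCenter D w (.onEdge d) ∈ segment ℝ (D.pos d.fst) (D.pos d.snd) := by
  have := len_pos D d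
  exact add_smul_dir_mem D _ (by positivity) (by linarith)

lemma diskCenter_onEdge_symm (w : G.Dart → Plane) (e : G.Dart) :
    diskCenter D w (.onEdge e.symm) = D.pos e.fst + (2 / 5 * len D e) • dir D e := by
  rw [diskCenter, len_symm, dir_symm, show D.pos e.symm.fst = D.pos e.snd from rfl, pos_snd]
  module

lemma diskCenter_onEdge_ne_pos (w : G.Dart → Plane) (d : G.Dart) (v : V) :
    diskCenter D w (.onEdge d) ≠ D.pos v := by
  have hL := len_pos D d
  have hdir : dir D d ≠ 0 := norm_ne_zero_iff.1 (by rw [norm_dir]; norm_num)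
  intro h
  by_cases h1 : v = d.fst
  · rw [h1, diskCenter, add_eq_left, smul_eq_zero] at h
    exact h.elim (by positivity) hdir
  by_cases h2 : v = d.snd
  · rw [h2, diskCenter, pos_snd, add_right_inj, ← sub_eq_zero, ← sub_smul, smul_eq_zero] at h
    exact h.elim (fun h => by linarith) hdir
  · exact D.vertex_notMem v d.fst d.snd d.adj h1 h2 (h ▸ diskCenter_onEdge_mem w d)

lemma diskCenter_onEdge_notMem (w : G.Dart → Plane) (d : G.Dart) {a b : V} (hab : G.Adj a b)
    (hne : s(a, b) ≠ d.edge) : diskCenter D w (.onEdge d) ∉ segment ℝ (D.pos a) (D.pos b) := by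
  intro h
  have := (D.edge_inter a b d.fst d.snd hab d.adj hne ⟨h, diskCenter_onEdge_mem w d⟩).1
  rcases this with h | h <;> exact diskCenter_onEdge_ne_pos w d _ h

variable {w : G.Dart → Plane}

/-! ### Endpoints of the red segments -/

/-- A sign making a number positive. -/
noncomputable def sgn (c : ℝ) : ℝ := if c < 0 then -1 else 1

lemma sgn_mul_self (c : ℝ) : sgn c * sgn c = 1 := by unfold sgn; split_ifs <;> norm_num
lemma abs_sgn (c : ℝ) : |sgn c| = 1 := by unfold sgn; split_ifs <;> norm_num
lemma sgn_mul_pos {c : ℝ} (h : c ≠ 0) : 0 < sgn c * c := by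
  unfold sgn; split_ifs with h1
  · linarith
  · have := lt_of_le_of_ne (not_lt.1 h1) h.symm; linarith
lemma sgn_of_mul_neg {c c' : ℝ} (h : c * c' < 0) : sgn c' = - sgn c := by
  unfold sgn; split_ifs with h1 h2 h2
  · exact absurd h (not_lt.2 (mul_nonneg_of_nonpos_of_nonpos h2.le h1.le))
  · rfl
  · norm_num
  · exact absurd h (not_lt.2 (mul_nonneg (not_lt.1 h2) (not_lt.1 h1)))

/-- The side of its edge on which the wedge of a red label lies. -/
noncomputable def farSign (D : StraightLineDrawing G) (w : G.Dart → Plane) (r : RedLabel G) : ℝ :=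
  sgn (cr (dir D r.edge) (unitTo D r.opp (w r.opp)))

/-- The side of the bisector of its wedge on which the edge of a red label lies. -/
noncomputable def nearSign (D : StraightLineDrawing G) (w : G.Dart → Plane) (r : RedLabel G) : ℝ :=
  sgn (cr (unitTo D r.opp (w r.opp)) (dir D r.edge))

/-- The offset is normal to the bisector, towards the edge of `r`. The two red ends in a wedge disk
thus lie on opposite sides of the bisector. -/
noncomputable def nearPt (D : StraightLineDrawing G) (w : G.Dart → Plane) (ρ : ℝ) (r : RedLabel G) :
    Plane := w r.opp + (ρ / 2 * nearSign D w r) • rot (unitTo D r.opp (w r.opp))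

/-- The offset is normal to the edge, towards the wedge of `r`. The two red ends in an edge disk
thus lie on opposite sides of the edge. -/
noncomputable def farPt (D : StraightLineDrawing G) (w : G.Dart → Plane) (ρ : ℝ) (r : RedLabel G) :
    Plane := diskCenter D w (.onEdge r.edge) + (ρ / 2 * farSign D w r) • rot (dir D r.edge)

lemma farPt_mem {ρ : ℝ} (hρ : 0 < ρ) (r : RedLabel G) :
    farPt D w ρ r ∈ Metric.ball (diskCenter D w (.onEdge r.edge)) ρ := by
  rw [Metric.mem_ball, dist_eq_norm, farPt, add_sub_cancel_left, norm_smul, norm_rot, norm_dir,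
    mul_one, norm_mul, Real.norm_eq_abs (farSign D w r), farSign, abs_sgn, mul_one,
    Real.norm_of_nonneg (by positivity)]
  linarith

lemma tendsto_nearPt (f : Plane →ₗ[ℝ] ℝ) (r : RedLabel G) :
    Tendsto (fun ρ => f (nearPt D w ρ r)) (𝓝[>] 0) (𝓝 (f (w r.opp))) := by
  have : ContinuousAt (fun ρ : ℝ => f (nearPt D w ρ r)) 0 := by
    simp only [nearPt, map_add, map_smul, smul_eq_mul]; fun_prop
  have h := this.tendsto.mono_left (nhdsWithin_le_nhds (s := Set.Ioi 0))
  simpa [nearPt] using h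

lemma tendsto_farPt (f : Plane →ₗ[ℝ] ℝ) (r : RedLabel G) :
    Tendsto (fun ρ => f (farPt D w ρ r)) (𝓝[>] 0) (𝓝 (f (diskCenter D w (.onEdge r.edge)))) := by
  have : ContinuousAt (fun ρ : ℝ => f (farPt D w ρ r)) 0 := by
    simp only [farPt, map_add, map_smul, smul_eq_mul]; fun_prop
  have h := this.tendsto.mono_left (nhdsWithin_le_nhds (s := Set.Ioi 0))
  simpa [farPt] using h

lemma RedLabel.exists_third (hcub : ∀ v, (G.neighborSet v).ncard = 3) (r : RedLabel G) :
    ∃ t : G.Dart, t.fst = r.opp.fst ∧ t ≠ r.opp ∧ r.edge ≠ t := by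
  obtain ⟨t, ht, hte, hto, -⟩ := exists_third_dart hcub r.same_vertex r.ne
  exact ⟨t, ht.trans r.same_vertex.symm, hto, hte.symm⟩

variable [Finite V]

/-! ### Disjointness of the guide disks and properties of the red segments -/

lemma pos_add_unitTo (o : G.Dart) (x : Plane) :
    x = D.pos o.fst + (D.clearance / 5) • unitTo D o x := by
  rw [smul_unitTo]; abel

/-- Edges away from the vertex are at distance at least `δ`, beyond `δ / 5`. On an incident edge `e`
the bisector would be `dir D e`: for `e = d` this contradicts the strict inequality `dt_lt`, for the
bounding edges it contradicts `cr_ne_zero`. -/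
lemma IsWedgeCenter.notMem_edge (hcub : ∀ v, (G.neighborSet v).ncard = 3) {d : G.Dart} {x : Plane}
    (hx : IsWedgeCenter D d x) {a b : V} (hab : G.Adj a b) :
    x ∉ segment ℝ (D.pos a) (D.pos b) := by
  have hδ := clearance_pos' D d
  have inc : ∀ e : G.Dart, e.fst = d.fst → x ∉ segment ℝ (D.pos e.fst) (D.pos e.snd) := by
    intro e he hmem
    rw [segment_eq_image'] at hmem
    obtain ⟨s, hs, hsx⟩ := hmem
    simp only at hsx
    rw [← len_smul_dir, smul_smul] at hsx
    have h1 : x - D.pos d.fst = (s * len D e) • dir D e := by rw [← hsx, he]; abel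
    have hk : s * len D e = D.clearance / 5 := by
      have := hx.norm_sub
      rw [h1, norm_smul, norm_dir, mul_one, Real.norm_of_nonneg (mul_nonneg hs.1 (len_pos D e).le)]
        at this
      exact this
    have hn : unitTo D d x = dir D e := by
      rw [unitTo, h1, hk, smul_smul, show 5 / D.clearance * (D.clearance / 5) = 1 by field_simp,
        one_smul]
    obtain ⟨o, ho, hod⟩ := exists_other_dart hcub d
    obtain ⟨t, ht, htd, hto, hall⟩ := exists_third_dart hcub ho hod
    rcases hall e he with rfl | rfl | rfl
    · have h := hx.dt_lt ho hod
      rw [hn, dt_self, norm_dir] at h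
      have := (abs_le.1 (abs_dt_le_one (norm_dir D e) (norm_dir D o))).2
      linarith
    · exact hx.cr_ne_zero ho ht hod htd hto.symm (by rw [hn, cr_self])
    · exact hx.cr_ne_zero ht ho htd hod hto (by rw [hn, cr_self])
  by_cases ha : d.fst = a
  · exact inc ⟨(a, b), hab⟩ ha.symm
  by_cases hb : d.fst = b
  · rw [segment_symm]; exact inc ⟨(b, a), hab.symm⟩ hb.symm
  · intro h
    have h1 := D.clearance_le_dist_edge hab ha hb h
    rw [dist_comm, hx.dist_eq] at h1
    linarith

lemma diskCenter_injective (hw : ∀ d, IsWedgeCenter D d (w d))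
    (hcub : ∀ v, (G.neighborSet v).ncard = 3) :
    Function.Injective (diskCenter D w) := by
  have mixed : ∀ d d', diskCenter D w (.onEdge d) ≠ diskCenter D w (.inWedge d') := by
    intro d d' h
    exact (hw d').notMem_edge hcub d.adj
      (show diskCenter D w (.inWedge d') ∈ _ from h ▸ diskCenter_onEdge_mem w d)
  rintro (d | d) (d' | d') h
  · congr 1
    by_contra hne
    by_cases he : d'.edge = d.edge
    · rcases SimpleGraph.dart_edge_eq_iff d' d |>.1 he with h' | h'
      · exact hne h'.symm
      · rw [h', diskCenter_onEdge_symm, diskCenter, add_right_inj, ← sub_eq_zero, ← sub_smul,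
          smul_eq_zero] at h
        have hL := len_pos D d
        exact h.elim (fun h => by linarith) (norm_ne_zero_iff.1 (by rw [norm_dir]; norm_num))
    · exact diskCenter_onEdge_notMem w d d'.adj he (h ▸ diskCenter_onEdge_mem w d')
  · exact absurd h (mixed d d')
  · exact absurd h.symm (mixed d' d)
  · congr 1
    by_contra hne
    have h' : w d = w d' := h
    have hδ := clearance_pos' D d
    by_cases hf : d.fst = d'.fst
    · have hu : unitTo D d (w d) = unitTo D d' (w d') := by rw [unitTo, unitTo, h', hf]
      have h1 := (hw d).dt_lt hf.symm (Ne.symm hne)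
      have h2 := (hw d').dt_lt hf hne
      rw [← hu] at h2
      linarith
    · have h1 := D.clearance_le_dist hf
      have h2 := (hw d).dist_eq
      have h3 := (hw d').dist_eq
      rw [← h'] at h3
      have := dist_triangle_left (D.pos d.fst) (D.pos d'.fst) (w d)
      linarith

lemma nearPt_mem (hw : ∀ d, IsWedgeCenter D d (w d)) {ρ : ℝ} (hρ : 0 < ρ) (r : RedLabel G) :
    nearPt D w ρ r ∈ Metric.ball (diskCenter D w (.inWedge r.opp)) ρ := by
  rw [Metric.mem_ball, dist_eq_norm, nearPt, diskCenter, add_sub_cancel_left, norm_smul, norm_rot,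
    (hw r.opp).norm_unitTo, mul_one, norm_mul, Real.norm_eq_abs (nearSign D w r), nearSign, abs_sgn,
    mul_one, Real.norm_of_nonneg (by positivity)]
  linarith

lemma cr_unitTo_dir_ne_zero (hw : ∀ d, IsWedgeCenter D d (w d))
    (hcub : ∀ v, (G.neighborSet v).ncard = 3) (r : RedLabel G) :
    cr (unitTo D r.opp (w r.opp)) (dir D r.edge) ≠ 0 := by
  obtain ⟨t, ht, hto, hte⟩ := r.exists_third hcub
  exact (hw r.opp).cr_ne_zero r.same_vertex.symm ht r.ne.symm hto hte

lemma cr_dir_unitTo_ne_zero (hw : ∀ d, IsWedgeCenter D d (w d))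
    (hcub : ∀ v, (G.neighborSet v).ncard = 3) (r : RedLabel G) :
    cr (dir D r.edge) (unitTo D r.opp (w r.opp)) ≠ 0 := by
  rw [cr_comm, neg_ne_zero]; exact cr_unitTo_dir_ne_zero hw hcub r

/-- Red segments stay on their side of the bisector of their wedge. -/
lemma eventually_nearSide (hw : ∀ d, IsWedgeCenter D d (w d))
    (hcub : ∀ v, (G.neighborSet v).ncard = 3) (r : RedLabel G) :
    ∀ᶠ ρ in 𝓝[>] (0 : ℝ), ∀ z ∈ segment ℝ (nearPt D w ρ r) (farPt D w ρ r),
      nearSign D w r * cr (unitTo D r.opp (w r.opp)) (D.pos r.opp.fst) <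
        nearSign D w r * cr (unitTo D r.opp (w r.opp)) z := by
  have hpos := sgn_mul_pos (cr_unitTo_dir_ne_zero hw hcub r)
  have hL := len_pos D r.edge
  have hn := (hw r.opp).norm_unitTo
  have h2 := (tendsto_farPt (D := D) (w := w)
    (nearSign D w r • cr (unitTo D r.opp (w r.opp))) r).eventually_const_lt
    (u := (nearSign D w r • cr (unitTo D r.opp (w r.opp))) (D.pos r.opp.fst)) (by
      rw [diskCenter, map_add, map_smul, r.same_vertex, smul_eq_mul]
      have : 0 < (nearSign D w r • cr (unitTo D r.opp (w r.opp))) (dir D r.edge) := hpos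
      have : 0 < 3 / 5 * len D r.edge *
        (nearSign D w r • cr (unitTo D r.opp (w r.opp))) (dir D r.edge) := by positivity
      linarith)
  filter_upwards [h2, self_mem_nhdsWithin] with ρ h2 hρ z hz
  refine lt_of_mem_segment (f := nearSign D w r • cr (unitTo D r.opp (w r.opp))) ?_ h2 hz
  change _ < nearSign D w r * cr (unitTo D r.opp (w r.opp)) (nearPt D w ρ r)
  -- The wedge centre is on the bisector, so the near end clears it by exactly `ρ / 2`. The far end
  -- clears it for small `ρ` since the edge disk is centred off the bisector.
  have hwo : cr (unitTo D r.opp (w r.opp)) (w r.opp) =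
      cr (unitTo D r.opp (w r.opp)) (D.pos r.opp.fst) := by
    conv_lhs => rw [pos_add_unitTo (D := D) r.opp (w r.opp)]
    rw [map_add, map_smul, ← pos_add_unitTo, cr_self, smul_zero, add_zero]
  rw [nearPt, map_add, map_smul, cr_rot_right, dt_self, hn, hwo, smul_eq_mul]
  have hρ' : 0 < ρ := hρ
  have hs : nearSign D w r * nearSign D w r = 1 := sgn_mul_self _
  nlinarith

/-- Red segments stay on their side of their edge. -/
lemma eventually_farSide (hw : ∀ d, IsWedgeCenter D d (w d))
    (hcub : ∀ v, (G.neighborSet v).ncard = 3) (r : RedLabel G) :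
    ∀ᶠ ρ in 𝓝[>] (0 : ℝ), ∀ z ∈ segment ℝ (nearPt D w ρ r) (farPt D w ρ r),
      farSign D w r * cr (dir D r.edge) (D.pos r.edge.fst) < farSign D w r * cr (dir D r.edge) z := by
  have hpos := sgn_mul_pos (cr_dir_unitTo_ne_zero hw hcub r)
  have hδ := clearance_pos' D r.edge
  have h1 := (tendsto_nearPt (D := D) (w := w)
    (farSign D w r • cr (dir D r.edge)) r).eventually_const_lt
    (u := (farSign D w r • cr (dir D r.edge)) (D.pos r.edge.fst)) (by
      have e := pos_add_unitTo (D := D) r.opp (w r.opp)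
      have e' := congrArg (farSign D w r • cr (dir D r.edge)) e
      rw [map_add, map_smul, r.same_vertex, smul_eq_mul] at e'
      rw [e']
      have : 0 < (farSign D w r • cr (dir D r.edge)) (unitTo D r.opp (w r.opp)) := hpos
      have : 0 < D.clearance / 5 *
        (farSign D w r • cr (dir D r.edge)) (unitTo D r.opp (w r.opp)) := by positivity
      linarith)
  filter_upwards [h1, self_mem_nhdsWithin] with ρ h1 hρ z hz
  refine lt_of_mem_segment (f := farSign D w r • cr (dir D r.edge)) h1 ?_ hz
  change _ < farSign D w r * cr (dir D r.edge) (farPt D w ρ r)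
  rw [farPt, map_add, map_smul, cr_rot_right, dt_self, norm_dir, diskCenter, map_add, map_smul,
    cr_self, smul_zero, add_zero, smul_eq_mul]
  have hρ' : 0 < ρ := hρ
  have hs : farSign D w r * farSign D w r = 1 := sgn_mul_self _
  change farSign D w r * cr (dir D r.edge) (D.pos r.edge.fst) < _
  nlinarith

/-- Transversality of the red segment to the normal of its edge, used to place the blue segment on
the edge. In the limit the two ends have coordinates at most `δ / 5` and equal to `3/5 * len` along
the edge. -/
lemma eventually_dt_dir_ne (hw : ∀ d, IsWedgeCenter D d (w d)) (r : RedLabel G) :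
    ∀ᶠ ρ in 𝓝[>] (0 : ℝ), dt (dir D r.edge) (nearPt D w ρ r - farPt D w ρ r) ≠ 0 := by
  have h := (tendsto_nearPt (D := D) (w := w) (dt (dir D r.edge)) r).sub
    (tendsto_farPt (D := D) (w := w) (dt (dir D r.edge)) r)
  have hne : dt (dir D r.edge) (w r.opp) - dt (dir D r.edge) (diskCenter D w (.onEdge r.edge)) ≠ 0 := by
    have e := congrArg (dt (dir D r.edge)) (pos_add_unitTo (D := D) r.opp (w r.opp))
    rw [map_add, map_smul, r.same_vertex, smul_eq_mul] at e
    rw [e, diskCenter, map_add, map_smul, dt_self, norm_dir, smul_eq_mul]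
    have h1 := (abs_le.1 (abs_dt_le_one (norm_dir D r.edge) (hw r.opp).norm_unitTo)).2
    have h2 := clearance_le_len D r.edge
    have h3 := clearance_pos' D r.edge
    apply ne_of_lt
    nlinarith
  filter_upwards [h.eventually_ne hne] with ρ hρ
  rwa [map_sub]

/-- The counterpart in the wedge disk. The limit may be zero here, but the offset of the far end has
a nonzero component along the bisector, so the slope in `ρ` is nonzero. -/
lemma eventually_dt_unitTo_ne (hw : ∀ d, IsWedgeCenter D d (w d))
    (hcub : ∀ v, (G.neighborSet v).ncard = 3) (r : RedLabel G) :
    ∀ᶠ ρ in 𝓝[>] (0 : ℝ), dt (unitTo D r.opp (w r.opp)) (farPt D w ρ r - nearPt D w ρ r) ≠ 0 := by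
  have h := eventually_affine_ne
    (α := dt (unitTo D r.opp (w r.opp)) (diskCenter D w (.onEdge r.edge) - w r.opp))
    (β := - (1 / 2 * farSign D w r * cr (unitTo D r.opp (w r.opp)) (dir D r.edge))) (by
      refine neg_ne_zero.2 (mul_ne_zero (mul_ne_zero (by norm_num) ?_)
        (cr_unitTo_dir_ne_zero hw hcub r))
      intro h0
      have := abs_sgn (cr (dir D r.edge) (unitTo D r.opp (w r.opp)))
      rw [show sgn (cr (dir D r.edge) (unitTo D r.opp (w r.opp))) = 0 from h0] at this
      norm_num at this)
  filter_upwards [h] with ρ hρ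
  convert hρ using 1
  simp only [farPt, nearPt, map_sub, map_add, map_smul, dt_rot_right, cr_self, smul_eq_mul]
  ring

lemma nearSign_neg {r r' : RedLabel G} (hw : ∀ d, IsWedgeCenter D d (w d)) (h : r.opp = r'.opp)
    (hne : r ≠ r') : nearSign D w r' = - nearSign D w r := by
  have hee : r.edge ≠ r'.edge := fun he => hne (RedLabel.ext' he h)
  have hs := (hw r.opp).cr_neg r.same_vertex.symm (by rw [h]; exact r'.same_vertex.symm)
    r.ne.symm (by rw [h]; exact r'.ne.symm) hee
  have h0 := (hw r.opp).cr_ne_zero r.same_vertex.symm (by rw [h]; exact r'.same_vertex.symm)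
    r.ne.symm (by rw [h]; exact r'.ne.symm) hee
  rw [nearSign, nearSign, ← h, hs]
  apply sgn_of_mul_neg
  nlinarith [mul_self_pos.2 h0]

lemma farSign_neg {r r' : RedLabel G} (hw : ∀ d, IsWedgeCenter D d (w d)) (h : r.edge = r'.edge)
    (hne : r ≠ r') : farSign D w r' = - farSign D w r := by
  have hoo : r'.opp ≠ r.opp := fun ho => hne (RedLabel.ext' h ho.symm)
  rw [farSign, farSign, ← h]
  apply sgn_of_mul_neg
  refine (hw r.opp).opposite_sides (hw r'.opp) r.same_vertex.symm ?_ r.ne.symm hoo ?_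
  · rw [r'.same_vertex, ← h, r.same_vertex]
  · rw [h]; exact r'.ne.symm

/-- The conditions on the radius needed to complete the construction. -/
structure SmallRadius (D : StraightLineDrawing G) (w : G.Dart → Plane) (ρ : ℝ) : Prop where
  pos : 0 < ρ
  disks : ∀ q q' : GuideDisk G, q ≠ q' → Disjoint (Metric.closedBall (diskCenter D w q) ρ)
    (Metric.closedBall (diskCenter D w q') ρ)
  onEdge_edge : ∀ (d : G.Dart) (a b : V), G.Adj a b → s(a, b) ≠ d.edge →
    Disjoint (Metric.closedBall (diskCenter D w (.onEdge d)) ρ) (segment ℝ (D.pos a) (D.pos b))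
  onEdge_vertex : ∀ (d : G.Dart) (v : V),
    Disjoint (Metric.closedBall (diskCenter D w (.onEdge d)) ρ) {D.pos v}
  inWedge_edge : ∀ (d : G.Dart) (a b : V), G.Adj a b →
    Disjoint (Metric.closedBall (diskCenter D w (.inWedge d)) ρ) (segment ℝ (D.pos a) (D.pos b))
  no_transversal : ∀ d e : G.Dart, e.fst = d.fst → e ≠ d → ¬ ∃ x y : Plane,
    (segment ℝ x y ∩ Metric.closedBall (diskCenter D w (.onEdge d)) ρ).Nonempty ∧
    (segment ℝ x y ∩ Metric.closedBall (diskCenter D w (.onEdge d.symm)) ρ).Nonempty ∧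
    (segment ℝ x y ∩ Metric.closedBall (diskCenter D w (.inWedge e)) ρ).Nonempty
  nearSide : ∀ r : RedLabel G, ∀ z ∈ segment ℝ (nearPt D w ρ r) (farPt D w ρ r),
      nearSign D w r * cr (unitTo D r.opp (w r.opp)) (D.pos r.opp.fst) <
        nearSign D w r * cr (unitTo D r.opp (w r.opp)) z
  farSide : ∀ r : RedLabel G, ∀ z ∈ segment ℝ (nearPt D w ρ r) (farPt D w ρ r),
      farSign D w r * cr (dir D r.edge) (D.pos r.edge.fst) < farSign D w r * cr (dir D r.edge) z
  dt_dir : ∀ r : RedLabel G, dt (dir D r.edge) (nearPt D w ρ r - farPt D w ρ r) ≠ 0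
  dt_unitTo : ∀ r : RedLabel G,
    dt (unitTo D r.opp (w r.opp)) (farPt D w ρ r - nearPt D w ρ r) ≠ 0

lemma isClosed_segment (x y : Plane) : IsClosed (segment ℝ x y) := by
  rw [segment_eq_image_lineMap]
  exact (isCompact_Icc.image (by fun_prop)).isClosed

/-- Each requirement is a finite family of conditions, every one valid for all small positive `ρ`.
-/
lemma exists_smallRadius (hw : ∀ d, IsWedgeCenter D d (w d))
    (hcub : ∀ v, (G.neighborSet v).ncard = 3) :
    ∃ ρ, SmallRadius D w ρ := by
  have hd : Finite G.Dart := Finite.of_injective (fun d : G.Dart => d.toProd)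
    fun d d' h => SimpleGraph.Dart.ext _ _ h
  have hS : Finite (SegLabel G) := finite_segLabel
  have hr : Finite (RedLabel G) := Finite.of_injective (SegLabel.red : RedLabel G → SegLabel G)
    fun a b h => by injection h
  have hq : Finite (GuideDisk G) := Finite.of_injective (SegLabel.blue : GuideDisk G → SegLabel G)
    fun a b h => by injection h
  have h1 : ∀ᶠ ρ in 𝓝[>] (0 : ℝ), ∀ q q' : GuideDisk G, q ≠ q' →
      Disjoint (Metric.closedBall (diskCenter D w q) ρ) (Metric.closedBall (diskCenter D w q') ρ) := by
    simp only [eventually_all]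
    exact fun q q' h => eventually_disjoint_closedBalls ((diskCenter_injective hw hcub).ne h)
  have h2 : ∀ᶠ ρ in 𝓝[>] (0 : ℝ), ∀ (d : G.Dart) (a b : V), G.Adj a b → s(a, b) ≠ d.edge →
      Disjoint (Metric.closedBall (diskCenter D w (.onEdge d)) ρ)
        (segment ℝ (D.pos a) (D.pos b)) := by
    simp only [eventually_all]
    exact fun d a b hab hne => eventually_disjoint_closedBall (isClosed_segment _ _)
      (diskCenter_onEdge_notMem w d hab hne)
  have h3 : ∀ᶠ ρ in 𝓝[>] (0 : ℝ), ∀ (d : G.Dart) (v : V),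
      Disjoint (Metric.closedBall (diskCenter D w (.onEdge d)) ρ) {D.pos v} := by
    simp only [eventually_all]
    exact fun d v => eventually_disjoint_closedBall isClosed_singleton
      (diskCenter_onEdge_ne_pos w d v)
  have h4 : ∀ᶠ ρ in 𝓝[>] (0 : ℝ), ∀ (d : G.Dart) (a b : V), G.Adj a b →
      Disjoint (Metric.closedBall (diskCenter D w (.inWedge d)) ρ)
        (segment ℝ (D.pos a) (D.pos b)) := by
    simp only [eventually_all]
    exact fun d a b hab => eventually_disjoint_closedBall (isClosed_segment _ _)
      ((hw d).notMem_edge hcub hab)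
  have h5 : ∀ᶠ ρ in 𝓝[>] (0 : ℝ), ∀ d e : G.Dart, e.fst = d.fst → e ≠ d → ¬ ∃ x y : Plane,
      (segment ℝ x y ∩ Metric.closedBall (diskCenter D w (.onEdge d)) ρ).Nonempty ∧
      (segment ℝ x y ∩ Metric.closedBall (diskCenter D w (.onEdge d.symm)) ρ).Nonempty ∧
      (segment ℝ x y ∩ Metric.closedBall (diskCenter D w (.inWedge e)) ρ).Nonempty := by
    simp only [eventually_all]
    intro d e he hne
    refine eventually_no_transversal ?_
    have h0 := cr_dir_unitTo_ne_zero hw hcub ⟨d, e, he, hne⟩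
    have hL := len_pos D d
    have hδ := clearance_pos' D d
    have e1 : diskCenter D w (.onEdge d.symm) - diskCenter D w (.onEdge d) =
        (-(1 / 5 * len D d)) • dir D d := by
      rw [diskCenter_onEdge_symm, diskCenter]; module
    have e2 : diskCenter D w (.inWedge e) - diskCenter D w (.onEdge d) =
        (D.clearance / 5) • unitTo D e (w e) - (3 / 5 * len D d) • dir D d := by
      rw [smul_unitTo, diskCenter, diskCenter, he]; abel
    rw [e1, e2, cr_smul_left, map_sub, map_smul, map_smul, cr_self, smul_zero, sub_zero]
    exact mul_ne_zero (neg_ne_zero.2 (by positivity)) (smul_ne_zero (by positivity) h0)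
  have h6 := eventually_all.2 fun r => eventually_nearSide hw hcub r
  have h7 := eventually_all.2 fun r => eventually_farSide hw hcub r
  have h8 := eventually_all.2 fun r => eventually_dt_dir_ne hw r
  have h9 := eventually_all.2 fun r => eventually_dt_unitTo_ne hw hcub r
  have hall : ∀ᶠ ρ in 𝓝[>] (0 : ℝ), SmallRadius D w ρ := by
    filter_upwards [self_mem_nhdsWithin, h1, h2, h3, h4, h5, h6, h7, h8, h9] with
      ρ a0 a1 a2 a3 a4 a5 a6 a7 a8 a9
    exact ⟨a0, a1, a2, a3, a4, a5, a6, a7, a8, a9⟩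
  exact hall.exists

/-- The two red ends in a disk differ by a multiple of a rotated unit vector, so the hypotheses of
`RedBlue.exists_blue` become the conditions `dt_dir` and `dt_unitTo`. -/
lemma SmallRadius.exists_blue (hw : ∀ d, IsWedgeCenter D d (w d))
    (hcub : ∀ v, (G.neighborSet v).ncard = 3) {ρ : ℝ}
    (hρ : SmallRadius D w ρ) (q : GuideDisk G) :
    ∃ B B' : Plane, B ∈ Metric.closedBall (diskCenter D w q) ρ ∧
      B' ∈ Metric.closedBall (diskCenter D w q) ρ ∧ B ≠ B' ∧
      ∀ r : RedLabel G, r.Touches q → nearPt D w ρ r ≠ farPt D w ρ r ∧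
        ∃ x, x ∈ openSegment ℝ B B' ∧ x ∈ openSegment ℝ (nearPt D w ρ r) (farPt D w ρ r) ∧
          segment ℝ B B' ∩ segment ℝ (nearPt D w ρ r) (farPt D w ρ r) = {x} := by
  have hnf : ∀ r : RedLabel G, nearPt D w ρ r ≠ farPt D w ρ r := fun r h => by
    have := hρ.dt_dir r; rw [h, sub_self, map_zero] at this; exact this rfl
  have h0 := hρ.pos
  have sne : ∀ c, sgn c ≠ 0 := fun c h => by have := abs_sgn c; rw [h] at this; norm_num at this
  obtain ⟨r, r', hne, hr⟩ := exists_touching_pair hcub q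
  have ht := (hr r).2 (Or.inl rfl)
  have ht' := (hr r').2 (Or.inr rfl)
  have crrot : ∀ u x : Plane, cr (rot u) x = - dt u x := fun u x => by
    simp only [cr_apply, dt_apply, rot_zero, rot_one]; ring
  rcases q with d | d
  · have he : r.edge = d := by
      rcases ht with h | h
      · cases h
      · injection h with h; exact h.symm
    have he' : r'.edge = d := by
      rcases ht' with h | h
      · cases h
      · injection h with h; exact h.symm
    have hdiff : farPt D w ρ r - farPt D w ρ r' = (ρ * farSign D w r) • rot (dir D d) := by
      rw [farPt, farPt, farSign_neg hw (he.trans he'.symm) hne, he, he']; module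
    have k : ρ * farSign D w r ≠ 0 := mul_ne_zero h0.ne' (sne _)
    obtain ⟨B, B', hB, hB', hBB, hx, hx'⟩ := RedBlue.exists_blue
      (c := diskCenter D w (.onEdge d)) (ρ := ρ)
      (P₁ := farPt D w ρ r) (Q₁ := nearPt D w ρ r) (P₂ := farPt D w ρ r') (Q₂ := nearPt D w ρ r')
      (by rw [← he]; exact farPt_mem h0 r) (by rw [← he']; exact farPt_mem h0 r')
      (by rw [hdiff, cr_smul_left, crrot, ← he]
          exact mul_ne_zero k (neg_ne_zero.2 (hρ.dt_dir r)))
      (by rw [hdiff, cr_smul_left, crrot, ← he']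
          exact mul_ne_zero k (neg_ne_zero.2 (hρ.dt_dir r')))
    refine ⟨B, B', hB, hB', hBB, fun s hs => ⟨hnf s, ?_⟩⟩
    rw [openSegment_symm ℝ (nearPt D w ρ s), segment_symm ℝ (nearPt D w ρ s)]
    rcases (hr s).1 hs with rfl | rfl
    · exact hx
    · exact hx'
  · have he : r.opp = d := by
      rcases ht with h | h
      · injection h with h; exact h.symm
      · cases h
    have he' : r'.opp = d := by
      rcases ht' with h | h
      · injection h with h; exact h.symm
      · cases h
    have hdiff : nearPt D w ρ r - nearPt D w ρ r' =
        (ρ * nearSign D w r) • rot (unitTo D d (w d)) := by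
      rw [nearPt, nearPt, nearSign_neg hw (he.trans he'.symm) hne, he, he']; module
    have k : ρ * nearSign D w r ≠ 0 := mul_ne_zero h0.ne' (sne _)
    obtain ⟨B, B', hB, hB', hBB, hx, hx'⟩ := RedBlue.exists_blue
      (c := diskCenter D w (.inWedge d)) (ρ := ρ)
      (P₁ := nearPt D w ρ r) (Q₁ := farPt D w ρ r) (P₂ := nearPt D w ρ r') (Q₂ := farPt D w ρ r')
      (by rw [← he]; exact nearPt_mem hw h0 r) (by rw [← he']; exact nearPt_mem hw h0 r')
      (by rw [hdiff, cr_smul_left, crrot, ← he]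
          exact mul_ne_zero k (neg_ne_zero.2 (hρ.dt_unitTo r)))
      (by rw [hdiff, cr_smul_left, crrot, ← he']
          exact mul_ne_zero k (neg_ne_zero.2 (hρ.dt_unitTo r')))
    refine ⟨B, B', hB, hB', hBB, fun s hs => ⟨hnf s, ?_⟩⟩
    rcases (hr s).1 hs with rfl | rfl
    · exact hx
    · exact hx'

/-- The line of the edge, or of the bisector, strictly separates two red segments that share the
disk. -/
lemma SmallRadius.red_disjoint (hw : ∀ d, IsWedgeCenter D d (w d))
    {ρ : ℝ} (hρ : SmallRadius D w ρ) {q : GuideDisk G}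
    {r r' : RedLabel G} (hne : r ≠ r') (ht : r.Touches q) (ht' : r'.Touches q) :
    Disjoint (segment ℝ (nearPt D w ρ r) (farPt D w ρ r))
      (segment ℝ (nearPt D w ρ r') (farPt D w ρ r')) := by
  rw [Set.disjoint_left]
  intro z hz hz'
  rcases q with d | d
  · have he : r.edge = r'.edge := by
      rcases ht with h | h <;> rcases ht' with h' | h'
      · cases h
      · cases h
      · cases h'
      · injection h with h; injection h' with h'; exact h.symm.trans h'
    have h1 := hρ.farSide r z hz
    have h2 := hρ.farSide r' z hz'
    rw [farSign_neg hw he hne, ← he] at h2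
    linarith
  · have he : r.opp = r'.opp := by
      rcases ht with h | h <;> rcases ht' with h' | h'
      · injection h with h; injection h' with h'; exact h.symm.trans h'
      · cases h'
      · cases h
      · cases h
    have h1 := hρ.nearSide r z hz
    have h2 := hρ.nearSide r' z hz'
    rw [nearSign_neg hw he hne, ← he] at h2
    linarith

theorem exists_valid (D : StraightLineDrawing G) (hcub : ∀ v, (G.neighborSet v).ncard = 3) :
    ∃ C : Choices D, C.Valid := by
  choose w hw using fun d : G.Dart => exists_isWedgeCenter (D := D) hcub d
  obtain ⟨ρ, hρ⟩ := exists_smallRadius hw hcub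
  choose B B' hB hB' hBB hcross using fun q => hρ.exists_blue hw hcub q
  let C : Choices D := ⟨w, ρ, nearPt D w ρ, farPt D w ρ, B, B'⟩
  have hcen : ∀ q, C.center q = diskCenter D w q := by
    rintro (d | d)
    · exact center_onEdge C d
    · rfl
  have hdisk : ∀ q, C.disk q = Metric.closedBall (diskCenter D w q) ρ := fun q => by
    rw [Choices.disk, hcen]
  refine ⟨C, ?_⟩
  constructor
  · exact hw
  · exact hρ.pos
  · intro q q' h; rw [hdisk, hdisk]; exact hρ.disks q q' h
  · intro d a b hab hne; rw [hdisk]; exact hρ.onEdge_edge d a b hab hne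
  · intro d v; rw [hdisk]; exact Set.disjoint_singleton_right.1 (hρ.onEdge_vertex d v)
  · intro d a b hab; rw [hdisk]; exact hρ.inWedge_edge d a b hab
  -- Every vertex is an endpoint of an edge, so the vertex rule for wedge disks follows from the
  -- edge rule.
  · intro d v hv
    rw [hdisk] at hv
    obtain ⟨e, rfl⟩ := exists_dart hcub v
    exact Set.disjoint_left.1 (hρ.inWedge_edge d e.fst e.snd e.adj) hv (left_mem_segment ℝ _ _)
  · intro d e he hne; rw [hdisk, hdisk, hdisk]; exact hρ.no_transversal d e he hne
  · intro r; rw [hdisk]; exact Metric.ball_subset_closedBall (nearPt_mem hw hρ.pos r)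
  · intro r; rw [hdisk]; exact Metric.ball_subset_closedBall (farPt_mem hρ.pos r)
  · intro q; rw [hdisk]; exact hB q
  · intro q; rw [hdisk]; exact hB' q
  · intro q r r' hne ht ht'; exact hρ.red_disjoint hw hne ht ht'
  · intro q r ht
    exact ⟨hBB q, (hcross q r ht).1, (hcross q r ht).2⟩

end Construct

end RedBlue

theorem mainTheorem3 {V : Type*} [Fintype V] (G : SimpleGraph V) [DecidableRel G.Adj]
    (hconn : G.Connected) (hreg : G.IsRegularOfDegree 3)
    (D : RedBlue.StraightLineDrawing G) :
    (∃ C : RedBlue.Choices D, C.Valid) ∧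
    ∀ C : RedBlue.Choices D, C.Valid →
      C.arrangement.IsRedBlueArrangement ∧
      ∃ f : {Z : Finset V // G.IsIndepSet (Z : Set V)} ≃
          {S : Finset (RedBlue.SegLabel G) // C.arrangement.IsMaxNonCrossing S},
        ∀ (Z : {Z : Finset V // G.IsIndepSet (Z : Set V)}) (k : ℕ),
          Z.1.card = k ↔ C.arrangement.redCount (f Z).1 = 6 * k := by
  have hcub : ∀ v, (G.neighborSet v).ncard = 3 := fun v => by
    rw [← Nat.card_coe_set_eq, Nat.card_eq_fintype_card, G.card_neighborSet_eq_degree]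
    exact hreg v
  exact ⟨RedBlue.exists_valid D hcub, fun C hC =>
    ⟨hC.isRedBlueArrangement hcub hconn, hC.exists_equiv hcub⟩⟩
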